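/- Let $k$ be a commutative ring and let $(\mathcal{A},\mathbb{E},\mathfrak{s})$ be a skeletally small, $k$-linear extriangulated category (in the sense of Nakaoka--Palu) that is weakly idempotent complete (WIC): every section has a cokernel. Let $\mathcal{N}\subseteq\mathcal{A}$ be an extension-closed full additive subcategory closed under isomorphisms and direct summands, with its restricted structure $(\mathcal{N},\mathbb{E}|_{\mathcal{N}},\mathfrak{s}|_{\mathcal{N}})$, and suppose: ($\spadesuit$) for every $\mathfrak{s}$-inflation $f\colon N_1\to B$ with $N_1\in\mathcal{N}$ there are $N_2\in\mathcal{N}$ and $b\colon B\to N_2$ such that $b\circ f$ is an $\mathfrak{s}|_{\mathcal{N}}$-inflation; and for every $\mathfrak{s}$-deflation $g\colon B\to N_3$ with $N_3\in\mathcal{N}$ there are $N_2\in\mathcal{N}$ and $b\colon N_2\to B$ such that $g\circ b$ is an $\mathfrak{s}|_{\mathcal{N}}$-deflation. Let $\mathrm{Inf}_{\mathcal{N}}$ be the class of $\mathfrak{s}$-inflations with cone in $\mathcal{N}$, $\mathrm{Def}_{\mathcal{N}}$ the class of $\mathfrak{s}$-deflations with cocone in $\mathcal{N}$, $\mathrm{Inf}^{\mathrm{sp}}_{\mathcal{N}}$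 the sections in $\mathrm{Inf}_{\mathcal{N}}$, $\mathrm{Def}^{\mathrm{sp}}_{\mathcal{N}}$ the retractions in $\mathrm{Def}_{\mathcal{N}}$, and $\mathcal{S}_{\mathcal{N}}$ the smallest class of morphisms closed under composition and containing $\mathrm{Inf}_{\mathcal{N}}\cup\mathrm{Def}_{\mathcal{N}}$. Then: 1. $\mathcal{N}$ is thick: it is closed under isomorphisms and direct summands, and if two terms of an $\mathfrak{s}$-conflation $A\to B\to C$ lie in $\mathcal{N}$, so does the third. 2. $\mathcal{S}_{\mathcal{N}}=\mathrm{Def}^{\mathrm{sp}}_{\mathcal{N}}\circ\mathrm{Inf}_{\mathcal{N}}=\mathrm{Def}_{\mathcal{N}}\circ\mathrm{Inf}^{\mathrm{sp}}_{\mathcal{N}}$. 3. $\mathcal{S}=\mathcal{S}_{\mathcal{N}}$ satisfies (MR1)--(MR4). Here $\mathcal{N}_{\mathcal{S}}$ is the full subcategory of objects $X$ with $X\to0$ and $0\to X$ in $\mathcal{S}$, $p\colon\mathcal{A}\to\overline{\mathcal{A}}=\mathcal{A}/[\mathcal{N}_{\mathcal{S}}]$, $f\mapsto\overline f$, is the ideal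 quotient, and $\overline{\mathcal{S}}$ is the closure of $p(\mathcal{S})$ under composition with isomorphisms. (MR1) $\overline{\mathcal{S}}$ has the 2-out-of-3 property for compositions. (MR2) $\overline{\mathcal{S}}$ is a (left and right) multiplicative system in $\overline{\mathcal{A}}$. (MR3) If $A\xrightarrow{x}B\xrightarrow{y}C\overset{\delta}{\dashrightarrow}$ and $A'\xrightarrow{x'}B'\xrightarrow{y'}C'\overset{\delta'}{\dashrightarrow}$ are $\mathfrak{s}$-triangles and $a\colon A\to A'$, $c\colon C\to C'$ satisfy $a_*\delta=c^*\delta'$ and $\overline a,\overline c\in\overline{\mathcal{S}}$, then there is $\overline b\in\overline{\mathcal{S}}(B,B')$ with $\overline b\,\overline x=\overline{x'}\,\overline a$ and $\overline c\,\overline y=\overline{y'}\,\overline b$. (MR4) The classes $\{\overline v\,\overline x\,\overline u\mid x \text{ an } \mathfrak{s}\text{-inflation},\ \overline u,\overline v\in\overline{\mathcal{S}}\}$ and $\{\overline v\,\overline y\,\overline u\mid y \text{ an } \mathfrak{s}\text{-deflation},\ \overline u,\overline v\in\overline{\mathcal{S}}\}$ are closed under composition in $\overline{\mathcal{A}}$.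 4. There are a skeletally small extriangulated category $(\mathcal{B},\mathbb{F},\mathfrak{t})=(\mathcal{A}/\mathcal{N},\widetilde{\mathbb{E}},\widetilde{\mathfrak{s}})$ and an exact functor $(Q,\mu)\colon\mathcal{A}\to\mathcal{B}$ such that $Q$ is a localization of $\mathcal{A}$ at $\mathcal{S}_{\mathcal{N}}$ and $$(\mathcal{N},\mathbb{E}|_{\mathcal{N}},\mathfrak{s}|_{\mathcal{N}})\xrightarrow{(\mathrm{inc},\iota)}(\mathcal{A},\mathbb{E},\mathfrak{s})\xrightarrow{(Q,\mu)}(\mathcal{B},\mathbb{F},\mathfrak{t})$$ is an exact sequence of extriangulated categories: $\mathcal{N}=\operatorname{Im}(\mathrm{inc})=\operatorname{Ker}Q$, and for every exact functor $(G,\psi)\colon\mathcal{A}\to\mathcal{A}'$ to an extriangulated category with $G|_{\mathcal{N}}=0$ there is a unique exact functor $(G',\psi')\colon\mathcal{B}\to\mathcal{A}'$ with $(G,\psi)=(G',\psi')\circ(Q,\mu)$. Moreover $\mathcal{B}$ carries a $k$-linear structure for which $Q$ is $k$-linear, and $G'$ is $k$-linear whenever $\mathcal{A}'$ is a $k$-linear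 category and $G$ is $k$-linear. -/

import Mathlib

open CategoryTheory CategoryTheory.Limits Opposite

universe w v u v₂ u₂ v₃ u₃

/-! # Extriangulated categories -/

namespace ET

section Bifunctor

variable {A : Type u} [Category.{v} A] (E : Aᵒᵖ ⥤ A ⥤ AddCommGrpCat.{w})

/-- The group `𝔼(C, X)` of extensions, contravariant in `C` and covariant in `X`. -/
abbrev Ext (C X : A) : Type w := (E.obj (op C)).obj X

/-- `a_* δ = 𝔼(C, a)(δ)`. -/
def push {C X X' : A} (a : X ⟶ X') : Ext E C X →+ Ext E C X' :=
  ((E.obj (op C)).map a).hom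

/-- `c^* δ = 𝔼(c, X)(δ)`. -/
def pull {C C' X : A} (c : C' ⟶ C) : Ext E C X →+ Ext E C' X :=
  ((E.map c.op).app X).hom

/-- The direct sum `δ ⊕ δ' ∈ 𝔼(C ⊞ C', X ⊞ X')`, i.e. the element whose four components are
`δ, 0, 0, δ'`. -/
noncomputable def extSum [HasZeroMorphisms A] [HasBinaryBiproducts A] {C X C' X' : A}
    (δ : Ext E C X) (δ' : Ext E C' X') : Ext E (C ⊞ C') (X ⊞ X') :=
  push E biprod.inl (pull E biprod.fst δ) + push E biprod.inr (pull E biprod.snd δ')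

end Bifunctor

/-- An extriangulated structure on an additive category `A`: a biadditive bifunctor `E` together
with an additive realization satisfying (ET1)-(ET4), (ET3)ᵒᵖ and (ET4)ᵒᵖ. The realization, a map
sending `δ ∈ 𝔼(C, X)` to an equivalence class of sequences `X ⟶ Y ⟶ C`, is encoded by the relation
`Realizes x y δ`, "the sequence `(x, y)` lies in the class `𝔰(δ)`"; the fields `exists_realizes`,
`realizes_of_iso`, `iso_of_realizes` say that for each `δ` the sequences in relation with `δ` form
exactly one equivalence class. -/
class Extriangulated (A : Type u) [Category.{v} A] [Preadditive A] [HasZeroObject A]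
    [HasBinaryBiproducts A] where
  E : Aᵒᵖ ⥤ A ⥤ AddCommGrpCat.{v}
  additive_right : ∀ C : Aᵒᵖ, (E.obj C).Additive
  additive_left : ∀ X : A, (E.flip.obj X).Additive
  Realizes : ∀ {X Y Z : A}, (X ⟶ Y) → (Y ⟶ Z) → Ext E Z X → Prop
  exists_realizes : ∀ {Z X : A} (δ : Ext E Z X),
    ∃ (Y : A) (x : X ⟶ Y) (y : Y ⟶ Z), Realizes x y δ
  realizes_of_iso : ∀ {X Y Y' Z : A} {x : X ⟶ Y} {y : Y ⟶ Z} {δ : Ext E Z X} (e : Y ≅ Y'),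
    Realizes x y δ → Realizes (x ≫ e.hom) (e.inv ≫ y) δ
  iso_of_realizes : ∀ {X Y Y' Z : A} {x : X ⟶ Y} {y : Y ⟶ Z} {x' : X ⟶ Y'} {y' : Y' ⟶ Z}
    {δ : Ext E Z X}, Realizes x y δ → Realizes x' y' δ →
    ∃ e : Y ≅ Y', x ≫ e.hom = x' ∧ e.hom ≫ y' = y
  -- morphisms of extensions lift to morphisms of realizing sequences
  exists_mid : ∀ {X Y Z X' Y' Z' : A} {x : X ⟶ Y} {y : Y ⟶ Z} {δ : Ext E Z X}
    {x' : X' ⟶ Y'} {y' : Y' ⟶ Z'} {δ' : Ext E Z' X'} (a : X ⟶ X') (c : Z ⟶ Z'),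
    Realizes x y δ → Realizes x' y' δ' → push E a δ = pull E c δ' →
    ∃ b : Y ⟶ Y', x ≫ b = a ≫ x' ∧ y ≫ c = b ≫ y'
  -- the realization is additive
  realizes_zero : ∀ (X Z : A),
    Realizes (biprod.inl : X ⟶ X ⊞ Z) (biprod.snd : X ⊞ Z ⟶ Z) (0 : Ext E Z X)
  realizes_sum : ∀ {X Y Z X' Y' Z' : A} {x : X ⟶ Y} {y : Y ⟶ Z} {δ : Ext E Z X}
    {x' : X' ⟶ Y'} {y' : Y' ⟶ Z'} {δ' : Ext E Z' X'},
    Realizes x y δ → Realizes x' y' δ' →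
    Realizes (biprod.map x x') (biprod.map y y') (extSum E δ δ')
  et3 : ∀ {X Y Z X' Y' Z' : A} {x : X ⟶ Y} {y : Y ⟶ Z} {δ : Ext E Z X}
    {x' : X' ⟶ Y'} {y' : Y' ⟶ Z'} {δ' : Ext E Z' X'} (a : X ⟶ X') (b : Y ⟶ Y'),
    Realizes x y δ → Realizes x' y' δ' → x ≫ b = a ≫ x' →
    ∃ c : Z ⟶ Z', y ≫ c = b ≫ y' ∧ push E a δ = pull E c δ'
  et3_op : ∀ {X Y Z X' Y' Z' : A} {x : X ⟶ Y} {y : Y ⟶ Z} {δ : Ext E Z X}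
    {x' : X' ⟶ Y'} {y' : Y' ⟶ Z'} {δ' : Ext E Z' X'} (b : Y ⟶ Y') (c : Z ⟶ Z'),
    Realizes x y δ → Realizes x' y' δ' → y ≫ c = b ≫ y' →
    ∃ a : X ⟶ X', x ≫ b = a ≫ x' ∧ push E a δ = pull E c δ'
  et4 : ∀ {X Y D Z F : A} {f : X ⟶ Y} {f' : Y ⟶ D} {δ : Ext E D X}
    {g : Y ⟶ Z} {g' : Z ⟶ F} {ρ : Ext E F Y},
    Realizes f f' δ → Realizes g g' ρ →
    ∃ (M : A) (h' : Z ⟶ M) (d : D ⟶ M) (e : M ⟶ F) (δ' : Ext E M X),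
      Realizes (f ≫ g) h' δ' ∧ Realizes d e (push E f' ρ) ∧
      f' ≫ d = g ≫ h' ∧ h' ≫ e = g' ∧ pull E d δ' = δ ∧ pull E e ρ = push E f δ'
  et4_op : ∀ {D X Y F Z : A} {f' : D ⟶ X} {f : X ⟶ Y} {δ : Ext E Y D}
    {g' : F ⟶ Y} {g : Y ⟶ Z} {ρ : Ext E Z F},
    Realizes f' f δ → Realizes g' g ρ →
    ∃ (M : A) (h' : M ⟶ X) (d : D ⟶ M) (e : M ⟶ F) (δ' : Ext E Z M),
      Realizes h' (f ≫ g) δ' ∧ Realizes d e (pull E g' δ) ∧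
      d ≫ h' = f' ∧ h' ≫ f = e ≫ g' ∧ push E e δ' = ρ ∧ push E d δ = pull E g δ'

open Extriangulated

section Basic

variable {A : Type u} [Category.{v} A] [Preadditive A] [HasZeroObject A]
  [HasBinaryBiproducts A] [Extriangulated A]

/-- `X ⟶ Y ⟶ Z` is an `𝔰`-conflation. -/
def IsConflation {X Y Z : A} (x : X ⟶ Y) (y : Y ⟶ Z) : Prop :=
  ∃ δ : Ext (E (A := A)) Z X, Realizes x y δ

def IsInflation {X Y : A} (x : X ⟶ Y) : Prop :=
  ∃ (Z : A) (y : Y ⟶ Z), IsConflation x y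

def IsDeflation {Y Z : A} (y : Y ⟶ Z) : Prop :=
  ∃ (X : A) (x : X ⟶ Y), IsConflation x y

/-- An extension-closed (full, additive) subcategory: it contains a zero object, is closed under
isomorphisms, and contains the middle term of a conflation whenever it contains the outer terms
(in particular it is closed under finite direct sums). -/
class IsExtensionClosed (N : ObjectProperty A) : Prop extends
    N.ContainsZero, N.IsClosedUnderIsomorphisms where
  mid : ∀ {X Y Z : A} {x : X ⟶ Y} {y : Y ⟶ Z}, IsConflation x y → N X → N Z → N Y

/-- Closure under direct summands. -/
def IsSummandClosed (N : ObjectProperty A) : Prop :=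
  ∀ X Y : A, N (X ⊞ Y) → N X ∧ N Y

/-- Thick subcategories: closed under isomorphisms and direct summands, and 2-out-of-3 for
conflations. -/
structure IsThick (N : ObjectProperty A) : Prop where
  iso : N.IsClosedUnderIsomorphisms
  summand : IsSummandClosed N
  left : ∀ {X Y Z : A} {x : X ⟶ Y} {y : Y ⟶ Z}, IsConflation x y → N Y → N Z → N X
  mid : ∀ {X Y Z : A} {x : X ⟶ Y} {y : Y ⟶ Z}, IsConflation x y → N X → N Z → N Y
  right : ∀ {X Y Z : A} {x : X ⟶ Y} {y : Y ⟶ Z}, IsConflation x y → N X → N Y → N Z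

end Basic

/-- Weak idempotent completeness (WIC): every section has a cokernel. -/
def IsWIC (A : Type u) [Category.{v} A] [HasZeroMorphisms A] : Prop :=
  ∀ {X Y : A} (f : X ⟶ Y), IsSplitMono f → HasCokernel f

section Transport

variable {A : Type u} [Category.{v} A] (E : Aᵒᵖ ⥤ A ⥤ AddCommGrpCat.{w})

lemma push_id {C X : A} (δ : Ext E C X) : push E (𝟙 X) δ = δ := by simp [push]

lemma push_comp {C X X' X'' : A} (a : X ⟶ X') (a' : X' ⟶ X'') (δ : Ext E C X) :
    push E (a ≫ a') δ = push E a' (push E a δ) := by simp [push]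

lemma pull_id {C X : A} (δ : Ext E C X) : pull E (𝟙 C) δ = δ := by simp [pull]

lemma pull_comp {C C' C'' X : A} (c : C' ⟶ C) (c' : C'' ⟶ C') (δ : Ext E C X) :
    pull E (c' ≫ c) δ = pull E c' (pull E c δ) := by simp [pull]

lemma push_pull {C C' X X' : A} (a : X ⟶ X') (c : C' ⟶ C) (δ : Ext E C X) :
    push E a (pull E c δ) = pull E c (push E a δ) :=
  (ConcreteCategory.congr_hom ((E.map c.op).naturality a) δ).symm

end Transport

section

variable {A : Type u} [Category.{v} A] [Preadditive A] [HasZeroObject A]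
  [HasBinaryBiproducts A] [Extriangulated A]

open ZeroObject in
lemma isIso_of_endo {X Y Z : A} {x : X ⟶ Y} {y : Y ⟶ Z} {δ : Ext (E (A := A)) Z X}
    (h : Realizes x y δ) (b : Y ⟶ Y) (h₁ : x ≫ b = x) (h₂ : b ≫ y = y) : IsIso b := by
  obtain ⟨s, hs, -⟩ := et3 (A := A) (a := (0 : X ⟶ 0)) (b := (b - 𝟙 Y) ≫ biprod.inr) h
    (realizes_zero (0 : A) Y) (by simp [reassoc_of% h₁])
  simp only [Category.assoc, biprod.inr_snd, Category.comp_id] at hs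
  have h0 : (b - 𝟙 Y) ≫ (b - 𝟙 Y) = 0 := by
    conv_lhs => rw [← hs]
    rw [hs, ← hs, ← Category.assoc, hs]
    simp [h₂]
  have h1 : b ≫ b = b + b - 𝟙 Y := by
    simp only [Preadditive.sub_comp, Preadditive.comp_sub, Category.id_comp,
      Category.comp_id] at h0
    rw [sub_eq_zero] at h0
    rw [eq_sub_iff_add_eq, ← sub_eq_zero]
    rw [← sub_eq_zero] at h0
    rw [← h0]
    abel
  refine ⟨𝟙 Y + 𝟙 Y - b, ?_, ?_⟩ <;>
    simp [Preadditive.sub_comp, Preadditive.comp_sub, Preadditive.add_comp,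
      Preadditive.comp_add, h1]

/-- Realizations may be transported along isomorphisms of the outer terms. -/
lemma realizes_transport {X Y Z X' Z' : A} {x : X ⟶ Y} {y : Y ⟶ Z} {δ : Ext (E (A := A)) Z X}
    (h : Realizes x y δ) (α : X ≅ X') (γ : Z ≅ Z') :
    Realizes (α.inv ≫ x) (y ≫ γ.hom) (push E α.hom (pull E γ.inv δ)) := by
  obtain ⟨M, x', y', h'⟩ := exists_realizes (push E α.hom (pull E γ.inv δ))
  obtain ⟨b, hb₁, hb₂⟩ := exists_mid α.hom γ.hom h h' (by
    rw [push_pull, ← pull_comp, Iso.hom_inv_id, pull_id])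
  obtain ⟨b', hb₁', hb₂'⟩ := exists_mid α.inv γ.inv h' h (by
    rw [← push_comp, Iso.hom_inv_id, push_id])
  have i₁ : IsIso (b ≫ b') := isIso_of_endo h _ (by
    rw [reassoc_of% hb₁, hb₁', Iso.hom_inv_id_assoc]) (by
    rw [Category.assoc, ← hb₂', ← reassoc_of% hb₂, Iso.hom_inv_id, Category.comp_id])
  have i₂ : IsIso (b' ≫ b) := isIso_of_endo h' _ (by
    rw [reassoc_of% hb₁', hb₁, Iso.inv_hom_id_assoc]) (by
    rw [Category.assoc, ← hb₂, ← reassoc_of% hb₂', Iso.inv_hom_id, Category.comp_id])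
  have : IsSplitMono b := IsSplitMono.mk' ⟨b' ≫ inv (b ≫ b'), by
    rw [← Category.assoc, IsIso.hom_inv_id]⟩
  have : IsSplitEpi b := IsSplitEpi.mk' ⟨inv (b' ≫ b) ≫ b', by
    rw [Category.assoc, IsIso.inv_hom_id]⟩
  have : IsIso b := isIso_of_epi_of_isSplitMono b
  have := realizes_of_iso (asIso b).symm h'
  convert this using 1
  · simp only [Iso.symm_hom, asIso_inv]
    rw [IsIso.eq_comp_inv, Category.assoc, hb₁, Iso.inv_hom_id_assoc]
  · simpa using hb₂

end

/-! ## Extension-closed subcategories as extriangulated categories -/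

section Restriction

variable {A : Type u} [Category.{v} A] [Preadditive A] [HasZeroObject A]
  [HasBinaryBiproducts A] [Extriangulated A]
variable (N : ObjectProperty A) [IsExtensionClosed N]

lemma prop_biprod {X Y : A} (hX : N X) (hY : N Y) : N (X ⊞ Y) :=
  IsExtensionClosed.mid ⟨0, realizes_zero X Y⟩ hX hY

/-- The binary bicone in `N` on the biproduct of `A`. -/
noncomputable def subBicone (X Y : N.FullSubcategory) : BinaryBicone X Y where
  pt := ⟨X.obj ⊞ Y.obj, prop_biprod N X.property Y.property⟩
  fst := ObjectProperty.homMk biprod.fst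
  snd := ObjectProperty.homMk biprod.snd
  inl := ObjectProperty.homMk biprod.inl
  inr := ObjectProperty.homMk biprod.inr
  inl_fst := by ext; simp
  inl_snd := by ext; simp
  inr_fst := by ext; simp
  inr_snd := by ext; simp

instance : HasBinaryBiproducts N.FullSubcategory :=
  ⟨fun X Y => HasBinaryBiproduct.mk ⟨subBicone N X Y, isBinaryBilimitOfTotal _ (by
    ext
    exact biprod.total)⟩⟩

/-- The biproduct of `N` is identified with that of `A`. -/
noncomputable def subBiprodIso (X Y : N.FullSubcategory) : X.obj ⊞ Y.obj ≅ (X ⊞ Y).obj where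
  hom := biprod.fst ≫ (biprod.inl : X ⟶ X ⊞ Y).hom + biprod.snd ≫ (biprod.inr : Y ⟶ X ⊞ Y).hom
  inv := (biprod.fst : X ⊞ Y ⟶ X).hom ≫ biprod.inl + (biprod.snd : X ⊞ Y ⟶ Y).hom ≫ biprod.inr
  hom_inv_id := by
    have h1 := congrArg (·.hom) (biprod.inl_fst (X := X) (Y := Y))
    have h2 := congrArg (·.hom) (biprod.inl_snd (X := X) (Y := Y))
    have h3 := congrArg (·.hom) (biprod.inr_fst (X := X) (Y := Y))
    have h4 := congrArg (·.hom) (biprod.inr_snd (X := X) (Y := Y))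
    change _ ≫ _ = 𝟙 _ at h1
    change _ ≫ _ = 0 at h2
    change _ ≫ _ = 0 at h3
    change _ ≫ _ = 𝟙 _ at h4
    simp [Preadditive.comp_add, Preadditive.add_comp, reassoc_of% h1, reassoc_of% h2,
      reassoc_of% h3, reassoc_of% h4]
  inv_hom_id := by
    have h := congrArg (·.hom) (biprod.total (X := X) (Y := Y))
    change _ ≫ _ + _ ≫ _ = 𝟙 _ at h
    simpa [Preadditive.comp_add, Preadditive.add_comp] using h

/-- The restriction `𝔼|_N`. -/
abbrev subE : (N.FullSubcategory)ᵒᵖ ⥤ N.FullSubcategory ⥤ AddCommGrpCat.{v} :=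
  N.ι.op ⋙ E (A := A) ⋙ (Functor.whiskeringLeft _ _ _).obj N.ι

/-- The restricted structure `(N, 𝔼|_N, 𝔰|_N)` on an extension-closed subcategory: a sequence in
`N` realizes `δ` if it does so in `A`. -/
noncomputable instance : Extriangulated N.FullSubcategory where
  E := subE N
  additive_right C := by
    have := additive_right (A := A) (op C.unop.obj)
    exact ⟨fun {X Y f g} => (E.obj (op C.unop.obj)).map_add (f := f.hom) (g := g.hom)⟩
  additive_left X := by
    have := additive_left (A := A) X.obj
    exact ⟨fun {C D f g} =>
      ((E (A := A)).flip.obj X.obj).map_add (f := f.unop.hom.op) (g := g.unop.hom.op)⟩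
  Realizes x y δ := Realizes (A := A) x.hom y.hom δ
  exists_realizes {Z X} δ := by
    obtain ⟨Y, x, y, h⟩ := exists_realizes (A := A) (Z := Z.obj) (X := X.obj) δ
    exact ⟨⟨Y, IsExtensionClosed.mid ⟨δ, h⟩ X.property Z.property⟩,
      ObjectProperty.homMk x, ObjectProperty.homMk y, h⟩
  realizes_of_iso e h := realizes_of_iso (A := A) (N.ι.mapIso e) h
  iso_of_realizes h h' := by
    obtain ⟨e, h1, h2⟩ := iso_of_realizes (A := A) h h'
    exact ⟨ObjectProperty.isoMk _ e, by ext; exact h1, by ext; exact h2⟩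
  exists_mid a c h h' w := by
    obtain ⟨b, h1, h2⟩ := exists_mid (A := A) a.hom c.hom h h' w
    exact ⟨ObjectProperty.homMk b, by ext; exact h1, by ext; exact h2⟩
  realizes_zero X Z := by
    have h := realizes_of_iso (subBiprodIso N X Z) (realizes_zero X.obj Z.obj)
    convert h using 1
    · simp [subBiprodIso]
    · simp [subBiprodIso, Preadditive.add_comp]
  realizes_sum {X Y Z X' Y' Z' x y δ x' y' δ'} h h' := by
    have h := realizes_of_iso (subBiprodIso N Y Y') (realizes_transport
      (realizes_sum (A := A) h h') (subBiprodIso N X X') (subBiprodIso N Z Z'))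
    convert h using 1
    · rw [biprod.map_eq]
      change _ ≫ _ ≫ _ + _ ≫ _ ≫ _ = _
      simp [subBiprodIso, Preadditive.add_comp, Preadditive.comp_add]
    · rw [biprod.map_eq]
      change _ ≫ _ ≫ _ + _ ≫ _ ≫ _ = _
      simp [subBiprodIso, Preadditive.add_comp, Preadditive.comp_add]
    · have e₁ : biprod.inl ≫ (subBiprodIso N X X').hom = (biprod.inl : X ⟶ X ⊞ X').hom := by
        simp [subBiprodIso, Preadditive.comp_add]
      have e₂ : biprod.inr ≫ (subBiprodIso N X X').hom = (biprod.inr : X' ⟶ X ⊞ X').hom := by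
        simp [subBiprodIso, Preadditive.comp_add]
      have e₃ : (subBiprodIso N Z Z').inv ≫ biprod.fst = (biprod.fst : Z ⊞ Z' ⟶ Z).hom := by
        simp [subBiprodIso, Preadditive.add_comp]
      have e₄ : (subBiprodIso N Z Z').inv ≫ biprod.snd = (biprod.snd : Z ⊞ Z' ⟶ Z').hom := by
        simp [subBiprodIso, Preadditive.add_comp]
      rw [extSum, extSum, map_add, map_add, ← push_pull, ← push_pull, ← pull_comp, ← pull_comp,
        ← push_comp, ← push_comp, e₁, e₂, e₃, e₄]
      rfl
  et3 a b h h' w := by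
    obtain ⟨c, h1, h2⟩ := et3 (A := A) a.hom b.hom h h' (congrArg (·.hom) w)
    exact ⟨ObjectProperty.homMk c, by ext; exact h1, h2⟩
  et3_op b c h h' w := by
    obtain ⟨a, h1, h2⟩ := et3_op (A := A) b.hom c.hom h h' (congrArg (·.hom) w)
    exact ⟨ObjectProperty.homMk a, by ext; exact h1, h2⟩
  et4 {X Y D Z F f f' δ g g' ρ} h h' := by
    obtain ⟨M, k, d, e, δ', h1, h2, h3, h4, h5, h6⟩ := et4 (A := A) h h'
    exact ⟨⟨M, IsExtensionClosed.mid ⟨_, h2⟩ D.property F.property⟩, ObjectProperty.homMk k,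
      ObjectProperty.homMk d, ObjectProperty.homMk e, δ', h1, h2, by ext; exact h3,
      by ext; exact h4, h5, h6⟩
  et4_op {D X Y F Z f' f δ g' g ρ} h h' := by
    obtain ⟨M, k, d, e, δ', h1, h2, h3, h4, h5, h6⟩ := et4_op (A := A) h h'
    exact ⟨⟨M, IsExtensionClosed.mid ⟨_, h2⟩ D.property F.property⟩, ObjectProperty.homMk k,
      ObjectProperty.homMk d, ObjectProperty.homMk e, δ', h1, h2, by ext; exact h3,
      by ext; exact h4, h5, h6⟩

end Restriction

/-! ## Exact functors and exact sequences -/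

section Exact

/-- An exact functor `(F, φ)`: an additive functor `F` with a natural transformation
`φ : 𝔼 ⟶ 𝔼' ∘ (Fᵒᵖ × F)` of abelian group valued bifunctors, sending `𝔰`-triangles to
`𝔰'`-triangles. -/
@[ext]
structure ExtriFunctor (A : Type u) [Category.{v} A] [Preadditive A] [HasZeroObject A]
    [HasBinaryBiproducts A] [Extriangulated A] (B : Type u₂) [Category.{v₂} B] [Preadditive B]
    [HasZeroObject B] [HasBinaryBiproducts B] [Extriangulated B] where
  functor : A ⥤ B
  additive : functor.Additive
  φ : ∀ C X : A, Ext (E (A := A)) C X →+ Ext (E (A := B)) (functor.obj C) (functor.obj X)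
  φ_push : ∀ {C X X' : A} (a : X ⟶ X') (δ : Ext E C X),
    φ C X' (push E a δ) = push E (functor.map a) (φ C X δ)
  φ_pull : ∀ {C C' X : A} (c : C' ⟶ C) (δ : Ext E C X),
    φ C' X (pull E c δ) = pull E (functor.map c) (φ C X δ)
  map_realizes : ∀ {X Y Z : A} {x : X ⟶ Y} {y : Y ⟶ Z} {δ : Ext E Z X},
    Realizes x y δ → Realizes (functor.map x) (functor.map y) (φ Z X δ)

variable {A : Type u} [Category.{v} A] [Preadditive A] [HasZeroObject A]
  [HasBinaryBiproducts A] [Extriangulated A]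
variable {B : Type u₂} [Category.{v₂} B] [Preadditive B] [HasZeroObject B]
  [HasBinaryBiproducts B] [Extriangulated B]

/-- `F.comp G` is the composite `G ∘ F`. -/
def ExtriFunctor.comp {D : Type u₃} [Category.{v₃} D] [Preadditive D] [HasZeroObject D]
    [HasBinaryBiproducts D] [Extriangulated D] (F : ExtriFunctor A B) (G : ExtriFunctor B D) :
    ExtriFunctor A D where
  functor := F.functor ⋙ G.functor
  additive := by
    have := F.additive
    have := G.additive
    infer_instance
  φ C X := (G.φ (F.functor.obj C) (F.functor.obj X)).comp (F.φ C X)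
  φ_push a δ := by
    change G.φ _ _ (F.φ _ _ _) = push E (G.functor.map (F.functor.map a)) (G.φ _ _ (F.φ _ _ _))
    rw [F.φ_push, G.φ_push]
  φ_pull c δ := by
    change G.φ _ _ (F.φ _ _ _) = pull E (G.functor.map (F.functor.map c)) (G.φ _ _ (F.φ _ _ _))
    rw [F.φ_pull, G.φ_pull]
  map_realizes h := G.map_realizes (F.map_realizes h)

/-- The inclusion `(inc, ι)` of an extension-closed subcategory. -/
noncomputable def incl (N : ObjectProperty A) [IsExtensionClosed N] :
    ExtriFunctor N.FullSubcategory A where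
  functor := N.ι
  additive := inferInstance
  φ C X := AddMonoidHom.id (Ext (E (A := A)) C.obj X.obj)
  φ_push _ _ := rfl
  φ_pull _ _ := rfl
  map_realizes h := h

/-- The kernel of an exact functor. -/
def ExtriFunctor.ker (F : ExtriFunctor A B) : ObjectProperty A := fun X => IsZero (F.functor.obj X)

/-- `N ⟶ A ⟶ B` is an exact sequence: `N = Im inc = Ker Q`, and every exact functor on `A` that
vanishes on `N` factors uniquely through `Q`. The first two universe levels are those
of the targets of the functors to be factored. -/
def IsExactSequence.{b, a, v', u', v'', u''} {A : Type u'} [Category.{v'} A] [Preadditive A]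
    [HasZeroObject A] [HasBinaryBiproducts A] [Extriangulated A]
    {B : Type u''} [Category.{v''} B] [Preadditive B] [HasZeroObject B]
    [HasBinaryBiproducts B] [Extriangulated B]
    (N : ObjectProperty A) [IsExtensionClosed N] (Q : ExtriFunctor A B) : Prop :=
  N = (incl N).functor.essImage ∧ (incl N).functor.essImage = Q.ker ∧
  ∀ (A' : Type a) [Category.{b} A'] [Preadditive A'] [HasZeroObject A'] [HasBinaryBiproducts A']
    [Extriangulated A'] (G : ExtriFunctor A A'),
    (∀ X : N.FullSubcategory, IsZero (((incl N).comp G).functor.obj X)) →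
    ∃! G' : ExtriFunctor B A', Q.comp G' = G

end Exact

/-! ## Localization data -/

section Localization

variable {A : Type u} [Category.{v} A]

/-- The class `W₂ ∘ W₁` of composites of a morphism in `W₁` followed by one in `W₂`. -/
def compClass (W₂ W₁ : MorphismProperty A) : MorphismProperty A := fun X Y f =>
  ∃ (M : A) (g : X ⟶ M) (h : M ⟶ Y), W₁ g ∧ W₂ h ∧ g ≫ h = f

variable [Preadditive A]

/-- Two morphisms are related if their difference factors through an object of `P`. -/
def idealRel (P : ObjectProperty A) : HomRel A := fun X Y f g =>
  ∃ (Z : A) (i : X ⟶ Z) (j : Z ⟶ Y), P Z ∧ f - g = i ≫ j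

variable [HasZeroObject A]

open ZeroObject in
/-- The subcategory `N_S` of objects `X` such that `X ⟶ 0` and `0 ⟶ X` belong to `S`. -/
def nullObjects (S : MorphismProperty A) : ObjectProperty A := fun X =>
  S (0 : X ⟶ (0 : A)) ∧ S (0 : (0 : A) ⟶ X)

/-- The ideal quotient `A / [N_S]`. -/
abbrev IdealQuot (S : MorphismProperty A) := Quotient (idealRel (nullObjects S))

/-- The projection `p : A ⥤ A / [N_S]`. -/
abbrev idealProj (S : MorphismProperty A) : A ⥤ IdealQuot S :=
  Quotient.functor (idealRel (nullObjects S))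

/-- The closure of `p(S)` under composition with isomorphisms of `A / [N_S]`. -/
def bar (S : MorphismProperty A) : MorphismProperty (IdealQuot S) := fun X Y f =>
  ∃ (X' Y' : A) (s : X' ⟶ Y') (i : X ≅ (idealProj S).obj X') (j : (idealProj S).obj Y' ≅ Y),
    S s ∧ f = i.hom ≫ (idealProj S).map s ≫ j.hom

/-- (MR1): `bar S` satisfies 2-out-of-3. -/
def MR1 (S : MorphismProperty A) : Prop := (bar S).HasTwoOutOfThreeProperty

/-- (MR2): `bar S` is a multiplicative system. -/
def MR2 (S : MorphismProperty A) : Prop :=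
  (bar S).HasLeftCalculusOfFractions ∧ (bar S).HasRightCalculusOfFractions

variable [HasBinaryBiproducts A] [Extriangulated A]

/-- (MR3): a morphism of extensions `(a, c)` between `𝔰`-triangles with `p(a)`, `p(c)` in `bar S`
can be completed in the ideal quotient by a morphism in `bar S`. -/
def MR3 (S : MorphismProperty A) : Prop :=
  ∀ {X Y Z X' Y' Z' : A} {x : X ⟶ Y} {y : Y ⟶ Z} {δ : Ext (E (A := A)) Z X}
    {x' : X' ⟶ Y'} {y' : Y' ⟶ Z'} {δ' : Ext (E (A := A)) Z' X'} (a : X ⟶ X') (c : Z ⟶ Z'),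
    Realizes x y δ → Realizes x' y' δ' → push E a δ = pull E c δ' →
    bar S ((idealProj S).map a) → bar S ((idealProj S).map c) →
    ∃ b : (idealProj S).obj Y ⟶ (idealProj S).obj Y', bar S b ∧
      (idealProj S).map x ≫ b = (idealProj S).map a ≫ (idealProj S).map x' ∧
      (idealProj S).map y ≫ (idealProj S).map c = b ≫ (idealProj S).map y'

/-- The class of composites `u ≫ p(x) ≫ v` with `x` an inflation and `u`, `v` in `bar S`. -/
def barInf (S : MorphismProperty A) : MorphismProperty (IdealQuot S) := fun X Y f =>
  ∃ (X' Y' : A) (x : X' ⟶ Y') (u : X ⟶ (idealProj S).obj X') (v : (idealProj S).obj Y' ⟶ Y),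
    IsInflation x ∧ bar S u ∧ bar S v ∧ f = u ≫ (idealProj S).map x ≫ v

/-- The class of composites `u ≫ p(y) ≫ v` with `y` a deflation and `u`, `v` in `bar S`. -/
def barDef (S : MorphismProperty A) : MorphismProperty (IdealQuot S) := fun X Y f =>
  ∃ (X' Y' : A) (y : X' ⟶ Y') (u : X ⟶ (idealProj S).obj X') (v : (idealProj S).obj Y' ⟶ Y),
    IsDeflation y ∧ bar S u ∧ bar S v ∧ f = u ≫ (idealProj S).map y ≫ v

/-- (MR4): `barInf S` and `barDef S` are closed under composition. -/
def MR4 (S : MorphismProperty A) : Prop :=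
  (barInf S).IsStableUnderComposition ∧ (barDef S).IsStableUnderComposition

variable (N : ObjectProperty A)

/-- Inflations whose cone lies in `N`. -/
def InfN : MorphismProperty A := fun _ Y f =>
  ∃ (Z : A) (g : Y ⟶ Z), IsConflation f g ∧ N Z

/-- Deflations whose cocone lies in `N`. -/
def DefN : MorphismProperty A := fun Y _ g =>
  ∃ (X : A) (f : X ⟶ Y), IsConflation f g ∧ N X

/-- The sections in `InfN`. -/
def InfSpN : MorphismProperty A := fun _ _ f => InfN N f ∧ IsSplitMono f

/-- The retractions in `DefN`. -/
def DefSpN : MorphismProperty A := fun _ _ g => DefN N g ∧ IsSplitEpi g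

/-- The class `S_N`: the smallest class closed under composition that contains `InfN` and
`DefN`. -/
inductive SN : MorphismProperty A
  | of_inf {X Y : A} (f : X ⟶ Y) : InfN N f → SN f
  | of_def {X Y : A} (f : X ⟶ Y) : DefN N f → SN f
  | comp {X Y Z : A} (f : X ⟶ Y) (g : Y ⟶ Z) : SN f → SN g → SN (f ≫ g)

/-- The condition (♠). -/
structure Spade [IsExtensionClosed N] : Prop where
  inflation : ∀ (N₁ : N.FullSubcategory) (B : A) (f : N₁.obj ⟶ B), IsInflation f →
    ∃ (N₂ : N.FullSubcategory) (b : B ⟶ N₂.obj),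
      IsInflation (ObjectProperty.homMk (f ≫ b) : N₁ ⟶ N₂)
  deflation : ∀ (N₃ : N.FullSubcategory) (B : A) (g : B ⟶ N₃.obj), IsDeflation g →
    ∃ (N₂ : N.FullSubcategory) (b : N₂.obj ⟶ B),
      IsDeflation (ObjectProperty.homMk (b ≫ g) : N₂ ⟶ N₃)

end Localization

end ET

open ET

/-! The theorem rests on one consequence of (♠). Let `g : X ⟶ Y` be a deflation with cocone `K` in
`N`. By (♠) the inflation `K ⟶ X` extends to an inflation `K ⟶ X ⟶ W` with `W` and its cone in `N`.
In the pushout `M` of `K ⟶ X` and `K ⟶ W`, the row `W ⟶ M ⟶ Y` splits, because its class is pushed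
out along a map that factors through `K ⟶ X`. Thus `g` is an inflation with cone in `N` followed by
a retraction with cocone in `N` (`IsAbsorbing.exists_fac_of_defN`). Split deflations can be moved
past inflations, so every morphism of `SN N` has this form (`IsAbsorbing.exists_fac`). The second
factorization is the dual one: the hypotheses are put in the self-dual form `IsAbsorbing`, and half
of the statements follow by passing to the opposite category.

Modulo morphisms through `N` a split deflation with cocone in `N` is an isomorphism, so `SN N`
behaves there like the inflations with cone in `N`. Its members become both mono and epi, satisfy
the Ore conditions by pushing out, and have two-out-of-three because weak idempotent completeness
lets inflations be cancelled (`IsInflation.of_comp`). This yields (MR1)-(MR4).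

The bifunctor is localized together with the category. In the trivial extension `TrivExt A` a
morphism is a pair of a morphism and an extension. One divides by morphisms through `N` and by
`nullExt`, the extensions pushed out from `N`, then inverts `SN N`. The localized extensions are the
kernel of the projection to the localized category. An exact functor induces a functor on trivial
extensions, so one universal property produces both components of the induced functor.

The extriangulated axioms are verified for any `ExtLocalization`, by clearing denominators and
working in `A`. The delicate axiom is (ET4), where two triangles must be represented by composable
inflations of `A` (`ExtLocalization.Realizes.exists_composable`); this uses that `SN N` is saturated
(`ExtLocalization.SN_of_isIso`). -/

namespace ET

open Extriangulated

/-! ### Exact sequences of extensions and pushouts of inflations -/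

section Basics

variable {A : Type u} [Category.{v} A] [Preadditive A] [HasZeroObject A]
  [HasBinaryBiproducts A] [Extriangulated A]

lemma push_add_hom {C X X' : A} (a b : X ⟶ X') (δ : Ext (E (A := A)) C X) :
    push E (a + b) δ = push E a δ + push E b δ := by
  have := additive_right (A := A) (op C)
  simp [push, Functor.map_add]

lemma pull_add_hom {C C' X : A} (a b : C' ⟶ C) (δ : Ext (E (A := A)) C X) :
    pull E (a + b) δ = pull E a δ + pull E b δ := by
  have := additive_left (A := A) X
  have h := ((E (A := A)).flip.obj X).map_add (f := a.op) (g := b.op)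
  exact ConcreteCategory.congr_hom h δ

@[simp]
lemma push_zero_hom {C X X' : A} (δ : Ext (E (A := A)) C X) :
    push E (0 : X ⟶ X') δ = 0 := by
  have h := push_add_hom (0 : X ⟶ X') 0 δ
  rw [add_zero] at h
  exact left_eq_add.1 h

@[simp]
lemma pull_zero_hom {C C' X : A} (δ : Ext (E (A := A)) C X) :
    pull E (0 : C' ⟶ C) δ = 0 := by
  have h := pull_add_hom (0 : C' ⟶ C) 0 δ
  rw [add_zero] at h
  exact left_eq_add.1 h

lemma push_neg_hom {C X X' : A} (a : X ⟶ X') (δ : Ext (E (A := A)) C X) :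
    push E (-a) δ = -push E a δ := by
  rw [eq_neg_iff_add_eq_zero, ← push_add_hom, neg_add_cancel, push_zero_hom]

lemma pull_neg_hom {C C' X : A} (a : C' ⟶ C) (δ : Ext (E (A := A)) C X) :
    pull E (-a) δ = -pull E a δ := by
  rw [eq_neg_iff_add_eq_zero, ← pull_add_hom, neg_add_cancel, pull_zero_hom]

lemma ext_eq_zero_of_isZero_right {C X : A} (h : IsZero X) (δ : Ext (E (A := A)) C X) :
    δ = 0 := by
  rw [← push_id E δ, h.eq_of_src (𝟙 X) 0, push_zero_hom]

lemma ext_eq_zero_of_isZero_left {C X : A} (h : IsZero C) (δ : Ext (E (A := A)) C X) :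
    δ = 0 := by
  rw [← pull_id E δ, h.eq_of_src (𝟙 C) 0, pull_zero_hom]

/-- Split sequences realize `0`. -/
lemma realizes_split {X Y Z : A} {i : X ⟶ Y} {p : Y ⟶ Z} (r : Y ⟶ X) (s : Z ⟶ Y)
    (hi : i ≫ r = 𝟙 X) (hs : s ≫ p = 𝟙 Z) (h : r ≫ i + p ≫ s = 𝟙 Y) (hip : i ≫ p = 0)
    (hsr : s ≫ r = 0) : Realizes i p (0 : Ext (E (A := A)) Z X) := by
  let e : X ⊞ Z ≅ Y :=
    { hom := biprod.desc i s
      inv := biprod.lift r p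
      hom_inv_id := by ext <;> simp [hi, hs, hip, hsr]
      inv_hom_id := by simp [biprod.lift_desc, h] }
  simpa [e] using realizes_of_iso e (realizes_zero X Z)

lemma realizes_id_of_isZero (X : A) {Z : A} (hZ : IsZero Z) :
    Realizes (𝟙 X) (0 : X ⟶ Z) (0 : Ext (E (A := A)) Z X) :=
  realizes_split (𝟙 X) 0 (by simp) (hZ.eq_of_src _ _) (by simp) (by simp) (by simp)

lemma realizes_of_isZero_id (Z : A) {X : A} (hX : IsZero X) :
    Realizes (0 : X ⟶ Z) (𝟙 Z) (0 : Ext (E (A := A)) Z X) :=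
  realizes_split 0 (𝟙 Z) (hX.eq_of_src _ _) (by simp) (by simp) (by simp) (by simp)

section Triangle

variable {X Y Z : A} {x : X ⟶ Y} {y : Y ⟶ Z} {δ : Ext (E (A := A)) Z X}

open ZeroObject

/-- Here and below, the exact sequences come from comparing a triangle with the trivial triangles `X
= X ⟶ 0` and `0 ⟶ Z = Z`, through (ET3), its dual, or the lifting of morphisms of extensions. -/
lemma comp_zero_of_realizes (h : Realizes x y δ) : x ≫ y = 0 := by
  obtain ⟨c, hc, -⟩ := et3 (𝟙 X) x (realizes_id_of_isZero X (isZero_zero A)) h (by simp)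
  rw [← hc, zero_comp]

lemma push_inflation_eq_zero (h : Realizes x y δ) : push E x δ = 0 := by
  obtain ⟨c, -, hc⟩ := et3 x (𝟙 Y) h (realizes_id_of_isZero Y (isZero_zero A)) (by simp)
  rw [hc, map_zero]

lemma pull_deflation_eq_zero (h : Realizes x y δ) : pull E y δ = 0 := by
  obtain ⟨c, -, hc⟩ := et3_op (𝟙 Y) y (realizes_of_isZero_id Y (isZero_zero A)) h (by simp)
  rw [← hc, map_zero]

lemma exists_desc (h : Realizes x y δ) {W : A} (g : Y ⟶ W) (hg : x ≫ g = 0) :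
    ∃ k : Z ⟶ W, y ≫ k = g := by
  obtain ⟨c, hc, -⟩ := et3 (0 : X ⟶ (0 : A)) g h (realizes_of_isZero_id W (isZero_zero A))
    (by simp [hg])
  exact ⟨c, by simpa using hc⟩

lemma exists_lift (h : Realizes x y δ) {W : A} (g : W ⟶ Y) (hg : g ≫ y = 0) :
    ∃ k : W ⟶ X, k ≫ x = g := by
  obtain ⟨c, hc, -⟩ := et3_op g (0 : (0 : A) ⟶ Z) (realizes_id_of_isZero W (isZero_zero A)) h
    (by simp [hg])
  exact ⟨c, by simpa using hc.symm⟩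

/-- Exactness at `𝔼(W, X)`. -/
lemma exists_pull_eq (h : Realizes x y δ) {W : A} (ε : Ext (E (A := A)) W X)
    (hε : push E x ε = 0) : ∃ c : W ⟶ Z, ε = pull E c δ := by
  obtain ⟨V, i, p, hV⟩ := exists_realizes ε
  obtain ⟨b, hb, -⟩ := exists_mid x (0 : W ⟶ (0 : A)) hV
    (realizes_id_of_isZero Y (isZero_zero A)) (by simp [hε])
  obtain ⟨c, -, hc⟩ := et3 (𝟙 X) b hV h (by simpa using hb)
  exact ⟨c, by rw [← hc, push_id]⟩

lemma exists_extend (h : Realizes x y δ) {W : A} (a : X ⟶ W) (ha : push E a δ = 0) :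
    ∃ k : Y ⟶ W, x ≫ k = a := by
  obtain ⟨b, hb, -⟩ := exists_mid a (0 : Z ⟶ (0 : A)) h
    (realizes_id_of_isZero W (isZero_zero A)) (by simp [ha])
  exact ⟨b, by simpa using hb⟩

lemma exists_factor (h : Realizes x y δ) {W : A} (c : W ⟶ Z) (hc : pull E c δ = 0) :
    ∃ k : W ⟶ Y, k ≫ y = c := by
  obtain ⟨b, -, hb⟩ := exists_mid (0 : (0 : A) ⟶ X) c
    (realizes_of_isZero_id W (isZero_zero A)) h (by simp [hc])
  exact ⟨b, by simpa using hb.symm⟩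

/-- Exactness at `𝔼(W, Y)`. -/
lemma exists_push_inflation_eq (h : Realizes x y δ) {W : A} (ε : Ext (E (A := A)) W Y)
    (hε : push E y ε = 0) : ∃ ε' : Ext (E (A := A)) W X, ε = push E x ε' := by
  obtain ⟨V, g, g', hV⟩ := exists_realizes ε
  obtain ⟨M, h', d, e, δ', -, h2, -, -, -, h6⟩ := et4 h hV
  rw [hε] at h2
  -- The vanishing of `y_* ε` splits the conflation `Z ⟶ M ⟶ W` of the octahedron; the required
  -- class is `δ'` restricted along a section of `M ⟶ W`.
  obtain ⟨s, hs⟩ := exists_factor h2 (𝟙 W) (by simp)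
  exact ⟨pull E s δ', by rw [push_pull, ← h6, ← pull_comp, hs, pull_id]⟩

/-- Exactness at `𝔼(Y, W)`. -/
lemma exists_pull_deflation_eq (h : Realizes x y δ) {W : A} (ε : Ext (E (A := A)) Y W)
    (hε : pull E x ε = 0) : ∃ ε' : Ext (E (A := A)) Z W, ε = pull E y ε' := by
  obtain ⟨V, g', g, hV⟩ := exists_realizes ε
  obtain ⟨M, h', d, e, δ', -, h2, -, -, -, h6⟩ := et4_op hV h
  rw [hε] at h2
  obtain ⟨s, hs⟩ := exists_extend h2 (𝟙 W) (by simp)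
  exact ⟨push E s δ', by rw [← push_pull, ← h6, ← push_comp, hs, push_id]⟩

lemma isIso_of_realizes_of_isZero_right (h : Realizes x y δ) (hZ : IsZero Z) : IsIso x := by
  obtain ⟨e, he, -⟩ := iso_of_realizes h
    (by rw [ext_eq_zero_of_isZero_left hZ δ]; exact realizes_id_of_isZero X hZ)
  rw [← Iso.eq_comp_inv, Category.id_comp] at he
  rw [he]
  infer_instance

lemma isIso_of_realizes_of_isZero_left (h : Realizes x y δ) (hX : IsZero X) : IsIso y := by
  obtain ⟨e, -, he⟩ := iso_of_realizes h
    (by rw [ext_eq_zero_of_isZero_right hX δ]; exact realizes_of_isZero_id Z hX)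
  rw [← he, Category.comp_id]
  infer_instance

end Triangle

/-- The pushout of two inflations with the same source. -/
lemma exists_pushout {X Y Z Y' Z' : A} {x : X ⟶ Y} {y : Y ⟶ Z} {δ : Ext (E (A := A)) Z X}
    {x' : X ⟶ Y'} {y' : Y' ⟶ Z'} {δ' : Ext (E (A := A)) Z' X}
    (h : Realizes x y δ) (h' : Realizes x' y' δ') :
    ∃ (M : A) (m : Y ⟶ M) (m' : Y' ⟶ M) (e : M ⟶ Z) (e' : M ⟶ Z'),
      Realizes m e' (push E x δ') ∧ Realizes m' e (push E x' δ) ∧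
      x ≫ m = x' ≫ m' ∧ m ≫ e = y ∧ m' ≫ e' = y' := by
  -- The pushout is the middle term of the class on `Z ⊞ Z'` that restricts to `δ` and `δ'`. The
  -- dual of (ET4), applied to each of the two split sequences on `Z ⊞ Z'`, gives its two rows.
  set ν : Ext (E (A := A)) (Z ⊞ Z') X := pull E biprod.fst δ + pull E biprod.snd δ' with hν
  have h1 : pull E biprod.inl ν = δ := by
    rw [hν, map_add, ← pull_comp, ← pull_comp, biprod.inl_fst, biprod.inl_snd, pull_id,
      pull_zero_hom, add_zero]
  have h2 : pull E biprod.inr ν = δ' := by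
    rw [hν, map_add, ← pull_comp, ← pull_comp, biprod.inr_fst, biprod.inr_snd, pull_id,
      pull_zero_hom, zero_add]
  obtain ⟨M, i, k, hM⟩ := exists_realizes ν
  have key : ∃ m : Y ⟶ M, Realizes m (k ≫ biprod.snd) (push E x δ') ∧ x ≫ m = i ∧
      m ≫ k = y ≫ biprod.inl := by
    obtain ⟨M₂, j, d, e, δ'', r1, r2, c1, c2, -, c4⟩ := et4_op hM (realizes_zero Z Z')
    rw [h1] at r2
    obtain ⟨φ, hφ1, hφ2⟩ := iso_of_realizes r2 h
    have r1' := realizes_transport r1 φ (Iso.refl _)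
    have hδ'' : push E φ.hom δ'' = push E x δ' := by
      have := congrArg (push E φ.hom) c4
      rw [← push_comp, hφ1] at this
      -- Pulling back along `biprod.inr` undoes the pullback along `biprod.snd` and isolates the
      -- component `δ'` of `ν`.
      have h3 := congrArg (pull E (biprod.inr : Z' ⟶ Z ⊞ Z')) this
      rw [← push_pull, ← push_pull, ← pull_comp, biprod.inr_snd, pull_id, h2] at h3
      exact h3.symm
    simp only [Iso.refl_hom, Category.comp_id, Iso.refl_inv, pull_id, hδ''] at r1'
    refine ⟨_, r1', ?_, ?_⟩
    · rw [← c1, ← hφ1, Category.assoc, Iso.hom_inv_id_assoc]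
    · rw [Category.assoc, c2, ← hφ2, Category.assoc, Iso.inv_hom_id_assoc]
  have key' : ∃ m : Y' ⟶ M, Realizes m (k ≫ biprod.fst) (push E x' δ) ∧ x' ≫ m = i ∧
      m ≫ k = y' ≫ biprod.inr := by
    have hz : Realizes (biprod.inr : Z' ⟶ Z ⊞ Z') biprod.fst (0 : Ext (E (A := A)) Z Z') :=
      realizes_split biprod.snd biprod.inl (by simp) (by simp)
        (by rw [add_comm]; exact biprod.total) (by simp) (by simp)
    obtain ⟨M₂, j, d, e, δ'', r1, r2, c1, c2, -, c4⟩ := et4_op hM hz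
    rw [h2] at r2
    obtain ⟨φ, hφ1, hφ2⟩ := iso_of_realizes r2 h'
    have r1' := realizes_transport r1 φ (Iso.refl _)
    have hδ'' : push E φ.hom δ'' = push E x' δ := by
      have := congrArg (push E φ.hom) c4
      rw [← push_comp, hφ1] at this
      have h3 := congrArg (pull E (biprod.inl : Z ⟶ Z ⊞ Z')) this
      rw [← push_pull, ← push_pull, ← pull_comp, biprod.inl_fst, pull_id, h1] at h3
      exact h3.symm
    simp only [Iso.refl_hom, Category.comp_id, Iso.refl_inv, pull_id, hδ''] at r1'
    refine ⟨_, r1', ?_, ?_⟩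
    · rw [← c1, ← hφ1, Category.assoc, Iso.hom_inv_id_assoc]
    · rw [Category.assoc, c2, ← hφ2, Category.assoc, Iso.inv_hom_id_assoc]
  obtain ⟨m, hm1, hm2, hm3⟩ := key
  obtain ⟨m', hm1', hm2', hm3'⟩ := key'
  refine ⟨M, m, m', _, _, hm1, hm1', by rw [hm2, hm2'], ?_, ?_⟩
  · rw [reassoc_of% hm3, biprod.inl_fst, Category.comp_id]
  · rw [reassoc_of% hm3', biprod.inr_snd, Category.comp_id]

/-- If `x` is an inflation, then so is `(x, i)` for every `i`. -/
lemma exists_realizes_lift {X Y Z W : A} {x : X ⟶ Y} {y : Y ⟶ Z} {δ : Ext (E (A := A)) Z X}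
    (h : Realizes x y δ) (i : X ⟶ W) :
    ∃ (M : A) (p : Y ⊞ W ⟶ M) (e : M ⟶ Z) (δ' : Ext (E (A := A)) M X) (η : Ext (E (A := A)) Z W),
      Realizes (biprod.lift x i) p δ' ∧ Realizes (biprod.inr ≫ p) e η ∧
      p ≫ e = biprod.fst ≫ y := by
  -- `(x, i)` is the graph of `i`, a split inflation `X ⟶ X ⊞ W`, followed by `x ⊞ 𝟙 W`; (ET4) then
  -- gives its cone as an extension of `Z` by `W`.
  have h1 : Realizes (biprod.lift (𝟙 X) i) (biprod.desc (-i) (𝟙 W))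
      (0 : Ext (E (A := A)) W X) :=
    realizes_split biprod.fst biprod.inr (by simp) (by simp)
      (by ext <;> simp) (by simp) (by simp)
  have h2 := realizes_sum h (realizes_id_of_isZero W (isZero_zero A))
  have h3 := realizes_transport h2 (Iso.refl _) (isoBiprodZero (isZero_zero A)).symm
  obtain ⟨M, p, d, e, δ', r1, r2, c1, c2, -, -⟩ := et4 h1 h3
  have hd : d = biprod.inr ≫ p := by
    have := congrArg (fun t => biprod.inr ≫ t) c1
    simpa using this
  refine ⟨M, p, e, δ', _, ?_, hd ▸ r2, ?_⟩
  · convert r1 using 1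
    ext <;> simp
  · rw [c2]
    ext <;> simp

end Basics
end ET

/-! ### The opposite extriangulated category -/

namespace ET

open Extriangulated

section Opposite

variable {A : Type u} [Category.{v} A] [Preadditive A] [HasZeroObject A]
  [HasBinaryBiproducts A] [Extriangulated A]

/-- The opposite of a biproduct is a biproduct in the opposite category. -/
noncomputable def opBiprodIso (X Y : Aᵒᵖ) : X ⊞ Y ≅ op (X.unop ⊞ Y.unop) where
  hom := (biprod.fst : X ⊞ Y ⟶ X) ≫ (biprod.fst : X.unop ⊞ Y.unop ⟶ _).op +
    (biprod.snd : X ⊞ Y ⟶ Y) ≫ (biprod.snd : X.unop ⊞ Y.unop ⟶ _).op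
  inv := (biprod.inl : X.unop ⟶ X.unop ⊞ Y.unop).op ≫ (biprod.inl : X ⟶ X ⊞ Y) +
    (biprod.inr : Y.unop ⟶ X.unop ⊞ Y.unop).op ≫ (biprod.inr : Y ⟶ X ⊞ Y)
  hom_inv_id := by
    simp only [Preadditive.add_comp, Preadditive.comp_add, Category.assoc, ← op_comp_assoc]
    simp
  inv_hom_id := by
    simp only [Preadditive.add_comp, Preadditive.comp_add, Category.assoc]
    simp only [biprod.inl_fst_assoc, biprod.inl_snd_assoc, biprod.inr_fst_assoc,
      biprod.inr_snd_assoc, zero_comp, comp_zero, add_zero, zero_add, ← op_comp, ← op_add,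
      biprod.total, op_id]

variable (A) in
/-- The extension bifunctor of the opposite category. -/
abbrev opE : Aᵒᵖᵒᵖ ⥤ Aᵒᵖ ⥤ AddCommGrpCat.{v} := unopUnop A ⋙ (E (A := A)).flip

/-- Realization in the opposite category. -/
abbrev OpRealizes {X Y Z : Aᵒᵖ} (x : X ⟶ Y) (y : Y ⟶ Z) (δ : Ext (opE A) Z X) : Prop :=
  Realizes (A := A) y.unop x.unop δ

/-- The opposite of an extriangulated category. -/
noncomputable instance : Extriangulated Aᵒᵖ where
  E := opE A
  additive_right C := additive_left (A := A) C.unop.unop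
  additive_left X := by
    have := additive_right (A := A) X
    exact ⟨fun {C D f g} => ((E (A := A)).obj X).map_add (f := f.unop.unop) (g := g.unop.unop)⟩
  Realizes x y δ := OpRealizes x y δ
  exists_realizes {Z X} δ := by
    obtain ⟨Y, x, y, h⟩ := exists_realizes (A := A) (Z := X.unop) (X := Z.unop) δ
    exact ⟨op Y, y.op, x.op, h⟩
  realizes_of_iso e h := realizes_of_iso (A := A) e.unop.symm h
  iso_of_realizes h h' := by
    obtain ⟨e, h1, h2⟩ := iso_of_realizes (A := A) h h'
    refine ⟨e.symm.op, Quiver.Hom.unop_inj ?_, Quiver.Hom.unop_inj ?_⟩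
    · change e.inv ≫ _ = _
      rw [← h2, Iso.inv_hom_id_assoc]
    · change _ ≫ e.inv = _
      rw [← h1, Category.assoc, Iso.hom_inv_id, Category.comp_id]
  exists_mid a c h h' w := by
    obtain ⟨b, h1, h2⟩ := exists_mid (A := A) c.unop a.unop h' h w.symm
    exact ⟨b.op, Quiver.Hom.unop_inj h2.symm, Quiver.Hom.unop_inj h1.symm⟩
  realizes_zero X Z := by
    have h : Realizes (A := A) (biprod.inr : Z.unop ⟶ X.unop ⊞ Z.unop) biprod.fst 0 :=
      realizes_split biprod.snd biprod.inl (by simp) (by simp)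
        (by rw [add_comm]; exact biprod.total) (by simp) (by simp)
    have h := realizes_of_iso (opBiprodIso X Z).unop h
    convert h using 1
    · apply Quiver.Hom.op_inj
      simp [opBiprodIso, Preadditive.comp_add]
    · apply Quiver.Hom.op_inj
      simp [opBiprodIso, Preadditive.add_comp]
  realizes_sum {X Y Z X' Y' Z' x y δ x' y' δ'} h h' := by
    have h := realizes_of_iso (opBiprodIso Y Y').unop (realizes_transport
      (realizes_sum (A := A) h h') (opBiprodIso Z Z').unop (opBiprodIso X X').unop)
    convert h using 1
    · rw [biprod.map_eq]
      apply Quiver.Hom.op_inj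
      rw [biprod.map_eq]
      simp [opBiprodIso, Preadditive.add_comp, Preadditive.comp_add]
    · rw [biprod.map_eq]
      apply Quiver.Hom.op_inj
      rw [biprod.map_eq]
      simp [opBiprodIso, Preadditive.add_comp, Preadditive.comp_add]
    · have e₁ : (opBiprodIso X X').inv.unop ≫ biprod.fst = (biprod.inl : X ⟶ X ⊞ X').unop :=
        Quiver.Hom.op_inj (by simp [opBiprodIso])
      have e₂ : (opBiprodIso X X').inv.unop ≫ biprod.snd = (biprod.inr : X' ⟶ X ⊞ X').unop :=
        Quiver.Hom.op_inj (by simp [opBiprodIso])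
      have e₃ : biprod.inl ≫ (opBiprodIso Z Z').hom.unop = (biprod.fst : Z ⊞ Z' ⟶ Z).unop :=
        Quiver.Hom.op_inj (by simp [opBiprodIso])
      have e₄ : biprod.inr ≫ (opBiprodIso Z Z').hom.unop = (biprod.snd : Z ⊞ Z' ⟶ Z').unop :=
        Quiver.Hom.op_inj (by simp [opBiprodIso])
      change _ = push (E (A := A)) (opBiprodIso Z Z').hom.unop
        (pull E (opBiprodIso X X').inv.unop _)
      rw [extSum, extSum, map_add, map_add, ← push_pull, ← push_pull, ← pull_comp, ← pull_comp,
        ← push_comp, ← push_comp, e₁, e₂, e₃, e₄]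
      exact congrArg₂ (· + ·) (push_pull E _ _ δ).symm (push_pull E _ _ δ').symm
  et3 a b h h' w := by
    obtain ⟨c, h1, h2⟩ := et3_op (A := A) b.unop a.unop h' h (congrArg (·.unop) w.symm)
    exact ⟨c.op, Quiver.Hom.unop_inj h1.symm, h2.symm⟩
  et3_op b c h h' w := by
    obtain ⟨a, h1, h2⟩ := et3 (A := A) c.unop b.unop h' h (congrArg (·.unop) w.symm)
    exact ⟨a.op, Quiver.Hom.unop_inj h1.symm, h2.symm⟩
  et4 {X Y D Z F f f' δ g g' ρ} h h' := by
    obtain ⟨M, k, d, e, δ', h1, h2, h3, h4, h5, h6⟩ := et4_op (A := A) h' h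
    exact ⟨op M, k.op, e.op, d.op, δ', h1, h2, Quiver.Hom.unop_inj h4.symm,
      Quiver.Hom.unop_inj h3, h5, h6⟩
  et4_op {D X Y F Z f' f δ g' g ρ} h h' := by
    obtain ⟨M, k, d, e, δ', h1, h2, h3, h4, h5, h6⟩ := et4 (A := A) h' h
    exact ⟨op M, k.op, e.op, d.op, δ', h1, h2, Quiver.Hom.unop_inj h4,
      Quiver.Hom.unop_inj h3.symm, h5, h6⟩

lemma op_realizes {X Y Z : A} {x : X ⟶ Y} {y : Y ⟶ Z} {δ : Ext (E (A := A)) Z X}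
    (h : Realizes x y δ) :
    Realizes (A := Aᵒᵖ) (X := op Z) (Y := op Y) (Z := op X) y.op x.op δ := h

lemma unop_realizes {X Y Z : Aᵒᵖ} {x : X ⟶ Y} {y : Y ⟶ Z} {δ : Ext (E (A := Aᵒᵖ)) Z X}
    (h : Realizes x y δ) :
    Realizes (A := A) (X := Z.unop) (Y := Y.unop) (Z := X.unop) y.unop x.unop δ := h

end Opposite
end ET

/-! ### Weak idempotent completeness and cancellation of inflations -/

namespace ET

open Extriangulated

/-- Every section is the inclusion of a direct summand. -/
def HasSplitComplements (A : Type u) [Category.{v} A] [Preadditive A] : Prop :=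
  ∀ {X Y : A} (f : X ⟶ Y) (r : Y ⟶ X), f ≫ r = 𝟙 X →
    ∃ (C : A) (i : C ⟶ Y) (c : Y ⟶ C), i ≫ c = 𝟙 C ∧ r ≫ f + c ≫ i = 𝟙 Y

/-- The existence of complements, unlike that of cokernels of sections, is visibly self-dual, which
is the form needed for dualizing. -/
lemma IsWIC.hasSplitComplements {A : Type u} [Category.{v} A] [Preadditive A] (hA : IsWIC A) :
    HasSplitComplements A := by
  intro X Y f r h
  have := hA f (IsSplitMono.mk' ⟨r, h⟩)
  have hc : cokernel.π f ≫ cokernel.desc f (𝟙 Y - r ≫ f) (by simp [reassoc_of% h]) =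
      𝟙 Y - r ≫ f := cokernel.π_desc _ _ _
  refine ⟨cokernel f, cokernel.desc f (𝟙 Y - r ≫ f) (by simp [reassoc_of% h]),
    cokernel.π f, ?_, by rw [hc]; abel⟩
  rw [← cancel_epi (cokernel.π f), reassoc_of% hc]
  simp

lemma HasSplitComplements.op {A : Type u} [Category.{v} A] [Preadditive A]
    (hA : HasSplitComplements A) : HasSplitComplements Aᵒᵖ := by
  intro X Y f r h
  obtain ⟨C, i, c, h1, h2⟩ := hA r.unop f.unop (congrArg (·.unop) h)
  exact ⟨.op C, c.op, i.op, Quiver.Hom.unop_inj h1, Quiver.Hom.unop_inj h2⟩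

lemma split_complement_comp {A : Type u} [Category.{v} A] [Preadditive A] {X Y C : A}
    {f : X ⟶ Y} {r : Y ⟶ X} {i : C ⟶ Y} {c : Y ⟶ C} (h : f ≫ r = 𝟙 X) (h1 : i ≫ c = 𝟙 C)
    (h2 : r ≫ f + c ≫ i = 𝟙 Y) : f ≫ c = 0 ∧ i ≫ r = 0 := by
  have e1 : f ≫ c ≫ i = 0 := by
    have := congrArg (fun t => f ≫ t) h2
    simpa [Preadditive.comp_add, reassoc_of% h] using this
  have e2 : i ≫ r ≫ f = 0 := by
    have := congrArg (fun t => i ≫ t) h2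
    simpa [Preadditive.comp_add, reassoc_of% h1] using this
  constructor
  · simpa [h1] using congrArg (· ≫ c) e1
  · simpa [h] using congrArg (· ≫ r) e2

/-- If `b = 1 + n` with `n² = 0`, the inverse is `1 - n = 2 - b`. -/
lemma isIso_of_sq_zero {A : Type u} [Category.{v} A] [Preadditive A] {X : A} (b : X ⟶ X)
    (h : (b - 𝟙 X) ≫ (b - 𝟙 X) = 0) : IsIso b := by
  refine ⟨𝟙 X + 𝟙 X - b, ?_, ?_⟩ <;>
  · simp only [Preadditive.sub_comp, Preadditive.comp_sub, Category.id_comp,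
      Category.comp_id, Preadditive.add_comp, Preadditive.comp_add] at h ⊢
    rw [← sub_eq_zero, ← neg_eq_zero, ← h]
    abel

section Cancellation

variable {A : Type u} [Category.{v} A] [Preadditive A] [HasZeroObject A]
  [HasBinaryBiproducts A] [Extriangulated A]

/-- In a weakly idempotent complete category, `f` is an inflation whenever `f ≫ g` is. -/
lemma IsInflation.of_comp (hA : HasSplitComplements A) {X Y W : A} {f : X ⟶ Y} {g : Y ⟶ W}
    (h : IsInflation (f ≫ g)) : IsInflation f := by
  obtain ⟨Z, y, δ₀, h₀⟩ := h
  -- `(f ≫ g, f)` is an inflation since its first component is one. A shear of `W ⊞ Y` then removes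
  -- that component, so `(0, f)` is an inflation.
  obtain ⟨C, p, -, δ, -, h₁, -, -⟩ := exists_realizes_lift h₀ f
  let e : W ⊞ Y ≅ W ⊞ Y :=
    { hom := biprod.lift (biprod.fst - biprod.snd ≫ g) biprod.snd
      inv := biprod.lift (biprod.fst + biprod.snd ≫ g) biprod.snd
      hom_inv_id := by ext <;> simp [Preadditive.comp_add]
      inv_hom_id := by ext <;> simp [Preadditive.comp_sub] }
  have h₂ := realizes_of_iso e h₁
  have he : biprod.lift (f ≫ g) f ≫ e.hom = f ≫ biprod.inr := by ext <;> simp [e]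
  rw [he] at h₂
  set p' := e.inv ≫ p
  -- The projection to `W` kills `(0, f)`, so it descends to the cone `C` and makes `W` a direct
  -- summand of `C`. The complement `C'`, provided by `hA`, is the expected cone of `f`.
  obtain ⟨c, hc⟩ := exists_desc h₂ biprod.fst (by simp)
  have hs : (biprod.inl ≫ p') ≫ c = 𝟙 W := by rw [Category.assoc, hc, biprod.inl_fst]
  obtain ⟨C', i, q, hiq, hcomp⟩ := hA _ _ hs
  obtain ⟨hsq, hic⟩ := split_complement_comp hs hiq hcomp
  simp only [Category.assoc] at hs hsq hcomp
  have hp : biprod.inr ≫ p' ≫ q ≫ i = biprod.inr ≫ p' := by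
    have := congrArg (fun t => biprod.inr ≫ p' ≫ t) hcomp
    simpa [Preadditive.comp_add, reassoc_of% hc] using this
  -- The class `δ` vanishes on the summand `W`, whose inclusion factors through the deflation `p'`;
  -- hence it comes from `C'`.
  have hδ : δ = pull E q (pull E i δ) := by
    conv_lhs => rw [← pull_id E δ, ← hcomp]
    rw [pull_add_hom, pull_comp E (biprod.inl ≫ p') c, pull_comp E p' biprod.inl,
      pull_deflation_eq_zero h₂, pull_comp E i q, map_zero, map_zero, zero_add]
  -- It remains to identify the middle term of `i^* δ` with `Y`, compatibly with `f' : X ⟶ Y'` and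
  -- `f`.
  obtain ⟨Y', f', y', h'⟩ := exists_realizes (pull E i δ)
  obtain ⟨b, hb1, hb2⟩ := exists_mid (𝟙 X) i h' h₂ (by rw [push_id])
  obtain ⟨b₂, hb3, hb4⟩ := exists_mid (𝟙 X) q h₂ h' (by rw [push_id, ← hδ])
  rw [Category.id_comp] at hb1 hb3
  have htot : ∀ {T : A} (a : T ⟶ W ⊞ Y), a ≫ biprod.snd ≫ biprod.inr =
      a - a ≫ biprod.fst ≫ biprod.inl := by
    intro T a
    ext <;> simp
  set β := b ≫ biprod.snd
  set β' := biprod.inr ≫ b₂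
  have hβ : f' ≫ β = f := by simp [β, reassoc_of% hb1]
  have hβ' : f ≫ β' = f' := by simpa [β'] using hb3
  have hβy : β' ≫ y' = biprod.inr ≫ p' ≫ q := by simp only [β', Category.assoc, ← hb4]
  have hβk : β ≫ biprod.inr ≫ p' ≫ q = y' := by
    have := congrArg (· ≫ p' ≫ q) (htot b)
    simp only [Category.assoc, Preadditive.sub_comp, hsq, comp_zero, sub_zero] at this
    simp only [β, Category.assoc, this]
    rw [← reassoc_of% hb2, hiq, Category.comp_id]
  have i₁ : IsIso (β ≫ β') := isIso_of_endo h' _ (by rw [reassoc_of% hβ, hβ'])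
    (by rw [Category.assoc, hβy, hβk])
  -- No triangle on `Y` is available yet. The deviation `t` from the identity kills `f`, so it
  -- factors through `Y ⟶ C`; since `t` followed by `Y ⟶ C` is zero, `t² = 0`.
  have i₂ : IsIso (β' ≫ β) := by
    apply isIso_of_sq_zero
    set t := β' ≫ β - 𝟙 Y
    have ht1 : f ≫ t = 0 := by
      simp only [t, Preadditive.comp_sub, reassoc_of% hβ', hβ, Category.comp_id, sub_self]
    have ht2 : t ≫ biprod.inr ≫ p' = 0 := by
      rw [← hp]
      simp only [t, Preadditive.sub_comp, Category.assoc, reassoc_of% hβk, Category.id_comp]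
      rw [reassoc_of% hβy, sub_self]
    obtain ⟨k, hk⟩ := exists_desc h₂ (biprod.snd ≫ t) (by simp [ht1])
    have hk' : biprod.inr ≫ p' ≫ k = t := by rw [hk, biprod.inr_snd_assoc]
    calc t ≫ t = t ≫ biprod.inr ≫ p' ≫ k := by rw [hk']
      _ = 0 := by rw [reassoc_of% ht2, zero_comp]
  have : IsSplitMono β := IsSplitMono.mk' ⟨β' ≫ inv (β ≫ β'), by
    rw [← Category.assoc, IsIso.hom_inv_id]⟩
  have : IsSplitEpi β := IsSplitEpi.mk' ⟨inv (β' ≫ β) ≫ β', by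
    rw [Category.assoc, IsIso.inv_hom_id]⟩
  have : IsIso β := isIso_of_epi_of_isSplitMono β
  refine ⟨C', inv β ≫ y', pull E i δ, ?_⟩
  have := realizes_of_iso (asIso β) h'
  simpa [hβ] using this

/-- Endomorphisms of a realization which are the identity on the first two terms are invertible on
the third. -/
lemma isIso_third_of_endo {X Y Z : A} {x : X ⟶ Y} {y : Y ⟶ Z} {δ : Ext (E (A := A)) Z X}
    (h : Realizes x y δ) (c : Z ⟶ Z) (h₁ : y ≫ c = y) (h₂ : pull E c δ = δ) : IsIso c := by
  apply isIso_of_sq_zero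
  obtain ⟨k, hk⟩ := exists_factor h (c - 𝟙 Z) (by
    rw [sub_eq_add_neg, pull_add_hom, pull_neg_hom, pull_id, h₂, add_neg_cancel])
  calc (c - 𝟙 Z) ≫ (c - 𝟙 Z) = (k ≫ y) ≫ (c - 𝟙 Z) := by rw [hk]
    _ = 0 := by simp [h₁]

/-- The cone of an inflation is a retract of any other cone. -/
lemma exists_retract_cone {X Y Z Z' : A} {x : X ⟶ Y} {y : Y ⟶ Z} {y' : Y ⟶ Z'}
    {δ : Ext (E (A := A)) Z X} {δ' : Ext (E (A := A)) Z' X}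
    (h : Realizes x y δ) (h' : Realizes x y' δ') :
    ∃ (i : Z ⟶ Z') (r : Z' ⟶ Z), i ≫ r = 𝟙 Z := by
  obtain ⟨c, hc1, hc2⟩ := et3 (𝟙 X) (𝟙 Y) h h' (by simp)
  obtain ⟨c', hc1', hc2'⟩ := et3 (𝟙 X) (𝟙 Y) h' h (by simp)
  rw [Category.id_comp] at hc1 hc1'
  rw [push_id] at hc2 hc2'
  have : IsIso (c ≫ c') := isIso_third_of_endo h _ (by rw [reassoc_of% hc1, hc1'])
    (by rw [pull_comp, ← hc2', ← hc2])
  exact ⟨c, c' ≫ inv (c ≫ c'), by rw [← Category.assoc, IsIso.hom_inv_id]⟩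

end Cancellation

/-! ### The ideal of morphisms factoring through `N` -/

section Factoring

variable {A : Type u} [Category.{v} A]

/-- The morphism `f` factors through an object of `N`. -/
def FactorsThru (N : ObjectProperty A) {X Y : A} (f : X ⟶ Y) : Prop :=
  ∃ (Z : A) (i : X ⟶ Z) (j : Z ⟶ Y), N Z ∧ f = i ≫ j

lemma FactorsThru.comp_left {N : ObjectProperty A} {X Y Z : A} {f : Y ⟶ Z}
    (h : FactorsThru N f) (g : X ⟶ Y) : FactorsThru N (g ≫ f) := by
  obtain ⟨W, i, j, hW, rfl⟩ := h
  exact ⟨W, g ≫ i, j, hW, by simp⟩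

lemma FactorsThru.comp_right {N : ObjectProperty A} {X Y Z : A} {f : X ⟶ Y}
    (h : FactorsThru N f) (g : Y ⟶ Z) : FactorsThru N (f ≫ g) := by
  obtain ⟨W, i, j, hW, rfl⟩ := h
  exact ⟨W, i, j ≫ g, hW, by simp⟩

lemma FactorsThru.of_op {N : ObjectProperty A} {X Y : A} {f : X ⟶ Y}
    (h : FactorsThru N.op f.op) : FactorsThru N f := by
  obtain ⟨W, i, j, hW, hf⟩ := h
  exact ⟨W.unop, j.unop, i.unop, hW, congrArg (·.unop) hf⟩

lemma FactorsThru.op {N : ObjectProperty A} {X Y : A} {f : X ⟶ Y}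
    (h : FactorsThru N f) : FactorsThru N.op f.op := by
  obtain ⟨W, i, j, hW, rfl⟩ := h
  exact ⟨Opposite.op W, j.op, i.op, hW, rfl⟩

variable [Preadditive A]

lemma FactorsThru.neg {N : ObjectProperty A} {X Y : A} {f : X ⟶ Y}
    (h : FactorsThru N f) : FactorsThru N (-f) := by
  obtain ⟨W, i, j, hW, rfl⟩ := h
  exact ⟨W, -i, j, hW, by simp⟩

variable [HasZeroObject A] [HasBinaryBiproducts A] [Extriangulated A]

instance (N : ObjectProperty A) [IsExtensionClosed N] : IsExtensionClosed N.op where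
  exists_zero := by
    obtain ⟨Z, hZ, h⟩ := ObjectProperty.ContainsZero.exists_zero (P := N)
    exact ⟨op Z, hZ.op, h⟩
  of_iso e h := N.prop_of_iso e.unop.symm h
  mid := by
    rintro X Y Z x y ⟨δ, h⟩ hX hZ
    exact IsExtensionClosed.mid (N := N) ⟨δ, unop_realizes h⟩ hZ hX

variable {N : ObjectProperty A} [IsExtensionClosed N]

lemma prop_of_isZero {X : A} (h : IsZero X) : N X := by
  obtain ⟨Z, hZ, hN⟩ := ObjectProperty.ContainsZero.exists_zero (P := N)
  exact N.prop_of_iso (hZ.iso h) hN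

lemma FactorsThru.zero (X Y : A) : FactorsThru N (0 : X ⟶ Y) := by
  obtain ⟨Z, hZ, hN⟩ := ObjectProperty.ContainsZero.exists_zero (P := N)
  exact ⟨Z, 0, 0, hN, by simp⟩

lemma FactorsThru.add {X Y : A} {f g : X ⟶ Y} (hf : FactorsThru N f) (hg : FactorsThru N g) :
    FactorsThru N (f + g) := by
  obtain ⟨Z, i, j, hZ, rfl⟩ := hf
  obtain ⟨W, i', j', hW, rfl⟩ := hg
  exact ⟨Z ⊞ W, biprod.lift i i', biprod.desc j j', prop_biprod N hZ hW, by simp⟩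

lemma FactorsThru.sub {X Y : A} {f g : X ⟶ Y} (hf : FactorsThru N f) (hg : FactorsThru N g) :
    FactorsThru N (f - g) := by
  rw [sub_eq_add_neg]
  exact hf.add hg.neg

end Factoring

end ET

/-! ### The class `SN N`: factorizations, two-out-of-three and the Ore conditions -/

namespace ET

open Extriangulated

section Classes

open ZeroObject

variable {A : Type u} [Category.{v} A] [Preadditive A] [HasZeroObject A]
  [HasBinaryBiproducts A] [Extriangulated A] {N : ObjectProperty A}

lemma InfN.op {X Y : A} {f : X ⟶ Y} (h : InfN N f) : DefN N.op f.op := by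
  obtain ⟨Z, g, ⟨δ, hδ⟩, hZ⟩ := h
  exact ⟨.op Z, g.op, ⟨δ, op_realizes hδ⟩, hZ⟩

lemma DefN.op {X Y : A} {f : X ⟶ Y} (h : DefN N f) : InfN N.op f.op := by
  obtain ⟨Z, g, ⟨δ, hδ⟩, hZ⟩ := h
  exact ⟨.op Z, g.op, ⟨δ, op_realizes hδ⟩, hZ⟩

lemma InfN.unop {X Y : Aᵒᵖ} {f : X ⟶ Y} (h : InfN N.op f) : DefN N f.unop := by
  obtain ⟨Z, g, ⟨δ, hδ⟩, hZ⟩ := h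
  exact ⟨Z.unop, g.unop, ⟨δ, unop_realizes hδ⟩, hZ⟩

lemma DefN.unop {X Y : Aᵒᵖ} {f : X ⟶ Y} (h : DefN N.op f) : InfN N f.unop := by
  obtain ⟨Z, g, ⟨δ, hδ⟩, hZ⟩ := h
  exact ⟨Z.unop, g.unop, ⟨δ, unop_realizes hδ⟩, hZ⟩

lemma SN.op {X Y : A} {f : X ⟶ Y} (h : SN N f) : SN N.op f.op := by
  induction h with
  | of_inf f h => exact .of_def _ h.op
  | of_def f h => exact .of_inf _ h.op
  | comp f g _ _ hf hg => exact .comp _ _ hg hf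

lemma SN.unop {X Y : Aᵒᵖ} {f : X ⟶ Y} (h : SN N.op f) : SN N f.unop := by
  induction h with
  | of_inf f h => exact .of_def _ h.unop
  | of_def f h => exact .of_inf _ h.unop
  | comp f g _ _ hf hg => exact .comp _ _ hg hf

lemma DefSpN.unop {X Y : Aᵒᵖ} {f : X ⟶ Y} (h : DefSpN N.op f) : InfSpN N f.unop := by
  obtain ⟨h, ⟨⟨s⟩⟩⟩ := h
  exact ⟨h.unop, IsSplitMono.mk' ⟨s.section_.unop, congrArg (·.unop) s.id⟩⟩

lemma IsInflation.unop {X Y : Aᵒᵖ} {f : X ⟶ Y} (h : IsInflation f) : IsDeflation f.unop := by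
  obtain ⟨Z, g, ⟨δ, hδ⟩⟩ := h
  exact ⟨Z.unop, g.unop, ⟨δ, unop_realizes hδ⟩⟩

lemma IsDeflation.op {X Y : A} {f : X ⟶ Y} (h : IsDeflation f) : IsInflation f.op := by
  obtain ⟨Z, g, ⟨δ, hδ⟩⟩ := h
  exact ⟨.op Z, g.op, ⟨δ, op_realizes hδ⟩⟩

lemma IsDeflation.unop {X Y : Aᵒᵖ} {f : X ⟶ Y} (h : IsDeflation f) : IsInflation f.unop := by
  obtain ⟨Z, g, ⟨δ, hδ⟩⟩ := h
  exact ⟨Z.unop, g.unop, ⟨δ, unop_realizes hδ⟩⟩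

lemma DefN.biprod_fst (X : A) {K : A} (hK : N K) : DefN N (biprod.fst : X ⊞ K ⟶ X) :=
  ⟨K, biprod.inr, ⟨0, realizes_split biprod.snd biprod.inl (by simp) (by simp)
    (by rw [add_comm]; exact biprod.total) (by simp) (by simp)⟩, hK⟩

lemma DefN.biprod_snd (X : A) {K : A} (hK : N K) : DefN N (biprod.snd : K ⊞ X ⟶ X) :=
  ⟨K, biprod.inl, ⟨0, realizes_zero K X⟩, hK⟩

lemma InfN.biprod_inr (X : A) {K : A} (hK : N K) : InfN N (biprod.inr : X ⟶ K ⊞ X) :=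
  ⟨K, biprod.fst, ⟨0, realizes_split biprod.snd biprod.inl (by simp) (by simp)
    (by rw [add_comm]; exact biprod.total) (by simp) (by simp)⟩, hK⟩

/-- A split deflation with cocone in `N` is a projection. -/
lemma DefSpN.exists_iso {X Y : A} {g : X ⟶ Y} (hg : DefSpN N g) :
    ∃ (K : A) (e : X ≅ K ⊞ Y), N K ∧ e.hom ≫ biprod.snd = g := by
  obtain ⟨⟨K, k, ⟨δ, h⟩, hK⟩, ⟨⟨s⟩⟩⟩ := hg
  have hδ : δ = 0 := by
    rw [← pull_id E δ, ← s.id, pull_comp, pull_deflation_eq_zero h, map_zero]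
  obtain ⟨e, -, he⟩ := iso_of_realizes h (hδ ▸ realizes_zero K Y)
  exact ⟨K, e, hK, he⟩

lemma DefSpN.biprod_snd (X : A) {K : A} (hK : N K) : DefSpN N (biprod.snd : K ⊞ X ⟶ X) :=
  ⟨.biprod_snd X hK, IsSplitEpi.mk' ⟨biprod.inr, by simp⟩⟩

/-- Split deflations with cocone in `N` may be moved past inflations. -/
lemma DefSpN.exchange {X Y Z D : A} {g : X ⟶ Y} (hg : DefSpN N g) {f : Y ⟶ Z} {f' : Z ⟶ D}
    (hf : IsConflation f f') :
    ∃ (M D' : A) (h : X ⟶ M) (h' : M ⟶ D') (p : M ⟶ Z), IsConflation h h' ∧ Nonempty (D ≅ D') ∧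
      DefSpN N p ∧ h ≫ p = g ≫ f := by
  obtain ⟨K, e, hK, he⟩ := hg.exists_iso
  obtain ⟨δ, hδ⟩ := hf
  -- Under `X ≅ K ⊞ Y` the new inflation is `𝟙 K ⊞ f`, with cone `0 ⊞ D`, and the new split
  -- deflation is the projection `K ⊞ Z ⟶ Z`.
  have h1 := realizes_sum (realizes_id_of_isZero K (isZero_zero A)) hδ
  have h2 := realizes_transport h1 e.symm (Iso.refl _)
  exact ⟨_, _, _, _, biprod.snd, ⟨_, h2⟩, ⟨isoZeroBiprod (isZero_zero A)⟩, .biprod_snd Z hK,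
    by simp [reassoc_of% he]⟩

/-- The hypotheses on `N` in a self-dual form. -/
structure IsAbsorbing (N : ObjectProperty A) : Prop where
  compl : HasSplitComplements A
  retract : ∀ {X Y : A} (i : X ⟶ Y) (r : Y ⟶ X), i ≫ r = 𝟙 X → N Y → N X
  inflation : ∀ {X B : A} (f : X ⟶ B), N X → IsInflation f →
    ∃ (Y : A) (b : B ⟶ Y), N Y ∧ InfN N (f ≫ b)
  deflation : ∀ {X B : A} (g : B ⟶ X), N X → IsDeflation g →
    ∃ (Y : A) (b : Y ⟶ B), N Y ∧ DefN N (b ≫ g)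

lemma IsAbsorbing.op (hN : IsAbsorbing N) : IsAbsorbing N.op where
  compl := HasSplitComplements.op hN.compl
  retract i r h hY := hN.retract r.unop i.unop (congrArg (·.unop) h) hY
  inflation f hX hf := by
    obtain ⟨Y, b, hY, h⟩ := hN.deflation f.unop hX hf.unop
    exact ⟨.op Y, b.op, hY, h.op⟩
  deflation f hX hf := by
    obtain ⟨Y, b, hY, h⟩ := hN.inflation f.unop hX hf.unop
    exact ⟨.op Y, b.op, hY, h.op⟩

lemma IsAbsorbing.prop_of_factorsThru_id (hN : IsAbsorbing N) {X : A} (h : FactorsThru N (𝟙 X)) :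
    N X := by
  obtain ⟨Z, i, j, hZ, h⟩ := h
  exact hN.retract i j h.symm hZ

/-- The central use of (♠). In the pushout of `x` and `x ≫ b`, the map `X ⟶ M` has the cone `N₃` of
`x ≫ b`. The other row `W ⟶ M ⟶ Y` has class `(x ≫ b)_* δ = b_* (x_* δ) = 0` and therefore splits.
-/
lemma IsAbsorbing.exists_fac_of_defN (hN : IsAbsorbing N) {X Y : A} {g : X ⟶ Y} (hg : DefN N g) :
    compClass (DefSpN N) (InfN N) g := by
  obtain ⟨K, x, h, hK⟩ := hg
  obtain ⟨W, b, hW, N₃, z, ⟨δ', h'⟩, hN₃⟩ := hN.inflation x hK ⟨_, _, h⟩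
  obtain ⟨δ, h⟩ := h
  obtain ⟨M, m, m', e, e', h1, h2, -, h3, -⟩ := exists_pushout h h'
  rw [push_comp, push_inflation_eq_zero h, map_zero] at h2
  obtain ⟨s, hs⟩ := exists_factor h2 (𝟙 Y) (by simp)
  exact ⟨M, m, e, ⟨_, _, ⟨_, h1⟩, hN₃⟩, ⟨⟨_, _, ⟨_, h2⟩, hW⟩, IsSplitEpi.mk' ⟨s, hs⟩⟩, h3⟩

/-- Functors inverting `SN N` identify morphisms which agree modulo `N`. -/
lemma map_eq_of_inverts {D : Type u₂} [Category.{v₂} D] {F : A ⥤ D} (hF : (SN N).IsInvertedBy F)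
    {X Y : A} {f g : X ⟶ Y} (h : FactorsThru N (f - g)) : F.map f = F.map g := by
  obtain ⟨W, i, j, hW, h⟩ := h
  have := hF (biprod.fst : X ⊞ W ⟶ X) (.of_def _ (.biprod_fst X hW))
  -- Both maps are sections of the projection `X ⊞ W ⟶ X`, which `F` inverts; composing them with
  -- the same map `(g, j)` gives `f` and `g`.
  have h1 : F.map (biprod.lift (𝟙 X) i) = F.map biprod.inl := by
    rw [← cancel_mono (F.map (biprod.fst : X ⊞ W ⟶ X)), ← F.map_comp, ← F.map_comp]
    simp
  have h2 : f = biprod.lift (𝟙 X) i ≫ biprod.desc g j := by simp [← h]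
  rw [h2, F.map_comp, h1, ← F.map_comp, biprod.inl_desc]

variable [IsExtensionClosed N]

lemma InfN.comp {X Y Z : A} {f : X ⟶ Y} {g : Y ⟶ Z} (hf : InfN N f) (hg : InfN N g) :
    InfN N (f ≫ g) := by
  obtain ⟨D, f', ⟨δ, h⟩, hD⟩ := hf
  obtain ⟨F, g', ⟨ρ, h'⟩, hF⟩ := hg
  obtain ⟨M, k, d, e, δ', h1, h2, -⟩ := et4 h h'
  exact ⟨M, k, ⟨δ', h1⟩, IsExtensionClosed.mid ⟨_, h2⟩ hD hF⟩

lemma DefN.comp {X Y Z : A} {f : X ⟶ Y} {g : Y ⟶ Z} (hf : DefN N f) (hg : DefN N g) :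
    DefN N (f ≫ g) :=
  (hg.op.comp hf.op).unop

lemma InfN.of_isIso {X Y : A} (f : X ⟶ Y) [IsIso f] : InfN N f :=
  ⟨0, 0, ⟨0, by
    simpa using realizes_of_iso (asIso f) (realizes_id_of_isZero X (isZero_zero A))⟩,
    prop_of_isZero (isZero_zero A)⟩

lemma DefN.of_isIso {X Y : A} (f : X ⟶ Y) [IsIso f] : DefN N f :=
  (InfN.of_isIso (N := N.op) f.op).unop

lemma SN.id (X : A) : SN N (𝟙 X) := .of_inf _ (.of_isIso _)

/-- An inflation with cone in `N` may be enlarged by a morphism to an object of `N`. -/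
lemma InfN.lift {X Y W : A} {f : X ⟶ Y} (hf : InfN N f) (i : X ⟶ W) (hW : N W) :
    InfN N (biprod.lift f i) := by
  obtain ⟨D, f', ⟨δ, h⟩, hD⟩ := hf
  obtain ⟨M, p, e, δ', η, h1, h2, -⟩ := exists_realizes_lift h i
  exact ⟨M, p, ⟨δ', h1⟩, IsExtensionClosed.mid ⟨_, h2⟩ hW hD⟩

lemma DefSpN.comp {X Y Z : A} {f : X ⟶ Y} {g : Y ⟶ Z} (hf : DefSpN N f) (hg : DefSpN N g) :
    DefSpN N (f ≫ g) := by
  obtain ⟨hf, ⟨⟨s⟩⟩⟩ := hf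
  obtain ⟨hg, ⟨⟨t⟩⟩⟩ := hg
  exact ⟨hf.comp hg, IsSplitEpi.mk' ⟨t.section_ ≫ s.section_, by simp⟩⟩

lemma IsAbsorbing.of_spade (hA : IsWIC A) (hN : IsSummandClosed N) (hs : Spade N) :
    IsAbsorbing N where
  compl := hA.hasSplitComplements
  retract {X Y} i r h hY := by
    obtain ⟨C, j, c, h1, h2⟩ := hA.hasSplitComplements i r h
    obtain ⟨h3, h4⟩ := split_complement_comp h h1 h2
    let e : Y ≅ X ⊞ C :=
      { hom := biprod.lift r c
        inv := biprod.desc i j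
        hom_inv_id := by simp [h2]
        inv_hom_id := by ext <;> simp [h, h1, h3, h4] }
    exact (hN X C (N.prop_of_iso e hY)).1
  inflation {X B} f hX hf := by
    obtain ⟨Y, b, Z, g, δ, h⟩ := hs.inflation ⟨X, hX⟩ B f hf
    exact ⟨Y.obj, b, Y.property, Z.obj, g.hom, ⟨δ, h⟩, Z.property⟩
  deflation {X B} f hX hf := by
    obtain ⟨Y, b, Z, g, δ, h⟩ := hs.deflation ⟨X, hX⟩ B f hf
    exact ⟨Y.obj, b, Y.property, Z.obj, g.hom, ⟨δ, h⟩, Z.property⟩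

namespace IsAbsorbing

variable (hN : IsAbsorbing N)
include hN

/-- The same pushout: `W ⟶ M ⟶ Z` splits, so `Z` is a retract of `M`, which is an extension of `N₃`
by `Y`. -/
lemma right {X Y Z : A} {x : X ⟶ Y} {y : Y ⟶ Z} (h : IsConflation x y) (hX : N X)
    (hY : N Y) : N Z := by
  obtain ⟨W, b, hW, N₃, g, ⟨δ', h'⟩, hN₃⟩ := hN.inflation x hX ⟨_, _, h⟩
  obtain ⟨δ, h⟩ := h
  obtain ⟨M, m, m', e, e', h1, h2, -⟩ := exists_pushout h h'
  rw [push_comp, push_inflation_eq_zero h, map_zero] at h2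
  obtain ⟨s, hs⟩ := exists_factor h2 (𝟙 Z) (by simp)
  exact hN.retract s e hs (IsExtensionClosed.mid ⟨_, h1⟩ hY hN₃)

lemma left {X Y Z : A} {x : X ⟶ Y} {y : Y ⟶ Z} (h : IsConflation x y) (hY : N Y)
    (hZ : N Z) : N X := by
  obtain ⟨δ, h⟩ := h
  exact hN.op.right ⟨_, op_realizes h⟩ hZ hY

lemma isThick (hN' : IsSummandClosed N) : IsThick N where
  iso := inferInstance
  summand := hN'
  left := hN.left
  mid := IsExtensionClosed.mid
  right := hN.right

/-- By induction; in a composite, the split deflation of the first factor is moved past the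
inflation of the second with `DefSpN.exchange`. -/
lemma exists_fac {X Y : A} {f : X ⟶ Y} (hf : SN N f) :
    compClass (DefSpN N) (InfN N) f := by
  induction hf with
  | @of_inf X Y f h =>
    exact ⟨Y, f, 𝟙 Y, h, ⟨.of_isIso _, inferInstance⟩, Category.comp_id _⟩
  | of_def f h => exact hN.exists_fac_of_defN h
  | comp f g _ _ hf hg =>
    obtain ⟨M, a, p, ha, hp, rfl⟩ := hf
    obtain ⟨M', a', p', ⟨D, q, ha', hD⟩, hp', rfl⟩ := hg
    obtain ⟨M₂, D', h, h', r, hh, ⟨e⟩, hr, hc⟩ := hp.exchange ha'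
    exact ⟨M₂, a ≫ h, r ≫ p', ha.comp ⟨D', h', hh, N.prop_of_iso e hD⟩, hr.comp hp',
      by simp [reassoc_of% hc]⟩

lemma exists_fac' {X Y : A} {f : X ⟶ Y} (hf : SN N f) :
    compClass (DefN N) (InfSpN N) f := by
  obtain ⟨M, a, p, ha, hp, h⟩ := hN.op.exists_fac hf.op
  exact ⟨M.unop, p.unop, a.unop, hp.unop, ha.unop, congrArg (·.unop) h⟩

lemma SN_eq : SN N = compClass (DefSpN N) (InfN N) := by
  ext X Y f
  refine ⟨hN.exists_fac, ?_⟩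
  rintro ⟨M, a, p, ha, hp, rfl⟩
  exact .comp _ _ (.of_inf _ ha) (.of_def _ hp.1)

lemma SN_eq' : SN N = compClass (DefN N) (InfSpN N) := by
  ext X Y f
  refine ⟨hN.exists_fac', ?_⟩
  rintro ⟨M, a, p, ha, hp, rfl⟩
  exact .comp _ _ (.of_inf _ ha.1) (.of_def _ hp)

/-- Every morphism of `SN N` is an inflation followed by a projection. -/
lemma exists_inf_lift {X Y : A} {f : X ⟶ Y} (hf : SN N f) :
    ∃ (K : A) (n : X ⟶ K), N K ∧ InfN N (biprod.lift n f) := by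
  obtain ⟨M, a, p, ha, hp, rfl⟩ := hN.exists_fac hf
  obtain ⟨K, e, hK, rfl⟩ := hp.exists_iso
  refine ⟨K, a ≫ e.hom ≫ biprod.fst, hK, ?_⟩
  convert ha.comp (InfN.of_isIso e.hom) using 1
  ext <;> simp

/-- The class `SN N` is stable under changing a morphism modulo `N`. -/
lemma SN_of_sub {X Y : A} {f f' : X ⟶ Y} (hf : SN N f) (h : FactorsThru N (f' - f)) :
    SN N f' := by
  obtain ⟨W, i, j, hW, h⟩ := h
  obtain ⟨M, a, p, ha, hp, rfl⟩ := hN.exists_fac hf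
  obtain ⟨hp, ⟨⟨s⟩⟩⟩ := hp
  -- The perturbation `i ≫ j` is absorbed by enlarging `a` to `(a, i)` and applying the shear that
  -- adds `j`, lifted to `M` through the section of `p`.
  obtain ⟨θ, hθ⟩ : ∃ θ : M ⊞ W ≅ M ⊞ W,
      θ.hom = biprod.lift (biprod.fst + biprod.snd ≫ j ≫ s.section_) biprod.snd :=
    ⟨{hom := biprod.lift (biprod.fst + biprod.snd ≫ j ≫ s.section_) biprod.snd
      inv := biprod.lift (biprod.fst - biprod.snd ≫ j ≫ s.section_) biprod.snd
      hom_inv_id := by ext <;> simp [Preadditive.comp_sub]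
      inv_hom_id := by ext <;> simp [Preadditive.comp_add] }, rfl⟩
  have : f' = biprod.lift a i ≫ θ.hom ≫ biprod.fst ≫ p := by
    rw [← sub_add_cancel f' (a ≫ p), h]
    simp [hθ, Preadditive.comp_add, Preadditive.add_comp, add_comm]
  rw [this]
  exact .comp _ _ (.of_inf _ (ha.lift i hW)) (.comp _ _ (.of_inf _ (.of_isIso _))
    (.comp _ _ (.of_def _ (.biprod_fst M hW)) (.of_def _ hp)))

/-- Isomorphisms modulo `N` belong to `SN N`. -/
lemma SN_of_isIso_mod {X Y : A} (f : X ⟶ Y) (g : Y ⟶ X) (h : FactorsThru N (f ≫ g - 𝟙 X))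
    (h' : FactorsThru N (g ≫ f - 𝟙 Y)) : SN N f := by
  obtain ⟨W, i, j, hW, h⟩ := h
  -- Adding the component `i` turns an inverse modulo `N` into an honest retraction. It then
  -- suffices that the complement `C` of this section lies in `N`.
  have hr : biprod.lift f i ≫ biprod.desc g (-j) = 𝟙 X := by
    simp [← h]
  obtain ⟨C, q, c, h1, h2⟩ := hN.compl _ _ hr
  obtain ⟨h3, h4⟩ := split_complement_comp hr h1 h2
  have hC : N C := by
    apply hN.prop_of_factorsThru_id
    have e1 : f ≫ biprod.inl ≫ c = -(i ≫ biprod.inr ≫ c) := by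
      rw [eq_neg_iff_add_eq_zero]
      simpa [biprod.lift_eq] using h3
    have e2 : 𝟙 C = q ≫ biprod.fst ≫ biprod.inl ≫ c + q ≫ biprod.snd ≫ biprod.inr ≫ c := by
      rw [← h1]
      have := congrArg (fun t => q ≫ t ≫ c) (biprod.total (X := Y) (Y := W))
      simp only [Preadditive.add_comp, Preadditive.comp_add, Category.id_comp,
        Category.assoc] at this
      exact this.symm
    -- In the component of `𝟙 C` through `Y`, the identity of `Y` is replaced by `g ≫ f` at the cost
    -- of a morphism through `N`; by `e1` the new term factors through `W`.
    have e3 : 𝟙 C = q ≫ biprod.snd ≫ biprod.inr ≫ c -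
        (q ≫ biprod.fst) ≫ g ≫ i ≫ biprod.inr ≫ c -
        (q ≫ biprod.fst) ≫ (g ≫ f - 𝟙 Y) ≫ biprod.inl ≫ c := by
      rw [Preadditive.sub_comp, Category.assoc g, e1]
      simp only [Category.assoc, Preadditive.comp_sub, Preadditive.comp_neg, Category.id_comp]
      rw [e2]
      abel
    rw [e3]
    refine FactorsThru.sub (FactorsThru.sub ?_ ?_) ((h'.comp_right _).comp_left _)
    · exact ⟨W, q ≫ biprod.snd, biprod.inr ≫ c, hW, by simp⟩
    · exact ⟨W, (q ≫ biprod.fst) ≫ g ≫ i, biprod.inr ≫ c, hW, by simp⟩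
  have : InfN N (biprod.lift f i) :=
    ⟨C, c, ⟨0, realizes_split _ _ hr h1 h2 h3 h4⟩, hC⟩
  have h5 := SN.comp _ _ (.of_inf _ this) (.of_def _ (.biprod_fst Y hW))
  rwa [biprod.lift_fst] at h5

/-- Two-out-of-three, first part. -/
lemma SN_of_comp_right {X Y Z : A} {f : X ⟶ Y} {g : Y ⟶ Z} (hfg : SN N (f ≫ g))
    (hg : SN N g) : SN N f := by
  obtain ⟨M, a, p, ⟨D, q, ⟨ρ, ha⟩, hD⟩, hp, rfl⟩ := hN.exists_fac hg
  -- The projection `p` is invertible modulo `N`, with inverse the inclusion of the summand `Z`, so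
  -- `f ≫ a` agrees with `(f ≫ a ≫ p)` followed by this inclusion up to a map through `K`.
  have hfa : SN N (f ≫ a) := by
    obtain ⟨K, e, hK, rfl⟩ := hp.exists_iso
    have h1 : SN N ((f ≫ a ≫ e.hom ≫ biprod.snd) ≫ biprod.inr ≫ e.inv) :=
      .comp _ _ hfg (.comp _ _ (.of_inf _ (.biprod_inr Z hK)) (.of_inf _ (.of_isIso _)))
    refine hN.SN_of_sub h1 ⟨K, f ≫ a ≫ e.hom ≫ biprod.fst, biprod.inl ≫ e.inv, hK, ?_⟩
    have := congrArg (fun t => f ≫ a ≫ e.hom ≫ t ≫ e.inv) (biprod.total (X := K) (Y := Z))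
    simp only [Preadditive.add_comp, Preadditive.comp_add, Category.id_comp, Iso.hom_inv_id,
      Category.comp_id] at this
    rw [← this]
    simp
  obtain ⟨K, n, hK, hn⟩ := hN.exists_inf_lift hfa
  have hn' : biprod.lift n (f ≫ a) = biprod.lift n f ≫ biprod.map (𝟙 K) a := by ext <;> simp
  rw [hn'] at hn
  obtain ⟨C, c, ⟨ε, hc⟩, hC⟩ := hn
  -- Cancellation makes `(n, f)` an inflation. Its cone `F` is the first term of a conflation ending
  -- in `0 ⊞ D`, whose middle term is another cone of `(n, f ≫ a)` and so a retract of `C`.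
  obtain ⟨F, f', δ, hf⟩ := IsInflation.of_comp hN.compl ⟨C, c, ε, hc⟩
  obtain ⟨M', k, d, e, δ', h1, h2, -⟩ := et4 hf
    (realizes_sum (realizes_id_of_isZero K (isZero_zero A)) ha)
  obtain ⟨i, r, hir⟩ := exists_retract_cone h1 hc
  have hF : N F := hN.left ⟨_, h2⟩ (hN.retract i r hir hC)
    (prop_biprod N (prop_of_isZero (isZero_zero A)) hD)
  have h5 := SN.comp _ _ (.of_inf _ ⟨F, f', ⟨δ, hf⟩, hF⟩) (.of_def _ (.biprod_snd Y hK))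
  rwa [biprod.lift_snd] at h5

lemma SN_of_comp_left {X Y Z : A} {f : X ⟶ Y} {g : Y ⟶ Z} (hfg : SN N (f ≫ g))
    (hf : SN N f) : SN N g :=
  (hN.op.SN_of_comp_right (f := g.op) (g := f.op) hfg.op hf.op).unop

/-- Morphisms of `SN N` are epimorphisms modulo `N`. -/
lemma factorsThru_of_comp_left {X Y Z : A} {s : X ⟶ Y} (hs : SN N s) {f : Y ⟶ Z}
    (h : FactorsThru N (s ≫ f)) : FactorsThru N f := by
  obtain ⟨M, a, p, ⟨D, q, ⟨ρ, ha⟩, hD⟩, ⟨hp, ⟨⟨t⟩⟩⟩, rfl⟩ := hN.exists_fac hs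
  have hpf : FactorsThru N (p ≫ f) := by
    obtain ⟨W, i, j, hW, h⟩ := h
    rw [Category.assoc] at h
    -- The inflation `(a, i)` is killed by `(p ≫ f, -j)`, which therefore factors through its cone
    -- `C`, an extension of `D` by `W`.
    obtain ⟨C, c, e, δ', η, h1, h2, -⟩ := exists_realizes_lift ha i
    obtain ⟨k, hk⟩ := exists_desc h1 (biprod.desc (p ≫ f) (-j)) (by simp [h])
    refine ⟨C, biprod.inl ≫ c, k, IsExtensionClosed.mid ⟨_, h2⟩ hW hD, ?_⟩
    rw [Category.assoc, hk, biprod.inl_desc]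
  simpa using hpf.comp_left t.section_

lemma factorsThru_of_comp_right {X Y Z : A} {s : Y ⟶ Z} (hs : SN N s) {f : X ⟶ Y}
    (h : FactorsThru N (f ≫ s)) : FactorsThru N f :=
  (hN.op.factorsThru_of_comp_left (s := s.op) (f := f.op) hs.op h.op).of_op

/-- The Ore condition modulo `N`. -/
lemma exists_ore {X X' Y : A} {s : X ⟶ X'} (hs : SN N s) (f : X ⟶ Y) :
    ∃ (Y' : A) (t : Y ⟶ Y') (f' : X' ⟶ Y'), SN N t ∧ FactorsThru N (f ≫ t - s ≫ f') := by
  obtain ⟨M, a, p, ⟨D, q, ⟨ρ, ha⟩, hD⟩, ⟨⟨K, k, ⟨ρ', hp⟩, hK⟩, ⟨⟨σ⟩⟩⟩, rfl⟩ := hN.exists_fac hs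
  -- The inflation part `a` is pushed out along `f`; the pushout inflation `t` has the same cone
  -- `D`. The retraction `p` is undone by its section, with an error that factors through `K`.
  obtain ⟨Y', t, q', ht⟩ := exists_realizes (push E f ρ)
  obtain ⟨b, hb, -⟩ := exists_mid f (𝟙 D) ha ht (by rw [pull_id])
  refine ⟨Y', t, σ.section_ ≫ b, .of_inf _ ⟨D, q', ⟨_, ht⟩, hD⟩, ?_⟩
  obtain ⟨l, hl⟩ := exists_lift hp (𝟙 M - p ≫ σ.section_) (by simp)
  refine ⟨K, a ≫ l, k ≫ b, hK, ?_⟩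
  have := congrArg (fun t => a ≫ t ≫ b) hl
  rw [← hb]
  simpa using this.symm

lemma exists_ore' {X' Y' Y : A} {s : Y ⟶ Y'} (hs : SN N s) (f : X' ⟶ Y') :
    ∃ (X : A) (t : X ⟶ X') (f' : X ⟶ Y), SN N t ∧ FactorsThru N (t ≫ f - f' ≫ s) := by
  obtain ⟨X, t, f', ht, h⟩ := hN.op.exists_ore (s := s.op) hs.op f.op
  exact ⟨X.unop, t.unop, f'.unop, ht.unop, FactorsThru.of_op h⟩

omit hN in
/-- Lifting morphisms of `SN N` to realizations, covariantly. -/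
lemma _root_.ET.SN.exists_push {X X' : A} {a : X ⟶ X'} (ha : SN N a) :
    ∀ {Y Y' Z : A} {x : X ⟶ Y} {y : Y ⟶ Z} {x' : X' ⟶ Y'} {y' : Y' ⟶ Z}
    {δ : Ext (E (A := A)) Z X}, Realizes x y δ → Realizes x' y' (push E a δ) →
    ∃ b : Y ⟶ Y', SN N b ∧ x ≫ b = a ≫ x' ∧ b ≫ y' = y := by
  induction ha with
  | of_inf a ha =>
    intro Y Y' Z x y x' y' δ h h'
    obtain ⟨D, q, ⟨ρ, ha⟩, hD⟩ := ha
    -- For an inflation `a`, the lift `Y ⟶ M` is the pushout of `a` along `x`, with the same cone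
    -- `D`.
    obtain ⟨M, m, m', e, e', h1, h2, h3, h4, -⟩ := exists_pushout h ha
    obtain ⟨φ, hφ1, hφ2⟩ := iso_of_realizes h2 h'
    exact ⟨m ≫ φ.hom, .comp _ _ (.of_inf _ ⟨D, e', ⟨_, h1⟩, hD⟩) (.of_inf _ (.of_isIso _)),
      by rw [reassoc_of% h3, hφ1], by rw [Category.assoc, hφ2, h4]⟩
  | of_def a ha =>
    intro Y Y' Z x y x' y' δ h h'
    obtain ⟨K, k, ⟨ρ, ha⟩, hK⟩ := ha
    -- For a deflation `a` with cocone `K`, the lift is the cone map of the composite inflation `K ⟶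
    -- X ⟶ Y`.
    obtain ⟨M, m, d, e, δ', h1, h2, h3, h4, -⟩ := et4 ha h
    obtain ⟨φ, hφ1, hφ2⟩ := iso_of_realizes h2 h'
    exact ⟨m ≫ φ.hom, .comp _ _ (.of_def _ ⟨K, _, ⟨_, h1⟩, hK⟩) (.of_inf _ (.of_isIso _)),
      by rw [← hφ1, reassoc_of% h3], by rw [Category.assoc, hφ2, h4]⟩
  | @comp X₁ X₂ X₃ f g _ _ hf hg =>
    intro Y Y' Z x y x' y' δ h h'
    obtain ⟨Y₁, x₁, y₁, h₁⟩ := exists_realizes (push E f δ)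
    obtain ⟨b, hb1, hb2, hb3⟩ := hf h h₁
    obtain ⟨b', hb1', hb2', hb3'⟩ := hg h₁ (by rwa [← push_comp])
    exact ⟨b ≫ b', .comp _ _ hb1 hb1', by rw [reassoc_of% hb2, hb2', Category.assoc],
      by rw [Category.assoc, hb3', hb3]⟩

omit hN in
/-- Lifting morphisms of `SN N` to realizations, contravariantly. -/
lemma _root_.ET.SN.exists_pull {Z Z' : A} {c : Z' ⟶ Z} (hc : SN N c) {X Y Y' : A}
    {x : X ⟶ Y} {y : Y ⟶ Z} {x' : X ⟶ Y'} {y' : Y' ⟶ Z'} {δ : Ext (E (A := A)) Z X}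
    (h : Realizes x y δ) (h' : Realizes x' y' (pull E c δ)) :
    ∃ b : Y' ⟶ Y, SN N b ∧ x' ≫ b = x ∧ b ≫ y = y' ≫ c := by
  obtain ⟨b, h1, h2, h3⟩ := hc.op.exists_push (op_realizes h) (op_realizes h')
  exact ⟨b.unop, h1.unop, congrArg (·.unop) h3, congrArg (·.unop) h2⟩

/-- Extensions extend along `SN N` after pushing out along `SN N`. -/
lemma exists_push_eq_pull {C' C X : A} {s : C' ⟶ C} (hs : SN N s)
    (δ : Ext (E (A := A)) C' X) :
    ∃ (X' : A) (t : X ⟶ X') (δ' : Ext (E (A := A)) C X'), SN N t ∧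
      push E t δ = pull E s δ' := by
  obtain ⟨D, g, d, ⟨-, ⟨⟨r⟩⟩⟩, ⟨K, k, ⟨ρ, hd⟩, hK⟩, rfl⟩ := hN.exists_fac' hs
  -- The retraction extends `δ` to `D`; the obstruction to descending it along `d` is its
  -- restriction to `K`. The inflation realizing that restriction kills it and has cone `K`, so it
  -- serves as `t`.
  obtain ⟨X', t, q, ht⟩ := exists_realizes (pull E k (pull E r.retraction δ))
  obtain ⟨δ', hδ'⟩ := exists_pull_deflation_eq hd (push E t (pull E r.retraction δ))
    (by rw [← push_pull, push_inflation_eq_zero ht])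
  refine ⟨X', t, δ', .of_inf _ ⟨K, q, ⟨_, ht⟩, hK⟩, ?_⟩
  rw [pull_comp, ← hδ', ← push_pull, ← pull_comp, r.id, pull_id]

lemma exists_pull_eq_push {C X X' : A} {t : X ⟶ X'} (ht : SN N t)
    (δ : Ext (E (A := A)) C X') :
    ∃ (C' : A) (s : C' ⟶ C) (δ' : Ext (E (A := A)) C' X), SN N s ∧
      pull E s δ = push E t δ' := by
  obtain ⟨C', s, δ', hs, h⟩ := hN.op.exists_push_eq_pull ht.op (C' := .op X') (X := .op C) δ
  exact ⟨C'.unop, s.unop, δ', hs.unop, h⟩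

end IsAbsorbing

/-! ### Extensions that die in the localization -/

variable (N) in
/-- The subgroup of extensions which are pushouts of extensions by objects of `N`. -/
def nullExt (C X : A) : AddSubgroup (Ext (E (A := A)) C X) where
  carrier := { δ | ∃ (K : A) (ε : Ext (E (A := A)) C K) (j : K ⟶ X), N K ∧ δ = push E j ε }
  zero_mem' := ⟨0, 0, 0, prop_of_isZero (isZero_zero A), by simp⟩
  add_mem' := by
    rintro _ _ ⟨K, ε, j, hK, rfl⟩ ⟨K', ε', j', hK', rfl⟩
    refine ⟨K ⊞ K', push E biprod.inl ε + push E biprod.inr ε', biprod.desc j j',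
      prop_biprod N hK hK', ?_⟩
    rw [map_add, ← push_comp, ← push_comp, biprod.inl_desc, biprod.inr_desc]
  neg_mem' := by
    rintro _ ⟨K, ε, j, hK, rfl⟩
    exact ⟨K, -ε, j, hK, by rw [map_neg]⟩

lemma push_mem_nullExt {C X X' : A} (a : X ⟶ X') {δ : Ext (E (A := A)) C X}
    (h : δ ∈ nullExt N C X) : push E a δ ∈ nullExt N C X' := by
  obtain ⟨K, ε, j, hK, rfl⟩ := h
  exact ⟨K, ε, j ≫ a, hK, by rw [push_comp]⟩

lemma pull_mem_nullExt {C C' X : A} (c : C' ⟶ C) {δ : Ext (E (A := A)) C X}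
    (h : δ ∈ nullExt N C X) : pull E c δ ∈ nullExt N C' X := by
  obtain ⟨K, ε, j, hK, rfl⟩ := h
  exact ⟨K, pull E c ε, j, hK, by rw [push_pull]⟩

lemma push_mem_nullExt_of_factorsThru {C X X' : A} {a : X ⟶ X'} (ha : FactorsThru N a)
    (δ : Ext (E (A := A)) C X) : push E a δ ∈ nullExt N C X' := by
  obtain ⟨K, i, j, hK, rfl⟩ := ha
  exact ⟨K, push E i δ, j, hK, by rw [push_comp]⟩

lemma exists_pull_eq_zero_of_mem {C X : A} {δ : Ext (E (A := A)) C X} (h : δ ∈ nullExt N C X) :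
    ∃ (C' : A) (s : C' ⟶ C), SN N s ∧ pull E s δ = 0 := by
  obtain ⟨K, ε, j, hK, rfl⟩ := h
  obtain ⟨C', k, s, hs⟩ := exists_realizes ε
  exact ⟨C', s, .of_def _ ⟨K, k, ⟨_, hs⟩, hK⟩,
    by rw [← push_pull, pull_deflation_eq_zero hs, map_zero]⟩

namespace IsAbsorbing

variable (hN : IsAbsorbing N)
include hN

/-- Since `d_*` kills `g_* δ`, this class is pushed out from the cocone `K` of `d`; the retraction
of `g` then recovers `δ`. -/
lemma mem_nullExt_of_push_eq_zero {C X X' : A} {t : X ⟶ X'} (ht : SN N t)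
    {δ : Ext (E (A := A)) C X} (h : push E t δ = 0) : δ ∈ nullExt N C X := by
  obtain ⟨D, g, d, ⟨-, ⟨⟨r⟩⟩⟩, ⟨K, k, ⟨ρ, hd⟩, hK⟩, rfl⟩ := hN.exists_fac' ht
  rw [push_comp] at h
  obtain ⟨ε, hε⟩ := exists_push_inflation_eq hd _ h
  exact ⟨K, ε, k ≫ r.retraction, hK, by rw [push_comp, ← hε, ← push_comp, r.id, push_id]⟩

/-- By (♠) the inflation `x` realizing `ε` extends to `x ≫ b : K ⟶ W` with cone in `N`. For its
pushout `t` along `j`, the map `j ≫ t` factors through `x`, and `x_* ε = 0`. -/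
lemma exists_push_eq_zero_of_mem {C X : A} {δ : Ext (E (A := A)) C X}
    (h : δ ∈ nullExt N C X) : ∃ (X' : A) (t : X ⟶ X'), SN N t ∧ push E t δ = 0 := by
  obtain ⟨K, ε, j, hK, rfl⟩ := h
  obtain ⟨B, x, y, hε⟩ := exists_realizes ε
  obtain ⟨W, b, hW, D, q, ⟨ρ, h'⟩, hD⟩ := hN.inflation x hK ⟨_, _, _, hε⟩
  obtain ⟨X', t, q', ht⟩ := exists_realizes (push E j ρ)
  obtain ⟨l, hl, -⟩ := exists_mid j (𝟙 D) h' ht (by rw [pull_id])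
  refine ⟨X', t, .of_inf _ ⟨D, q', ⟨_, ht⟩, hD⟩, ?_⟩
  rw [← push_comp, ← hl, push_comp, push_comp, push_inflation_eq_zero hε, map_zero, map_zero]

/-- Null extensions are those killed by pushing out along some member of `SN N`, and equally those
killed by pulling back; this makes the one-sided definition self-dual. -/
lemma mem_nullExt_of_op {C X : A} {δ : Ext (E (A := A)) C X}
    (h : (show Ext (E (A := Aᵒᵖ)) (.op X) (.op C) from δ) ∈ nullExt N.op (.op X) (.op C)) :
    δ ∈ nullExt N C X := by
  obtain ⟨X', t, ht, h⟩ := exists_pull_eq_zero_of_mem h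
  exact hN.mem_nullExt_of_push_eq_zero ht.unop h

lemma pull_mem_nullExt_of_factorsThru {C C' X : A} {c : C' ⟶ C} (hc : FactorsThru N c)
    (δ : Ext (E (A := A)) C X) : pull E c δ ∈ nullExt N C' X := by
  apply hN.mem_nullExt_of_op
  exact push_mem_nullExt_of_factorsThru (A := Aᵒᵖ) hc.op
    (show Ext (E (A := Aᵒᵖ)) (.op X) (.op C) from δ)

lemma mem_nullExt_of_push {C X X' : A} {t : X ⟶ X'} (ht : SN N t)
    {δ : Ext (E (A := A)) C X} (h : push E t δ ∈ nullExt N C X') : δ ∈ nullExt N C X := by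
  obtain ⟨X'', t', ht', h⟩ := hN.exists_push_eq_zero_of_mem h
  rw [← push_comp] at h
  exact hN.mem_nullExt_of_push_eq_zero (.comp _ _ ht ht') h

lemma mem_nullExt_of_pull_eq_zero {C C' X : A} {s : C' ⟶ C} (hs : SN N s)
    {δ : Ext (E (A := A)) C X} (h : pull E s δ = 0) : δ ∈ nullExt N C X :=
  hN.mem_nullExt_of_op (hN.op.mem_nullExt_of_push_eq_zero hs.op h)

lemma mem_nullExt_of_pull {C C' X : A} {s : C' ⟶ C} (hs : SN N s)
    {δ : Ext (E (A := A)) C X} (h : pull E s δ ∈ nullExt N C' X) : δ ∈ nullExt N C X := by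
  obtain ⟨C'', s', hs', h⟩ := exists_pull_eq_zero_of_mem h
  rw [← pull_comp] at h
  exact hN.mem_nullExt_of_pull_eq_zero (.comp _ _ hs' hs) h

end IsAbsorbing

end Classes

end ET

/-! ### The ideal quotient and the conditions (MR1)-(MR4) -/

namespace ET

open Extriangulated

section IdealQuotient

open ZeroObject

variable {A : Type u} [Category.{v} A] [Preadditive A] [HasZeroObject A]
  [HasBinaryBiproducts A] [Extriangulated A] {N : ObjectProperty A} [IsExtensionClosed N]

/-- A factorization of `X ⟶ 0` exhibits `X` as the cocone of a deflation between objects of `N`: the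
middle term is an extension of `0` by an object of `N`. -/
lemma IsAbsorbing.nullObjects_eq (hN : IsAbsorbing N) : nullObjects (SN N) = N := by
  ext X
  constructor
  · rintro ⟨h, -⟩
    obtain ⟨M, a, p, ⟨D, q, ha, hD⟩, ⟨⟨K, k, hp, hK⟩, -⟩, -⟩ := hN.exists_fac h
    exact hN.left ha (IsExtensionClosed.mid hp hK (prop_of_isZero (isZero_zero A))) hD
  · intro hX
    exact ⟨.of_def _ ⟨X, 𝟙 X, ⟨0, realizes_id_of_isZero X (isZero_zero A)⟩, hX⟩,
      .of_inf _ ⟨X, 𝟙 X, ⟨0, realizes_of_isZero_id X (isZero_zero A)⟩, hX⟩⟩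

lemma IsAbsorbing.idealRel_iff (hN : IsAbsorbing N) {X Y : A} (f g : X ⟶ Y) :
    idealRel (nullObjects (SN N)) f g ↔ FactorsThru N (f - g) := by
  rw [hN.nullObjects_eq]
  rfl

/-- The morphism of extensions factors through the common class `a_* δ = c^* δ'`, so the two
one-sided liftings can be composed. -/
lemma exists_mid_SN {X Y Z X' Y' Z' : A} {x : X ⟶ Y} {y : Y ⟶ Z} {δ : Ext (E (A := A)) Z X}
    {x' : X' ⟶ Y'} {y' : Y' ⟶ Z'} {δ' : Ext (E (A := A)) Z' X'} {a : X ⟶ X'} {c : Z ⟶ Z'}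
    (h : Realizes x y δ) (h' : Realizes x' y' δ') (hδ : push E a δ = pull E c δ')
    (ha : SN N a) (hc : SN N c) : ∃ b : Y ⟶ Y', SN N b ∧ x ≫ b = a ≫ x' ∧ y ≫ c = b ≫ y' := by
  obtain ⟨M, i, p, hM⟩ := exists_realizes (push E a δ)
  obtain ⟨b₁, h1, h2, h3⟩ := ha.exists_push h hM
  rw [hδ] at hM
  obtain ⟨b₂, h4, h5, h6⟩ := hc.exists_pull h' hM
  exact ⟨b₁ ≫ b₂, .comp _ _ h1 h4, by rw [reassoc_of% h2, h5],
    by rw [← h3, Category.assoc, Category.assoc, h6]⟩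

lemma IsInflation.comp {X Y Z : A} {f : X ⟶ Y} {g : Y ⟶ Z} (hf : IsInflation f)
    (hg : IsInflation g) : IsInflation (f ≫ g) := by
  obtain ⟨D, f', δ, h⟩ := hf
  obtain ⟨F, g', ρ, h'⟩ := hg
  obtain ⟨M, k, d, e, δ', h1, -⟩ := et4 h h'
  exact ⟨M, k, δ', h1⟩

/-- This is (MR4) before passing to the quotient: the inflation part of `s` joins `x`, and its split
deflation is moved past `x'`. -/
lemma IsAbsorbing.inflation_comp (hN : IsAbsorbing N) {X Y Z W : A} {x : X ⟶ Y} {s : Y ⟶ Z}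
    {x' : Z ⟶ W} (hx : IsInflation x) (hs : SN N s) (hx' : IsInflation x') :
    ∃ (M : A) (i : X ⟶ M) (p : M ⟶ W), IsInflation i ∧ DefSpN N p ∧ i ≫ p = x ≫ s ≫ x' := by
  obtain ⟨M, a, p, ⟨D, q, ha, hD⟩, hp, rfl⟩ := hN.exists_fac hs
  obtain ⟨F, f', hf⟩ := hx'
  obtain ⟨M₂, D', h, h', r, hh, -, hr, hc⟩ := hp.exchange hf
  exact ⟨M₂, x ≫ a ≫ h, r, hx.comp (IsInflation.comp ⟨D, q, ha⟩ ⟨D', h', hh⟩), hr,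
    by simp [hc]⟩

lemma IsAbsorbing.deflation_comp (hN : IsAbsorbing N) {X Y Z W : A} {x : X ⟶ Y} {s : Y ⟶ Z}
    {x' : Z ⟶ W} (hx : IsDeflation x) (hs : SN N s) (hx' : IsDeflation x') :
    ∃ (M : A) (i : X ⟶ M) (p : M ⟶ W), InfSpN N i ∧ IsDeflation p ∧ i ≫ p = x ≫ s ≫ x' := by
  obtain ⟨M, i, p, hi, hp, h⟩ := hN.op.inflation_comp hx'.op hs.op hx.op
  exact ⟨M.unop, p.unop, i.unop, hp.unop, hi.unop, by simpa using congrArg (·.unop) h⟩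

variable [hN : Fact (IsAbsorbing N)]

instance : Congruence (idealRel (nullObjects (SN N))) where
  comp_left f g g' h := by
    rw [hN.out.idealRel_iff] at h ⊢
    simpa using h.comp_left f
  comp_right g h := by
    rw [hN.out.idealRel_iff] at h ⊢
    simpa using h.comp_right g
  equivalence :=
    { refl f := by
        rw [hN.out.idealRel_iff, sub_self]
        exact .zero _ _
      symm h := by
        rw [hN.out.idealRel_iff] at h ⊢
        simpa using h.neg
      trans h h' := by
        rw [hN.out.idealRel_iff] at h h' ⊢
        simpa using h.add h' }

lemma idealProj_map_eq_iff {X Y : A} (f g : X ⟶ Y) :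
    (idealProj (SN N)).map f = (idealProj (SN N)).map g ↔ FactorsThru N (f - g) := by
  rw [← hN.out.idealRel_iff]
  exact Quotient.functor_map_eq_iff _ f g

lemma SN_of_isIso_idealProj {X Y : A} (f : X ⟶ Y) (h : IsIso ((idealProj (SN N)).map f)) :
    SN N f := by
  obtain ⟨g, hg1, hg2⟩ := h
  obtain ⟨g, rfl⟩ := (idealProj (SN N)).map_surjective g
  rw [← Functor.map_comp, ← CategoryTheory.Functor.map_id, idealProj_map_eq_iff] at hg1 hg2
  exact hN.out.SN_of_isIso_mod f g hg1 hg2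

/-- Closing up under isomorphisms adds no morphisms of `A`, since isomorphisms of the ideal quotient
lift to `SN N` and `SN N` is a union of classes modulo `N`. -/
lemma bar_map_iff {X Y : A} (f : X ⟶ Y) : bar (SN N) ((idealProj (SN N)).map f) ↔ SN N f := by
  constructor
  · rintro ⟨X', Y', s, i, j, hs, h⟩
    obtain ⟨i', hi⟩ := (idealProj (SN N)).map_surjective i.hom
    obtain ⟨j', hj⟩ := (idealProj (SN N)).map_surjective j.hom
    have hi' : SN N i' := SN_of_isIso_idealProj i' (by rw [hi]; infer_instance)
    have hj' : SN N j' := SN_of_isIso_idealProj j' (by rw [hj]; infer_instance)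
    rw [← hi, ← hj, ← Functor.map_comp, ← Functor.map_comp, idealProj_map_eq_iff] at h
    exact hN.out.SN_of_sub (.comp _ _ hi' (.comp _ _ hs hj')) h
  · intro h
    exact ⟨X, Y, f, Iso.refl _, Iso.refl _, h, by simp⟩

lemma bar_id (X : IdealQuot (SN N)) : bar (SN N) (𝟙 X) := by
  obtain ⟨X⟩ := X
  exact (bar_map_iff (𝟙 X)).2 (.id X)

instance : (bar (SN N)).IsMultiplicative where
  id_mem := bar_id
  comp_mem {X Y Z} f g hf hg := by
    obtain ⟨X⟩ := X
    obtain ⟨Y⟩ := Y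
    obtain ⟨Z⟩ := Z
    obtain ⟨f, rfl⟩ := (idealProj (SN N)).map_surjective f
    obtain ⟨g, rfl⟩ := (idealProj (SN N)).map_surjective g
    rw [bar_map_iff] at hf hg
    rw [← Functor.map_comp, bar_map_iff]
    exact .comp _ _ hf hg

variable (N) in
lemma mr1 : MR1 (SN N) where
  of_postcomp {X Y Z} f g hg hfg := by
    obtain ⟨X⟩ := X
    obtain ⟨Y⟩ := Y
    obtain ⟨Z⟩ := Z
    obtain ⟨f, rfl⟩ := (idealProj (SN N)).map_surjective f
    obtain ⟨g, rfl⟩ := (idealProj (SN N)).map_surjective g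
    rw [← Functor.map_comp, bar_map_iff] at hfg
    rw [bar_map_iff] at hg ⊢
    exact hN.out.SN_of_comp_right hfg hg
  of_precomp {X Y Z} f g hf hfg := by
    obtain ⟨X⟩ := X
    obtain ⟨Y⟩ := Y
    obtain ⟨Z⟩ := Z
    obtain ⟨f, rfl⟩ := (idealProj (SN N)).map_surjective f
    obtain ⟨g, rfl⟩ := (idealProj (SN N)).map_surjective g
    rw [← Functor.map_comp, bar_map_iff] at hfg
    rw [bar_map_iff] at hf ⊢
    exact hN.out.SN_of_comp_left hfg hf

/-- Together with `mono_of_bar`, this gives the cancellation axioms of fractions with identity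
denominators; it is also why localizing identifies no further morphisms of the ideal quotient. -/
lemma epi_of_bar {X Y Z : IdealQuot (SN N)} {s : X ⟶ Y} (hs : bar (SN N) s) (f g : Y ⟶ Z)
    (h : s ≫ f = s ≫ g) : f = g := by
  obtain ⟨X⟩ := X
  obtain ⟨Y⟩ := Y
  obtain ⟨Z⟩ := Z
  obtain ⟨s, rfl⟩ := (idealProj (SN N)).map_surjective s
  obtain ⟨f, rfl⟩ := (idealProj (SN N)).map_surjective f
  obtain ⟨g, rfl⟩ := (idealProj (SN N)).map_surjective g
  rw [bar_map_iff] at hs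
  rw [← Functor.map_comp, ← Functor.map_comp, idealProj_map_eq_iff] at h
  rw [idealProj_map_eq_iff]
  exact hN.out.factorsThru_of_comp_left hs (by simpa using h)

lemma mono_of_bar {X Y Z : IdealQuot (SN N)} {s : Y ⟶ Z} (hs : bar (SN N) s) (f g : X ⟶ Y)
    (h : f ≫ s = g ≫ s) : f = g := by
  obtain ⟨X⟩ := X
  obtain ⟨Y⟩ := Y
  obtain ⟨Z⟩ := Z
  obtain ⟨s, rfl⟩ := (idealProj (SN N)).map_surjective s
  obtain ⟨f, rfl⟩ := (idealProj (SN N)).map_surjective f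
  obtain ⟨g, rfl⟩ := (idealProj (SN N)).map_surjective g
  rw [bar_map_iff] at hs
  rw [← Functor.map_comp, ← Functor.map_comp, idealProj_map_eq_iff] at h
  rw [idealProj_map_eq_iff]
  exact hN.out.factorsThru_of_comp_right hs (by simpa using h)

instance : (bar (SN N)).HasLeftCalculusOfFractions where
  exists_leftFraction := by
    rintro ⟨X⟩ ⟨Y⟩ @⟨⟨X'⟩, s, hs, f⟩
    obtain ⟨s, rfl⟩ := (idealProj (SN N)).map_surjective s
    obtain ⟨f, rfl⟩ := (idealProj (SN N)).map_surjective f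
    rw [bar_map_iff] at hs
    obtain ⟨Y', t, f', ht, h⟩ := hN.out.exists_ore hs f
    refine ⟨⟨(idealProj (SN N)).map f', (idealProj (SN N)).map t, (bar_map_iff t).2 ht⟩, ?_⟩
    dsimp only
    rwa [← Functor.map_comp, ← Functor.map_comp, idealProj_map_eq_iff]
  ext X' X Y f₁ f₂ s hs h := ⟨Y, 𝟙 Y, bar_id Y, by rw [epi_of_bar hs f₁ f₂ h]⟩

instance : (bar (SN N)).HasRightCalculusOfFractions where
  exists_rightFraction := by
    rintro ⟨X⟩ ⟨Y⟩ @⟨⟨Y'⟩, f, s, hs⟩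
    obtain ⟨s, rfl⟩ := (idealProj (SN N)).map_surjective s
    obtain ⟨f, rfl⟩ := (idealProj (SN N)).map_surjective f
    rw [bar_map_iff] at hs
    obtain ⟨Y', t, f', ht, h⟩ := hN.out.exists_ore' hs f
    refine ⟨⟨(idealProj (SN N)).map t, (bar_map_iff t).2 ht, (idealProj (SN N)).map f'⟩, ?_⟩
    dsimp only
    rwa [← Functor.map_comp, ← Functor.map_comp, idealProj_map_eq_iff]
  ext X Y Y' f₁ f₂ s hs h := ⟨X, 𝟙 X, bar_id X, by rw [mono_of_bar hs f₁ f₂ h]⟩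

variable (N) in
lemma mr2 : MR2 (SN N) := ⟨inferInstance, inferInstance⟩

variable (N) in
lemma mr3 : MR3 (SN N) := by
  intro X Y Z X' Y' Z' x y δ x' y' δ' a c h h' hδ ha hc
  rw [bar_map_iff] at ha hc
  obtain ⟨b, hb, h1, h2⟩ := exists_mid_SN h h' hδ ha hc
  refine ⟨(idealProj (SN N)).map b, (bar_map_iff b).2 hb, ?_, ?_⟩
  · rw [← Functor.map_comp, ← Functor.map_comp, h1]
  · rw [← Functor.map_comp, ← Functor.map_comp, h2]

variable (N) in
lemma mr4 : MR4 (SN N) := by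
  constructor
  · refine ⟨?_⟩
    rintro ⟨X⟩ ⟨Y⟩ ⟨Z⟩ _ _ ⟨X₁, Y₁, x, u, v, hx, hu, hv, rfl⟩
      ⟨X₂, Y₂, x', u', v', hx', hu', hv', rfl⟩
    have huv := (bar (SN N)).comp_mem _ _ hv hu'
    obtain ⟨s, hs⟩ := (idealProj (SN N)).map_surjective (v ≫ u')
    rw [← hs, bar_map_iff] at huv
    obtain ⟨M, i, p, hi, hp, h⟩ := hN.out.inflation_comp hx huv hx'
    refine ⟨X₁, M, i, u, (idealProj (SN N)).map p ≫ v', hi, hu,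
      (bar (SN N)).comp_mem _ _ ((bar_map_iff p).2 (.of_def _ hp.1)) hv', ?_⟩
    have h' := congrArg (idealProj (SN N)).map h
    simp only [Functor.map_comp] at h'
    simp only [Category.assoc, reassoc_of% h', reassoc_of% hs]
  · refine ⟨?_⟩
    rintro ⟨X⟩ ⟨Y⟩ ⟨Z⟩ _ _ ⟨X₁, Y₁, x, u, v, hx, hu, hv, rfl⟩
      ⟨X₂, Y₂, x', u', v', hx', hu', hv', rfl⟩
    have huv := (bar (SN N)).comp_mem _ _ hv hu'
    obtain ⟨s, hs⟩ := (idealProj (SN N)).map_surjective (v ≫ u')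
    rw [← hs, bar_map_iff] at huv
    obtain ⟨M, i, p, hi, hp, h⟩ := hN.out.deflation_comp hx huv hx'
    refine ⟨M, Y₂, p, u ≫ (idealProj (SN N)).map i, v', hp,
      (bar (SN N)).comp_mem _ _ hu ((bar_map_iff i).2 (.of_inf _ hi.1)), hv', ?_⟩
    have h' := congrArg (idealProj (SN N)).map h
    simp only [Functor.map_comp] at h'
    simp only [Category.assoc, reassoc_of% h', reassoc_of% hs]

lemma idealRel_add ⦃X Y : A⦄ (f₁ f₂ g₁ g₂ : X ⟶ Y) (h : idealRel (nullObjects (SN N)) f₁ f₂)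
    (h' : idealRel (nullObjects (SN N)) g₁ g₂) :
    idealRel (nullObjects (SN N)) (f₁ + g₁) (f₂ + g₂) := by
  rw [hN.out.idealRel_iff] at h h' ⊢
  rw [add_sub_add_comm]
  exact h.add h'

noncomputable instance : Preadditive (IdealQuot (SN N)) :=
  Quotient.preadditive _ idealRel_add

instance : (idealProj (SN N)).Additive := Quotient.functor_additive _ idealRel_add

/-- Functors inverting `SN N` descend to the ideal quotient. -/
noncomputable abbrev idealLift {D : Type u₂} [Category.{v₂} D] (F : A ⥤ D)
    (hF : (SN N).IsInvertedBy F) : IdealQuot (SN N) ⥤ D :=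
  CategoryTheory.Quotient.lift _ F
    (fun _ _ _ _ h => map_eq_of_inverts hF ((hN.out.idealRel_iff _ _).1 h))

lemma idealLift_inverts {D : Type u₂} [Category.{v₂} D] (F : A ⥤ D)
    (hF : (SN N).IsInvertedBy F) : (bar (SN N)).IsInvertedBy (idealLift F hF) := by
  rintro ⟨X⟩ ⟨Y⟩ f hf
  obtain ⟨f, rfl⟩ := (idealProj (SN N)).map_surjective f
  exact hF f ((bar_map_iff (X := X) (Y := Y) f).1 hf)

end IdealQuotient

end ET

/-! ### Localizations with small morphism types and a strict universal property -/

namespace ET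

section SmallLocalization

lemma essentiallySmall_of_essSurj {C : Type u} [Category.{v} C] {D : Type u₂} [Category.{v₂} D]
    (F : C ⥤ D) [F.EssSurj] [EssentiallySmall.{w} C] [LocallySmall.{w} D] :
    EssentiallySmall.{w} D := by
  refine (essentiallySmall_iff D).2 ⟨?_, inferInstance⟩
  exact small_of_surjective F.mapSkeleton_surjective

variable {C : Type u} [Category.{v} C] (W : MorphismProperty C) [W.HasLeftCalculusOfFractions]
  [EssentiallySmall.{v} C]

instance locallySmall_localization : LocallySmall.{v} W.Localization where
  hom_small X Y := by
    obtain ⟨X, rfl⟩ := (Localization.Construction.objEquiv W).surjective X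
    obtain ⟨Y, rfl⟩ := (Localization.Construction.objEquiv W).surjective Y
    let e := equivSmallModel.{v} C
    -- The middle object of a fraction is replaced by an isomorphic one from a small model. The
    -- class `W` need not be stable under isomorphisms, so denominators are only required to be
    -- inverted by `W.Q`.
    let T := Σ Z : SmallModel.{v} C, (X ⟶ e.inverse.obj Z) ×
      { s : Y ⟶ e.inverse.obj Z // IsIso (W.Q.map s) }
    have : Function.Surjective (fun t : T =>
        have := t.2.2.2
        W.Q.map t.2.1 ≫ inv (W.Q.map t.2.2.1)) := by
      intro f
      obtain ⟨φ, rfl⟩ := Localization.exists_leftFraction W.Q W f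
      have := Localization.inverts W.Q W φ.s φ.hs
      let i := e.unitIso.hom.app φ.Y'
      refine ⟨⟨e.functor.obj φ.Y', φ.f ≫ i, φ.s ≫ i, ?_⟩, ?_⟩
      · rw [Functor.map_comp]
        infer_instance
      · dsimp only
        rw [IsIso.comp_inv_eq, Functor.map_comp, Functor.map_comp,
          MorphismProperty.LeftFraction.map_comp_map_s_assoc]
    exact small_of_surjective this

/-- A localized category with small morphism types and the objects of the original category. -/
abbrev SmallLoc := ShrinkHoms.{u} W.Localization

/-- The localization functor. -/
noncomputable def SmallLoc.functor : C ⥤ SmallLoc W := W.Q ⋙ ShrinkHoms.functor _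

namespace SmallLoc

instance : (SmallLoc.functor W).IsLocalization W := by
  unfold SmallLoc.functor
  exact Functor.IsLocalization.of_equivalence_target W.Q W _
    (ShrinkHoms.equivalence W.Localization) (Iso.refl _)

noncomputable instance [Preadditive C] : Preadditive (SmallLoc W) :=
  Localization.preadditive (SmallLoc.functor W) W

instance [Preadditive C] : (SmallLoc.functor W).Additive :=
  Localization.functor_additive (SmallLoc.functor W) W

variable {W} {D : Type u₂} [Category.{v₂} D]

/-- The strict universal property of the localization functor. -/
noncomputable def lift (F : C ⥤ D) (hF : W.IsInvertedBy F) : SmallLoc W ⥤ D :=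
  ShrinkHoms.inverse _ ⋙ Localization.Construction.lift F hF

lemma lift_map (F : C ⥤ D) (hF : W.IsInvertedBy F) {X Y : C} (f : X ⟶ Y) :
    (lift F hF).map ((SmallLoc.functor W).map f) = F.map f := by
  have h : (Localization.Construction.lift F hF).map (W.Q.map f) = F.map f :=
    (Functor.congr_hom (Localization.Construction.fac F hF) f).trans
      ((Category.id_comp _).trans (Category.comp_id _))
  exact (congrArg (Localization.Construction.lift F hF).map (Equiv.symm_apply_apply _ _)).trans h

/-- `ShrinkHoms` leaves objects unchanged, so uniqueness is an equality of functors; the uniqueness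
of induced exact functors needs this strictness. -/
lemma uniq (F G : SmallLoc W ⥤ D) (h : SmallLoc.functor W ⋙ F = SmallLoc.functor W ⋙ G) :
    F = G := by
  have h1 : ShrinkHoms.functor _ ⋙ F = ShrinkHoms.functor _ ⋙ G :=
    Localization.Construction.uniq _ _ h
  refine CategoryTheory.Functor.ext (fun X => Functor.congr_obj h1 X) fun X Y f => ?_
  obtain ⟨f, rfl⟩ := (ShrinkHoms.functor W.Localization).map_surjective
    (X := ShrinkHoms.fromShrinkHoms X) (Y := ShrinkHoms.fromShrinkHoms Y) f
  exact Functor.congr_hom h1 f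

lemma obj_surjective (X : SmallLoc W) : ∃ X₀ : C, (SmallLoc.functor W).obj X₀ = X :=
  (Localization.Construction.objEquiv W).surjective X

end SmallLoc

end SmallLocalization

end ET

/-! ### The trivial extension of `A` by its bifunctor, modulo the ideal of `N` -/

namespace ET

open Extriangulated

/-- The trivial extension of an extriangulated category `A` by its bifunctor: morphisms from `X` to
`Y` are pairs of a morphism and an extension. -/
structure TrivExt (A : Type u) where
  as : A

namespace TrivExt

section

variable {A : Type u} [Category.{v} A] [Preadditive A] [HasZeroObject A]
  [HasBinaryBiproducts A] [Extriangulated A]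

/-- A morphism together with an extension. -/
@[ext]
structure Hom (X Y : TrivExt A) where
  hom : X.as ⟶ Y.as
  extn : Ext (E (A := A)) X.as Y.as

instance : Category.{v} (TrivExt A) where
  Hom := Hom
  id X := ⟨𝟙 X.as, 0⟩
  comp f g := ⟨f.hom ≫ g.hom, push E g.hom f.extn + pull E f.hom g.extn⟩
  id_comp f := by
    apply Hom.ext <;> simp [pull_id]
  comp_id f := by
    apply Hom.ext <;> simp [push_id]
  assoc f g h := by
    apply Hom.ext
    · simp
    · simp [push_comp, pull_comp, push_pull, add_assoc]

@[simp]
lemma id_hom (X : TrivExt A) : (𝟙 X : X ⟶ X).hom = 𝟙 X.as := rfl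

@[simp]
lemma id_extn (X : TrivExt A) : (𝟙 X : X ⟶ X).extn = 0 := rfl

@[simp]
lemma comp_hom {X Y Z : TrivExt A} (f : X ⟶ Y) (g : Y ⟶ Z) : (f ≫ g).hom = f.hom ≫ g.hom := rfl

@[simp]
lemma comp_extn {X Y Z : TrivExt A} (f : X ⟶ Y) (g : Y ⟶ Z) :
    (f ≫ g).extn = push E g.hom f.extn + pull E f.hom g.extn := rfl

@[ext]
lemma hom_ext {X Y : TrivExt A} {f g : X ⟶ Y} (h : f.hom = g.hom) (h' : f.extn = g.extn) :
    f = g := Hom.ext h h'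

/-- Morphisms of the trivial extension as a product. -/
def homEquiv (X Y : TrivExt A) : (X ⟶ Y) ≃ (X.as ⟶ Y.as) × Ext (E (A := A)) X.as Y.as where
  toFun f := (f.hom, f.extn)
  invFun p := ⟨p.1, p.2⟩

instance (X Y : TrivExt A) : AddCommGroup (X ⟶ Y) := (homEquiv X Y).addCommGroup

@[simp]
lemma add_hom {X Y : TrivExt A} (f g : X ⟶ Y) : (f + g).hom = f.hom + g.hom := rfl

@[simp]
lemma add_extn {X Y : TrivExt A} (f g : X ⟶ Y) : (f + g).extn = f.extn + g.extn := rfl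

instance : Preadditive (TrivExt A) where
  add_comp X Y Z f g h := by
    ext
    · simp
    · simp [pull_add_hom]
      abel
  comp_add X Y Z f g h := by
    ext
    · simp
    · simp [push_add_hom]
      abel

variable (A) in
/-- The inclusion of a category in its trivial extension. -/
def zeroExt : A ⥤ TrivExt A where
  obj X := ⟨X⟩
  map f := ⟨f, 0⟩
  map_id _ := rfl
  map_comp f g := by ext <;> simp

instance : (zeroExt A).Additive where
  map_add := hom_ext rfl (add_zero 0).symm

variable (A) in
/-- The projection from the trivial extension. -/
def fst : TrivExt A ⥤ A where
  obj X := X.as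
  map f := f.hom

instance : (fst A).Additive where

variable {B : Type u₂} [Category.{v₂} B] [Preadditive B] [HasZeroObject B]
  [HasBinaryBiproducts B] [Extriangulated B]

/-- The functor on trivial extensions induced by an exact functor. -/
def map (F : ExtriFunctor A B) : TrivExt A ⥤ TrivExt B where
  obj X := ⟨F.functor.obj X.as⟩
  map f := ⟨F.functor.map f.hom, F.φ _ _ f.extn⟩
  map_id X := by ext <;> simp
  map_comp f g := by ext <;> simp [F.φ_push, F.φ_pull]

instance (F : ExtriFunctor A B) : (map F).Additive where
  map_add {X Y f g} := by
    have := F.additive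
    exact hom_ext F.functor.map_add ((F.φ X.as Y.as).map_add f.extn g.extn)

end

end TrivExt

section

variable {A : Type u} [Category.{v} A] [Preadditive A] [HasZeroObject A]
  [HasBinaryBiproducts A] [Extriangulated A] (N : ObjectProperty A) [IsExtensionClosed N]

/-- The ideal relation on the trivial extension. -/
def extRel : HomRel (TrivExt A) := fun X Y f g =>
  FactorsThru N (f.hom - g.hom) ∧ f.extn - g.extn ∈ nullExt N X.as Y.as

/-- The trivial extension modulo the ideal of `N`. -/
abbrev TrivQuot := Quotient (extRel N)

/-- The projection of the trivial extension modulo the ideal of `N`. -/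
abbrev trivProj : TrivExt A ⥤ TrivQuot N := Quotient.functor (extRel N)

/-- The morphism of `TrivQuot N` given by a morphism and an extension. -/
def trivMk {X Y : A} (f : X ⟶ Y) (δ : Ext (E (A := A)) X Y) :
    (trivProj N).obj ⟨X⟩ ⟶ (trivProj N).obj ⟨Y⟩ :=
  (trivProj N).map (⟨f, δ⟩ : TrivExt.Hom ⟨X⟩ ⟨Y⟩)

lemma trivMk_comp {X Y Z : A} (f : X ⟶ Y) (δ : Ext (E (A := A)) X Y) (g : Y ⟶ Z)
    (ε : Ext (E (A := A)) Y Z) :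
    trivMk N f δ ≫ trivMk N g ε = trivMk N (f ≫ g) (push E g δ + pull E f ε) :=
  ((trivProj N).map_comp _ _).symm

lemma trivMk_comp_zero {X Y Z : A} (f : X ⟶ Y) (δ : Ext (E (A := A)) X Y) (g : Y ⟶ Z) :
    trivMk N f δ ≫ trivMk N g 0 = trivMk N (f ≫ g) (push E g δ) := by
  rw [trivMk_comp, map_zero, add_zero]

lemma trivMk_zero_comp {X Y Z : A} (f : X ⟶ Y) (g : Y ⟶ Z) (ε : Ext (E (A := A)) Y Z) :
    trivMk N f 0 ≫ trivMk N g ε = trivMk N (f ≫ g) (pull E f ε) := by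
  rw [trivMk_comp, map_zero, zero_add]

lemma trivMk_id (X : A) : trivMk N (𝟙 X) 0 = 𝟙 _ := (trivProj N).map_id _

lemma trivMk_surjective {X Y : A} (f : (trivProj N).obj ⟨X⟩ ⟶ (trivProj N).obj ⟨Y⟩) :
    ∃ g δ, trivMk N g δ = f := by
  obtain ⟨⟨g, δ⟩, rfl⟩ := (trivProj N).map_surjective f
  exact ⟨g, δ, rfl⟩

/-- The class of morphisms of `SN N` in the trivial extension. -/
def trivSN : MorphismProperty (TrivQuot N) := fun X Y f =>
  ∃ s : X.as.as ⟶ Y.as.as, SN N s ∧ trivMk N s 0 = f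

variable {N}

lemma extRel_add ⦃X Y : TrivExt A⦄ (f₁ f₂ g₁ g₂ : X ⟶ Y) (h : extRel N f₁ f₂)
    (h' : extRel N g₁ g₂) : extRel N (f₁ + g₁) (f₂ + g₂) := by
  refine ⟨?_, ?_⟩
  · rw [TrivExt.add_hom, TrivExt.add_hom, add_sub_add_comm]
    exact h.1.add h'.1
  · rw [TrivExt.add_extn, TrivExt.add_extn, add_sub_add_comm]
    exact add_mem h.2 h'.2

variable [hN : Fact (IsAbsorbing N)]

/-- A morphism through `N` must turn every extension into a null one. For pushing out this is
immediate from the definition of `nullExt`; for pulling back it is its self-duality. -/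
instance : Congruence (extRel N) where
  comp_left := by
    rintro X Y Z f g g' ⟨h, h'⟩
    refine ⟨by simpa using h.comp_left f.hom, ?_⟩
    have := add_mem (push_mem_nullExt_of_factorsThru h f.extn) (pull_mem_nullExt f.hom h')
    rw [sub_eq_add_neg, push_add_hom, push_neg_hom, map_sub] at this
    convert this using 1
    simp only [TrivExt.comp_extn]
    abel
  comp_right := by
    rintro X Y Z f f' g ⟨h, h'⟩
    refine ⟨by simpa using h.comp_right g.hom, ?_⟩
    have := add_mem (hN.out.pull_mem_nullExt_of_factorsThru h g.extn) (push_mem_nullExt g.hom h')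
    rw [sub_eq_add_neg, pull_add_hom, pull_neg_hom, map_sub] at this
    convert this using 1
    simp only [TrivExt.comp_extn]
    abel
  equivalence :=
    { refl f := by
        refine ⟨?_, ?_⟩
        · rw [sub_self]
          exact .zero _ _
        · rw [sub_self]
          exact zero_mem _
      symm := by
        rintro f g ⟨h, h'⟩
        exact ⟨by simpa using h.neg, by simpa using neg_mem h'⟩
      trans := by
        rintro f g k ⟨h, h'⟩ ⟨h₂, h₂'⟩
        exact ⟨by simpa using h.add h₂, by simpa using add_mem h' h₂'⟩ }

lemma trivMk_eq_iff {X Y : A} (f g : X ⟶ Y) (δ ε : Ext (E (A := A)) X Y) :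
    trivMk N f δ = trivMk N g ε ↔ FactorsThru N (f - g) ∧ δ - ε ∈ nullExt N X Y :=
  Quotient.functor_map_eq_iff (extRel N) (X := ⟨X⟩) (Y := ⟨Y⟩) ⟨f, δ⟩ ⟨g, ε⟩

noncomputable instance : Preadditive (TrivQuot N) := Quotient.preadditive _ extRel_add

instance : (trivProj N).Additive := Quotient.functor_additive _ extRel_add

lemma trivMk_add {X Y : A} (f g : X ⟶ Y) (δ ε : Ext (E (A := A)) X Y) :
    trivMk N (f + g) (δ + ε) = trivMk N f δ + trivMk N g ε :=
  (trivProj N).map_add (X := ⟨X⟩) (Y := ⟨Y⟩) (f := ⟨f, δ⟩) (g := ⟨g, ε⟩)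

instance : (trivSN N).IsMultiplicative where
  id_mem X := ⟨𝟙 _, .id _, trivMk_id _ _⟩
  comp_mem := by
    rintro X Y Z _ _ ⟨s, hs, rfl⟩ ⟨t, ht, rfl⟩
    exact ⟨s ≫ t, .comp _ _ hs ht, by rw [trivMk_comp_zero, map_zero]⟩

instance : (trivSN N).HasLeftCalculusOfFractions where
  exists_leftFraction := by
    rintro ⟨⟨X⟩⟩ ⟨⟨Y⟩⟩ @⟨⟨⟨X'⟩⟩, _, ⟨s, hs, rfl⟩, f⟩
    obtain ⟨f, δ, rfl⟩ := trivMk_surjective N f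
    -- One denominator is found for the morphism and a further one for the extension; the relation
    -- already obtained for the morphism survives composition with `t₂`.
    obtain ⟨Y₁, t₁, f₁, ht₁, h₁⟩ := hN.out.exists_ore hs f
    obtain ⟨Y₂, t₂, δ', ht₂, h₂⟩ := hN.out.exists_push_eq_pull hs (push E t₁ δ)
    refine ⟨⟨trivMk N (f₁ ≫ t₂) δ', trivMk N (t₁ ≫ t₂) 0, _, .comp _ _ ht₁ ht₂, rfl⟩, ?_⟩
    refine (trivMk_comp_zero N _ _ _).trans (Eq.trans ?_ (trivMk_zero_comp N _ _ _).symm)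
    rw [trivMk_eq_iff, push_comp, h₂, sub_self]
    exact ⟨by simpa using h₁.comp_right t₂, zero_mem _⟩
  ext := by
    rintro ⟨⟨X'⟩⟩ ⟨⟨X⟩⟩ ⟨⟨Y⟩⟩ f₁ f₂ _ ⟨s, hs, rfl⟩ h
    obtain ⟨f₁, δ₁, rfl⟩ := trivMk_surjective N f₁
    obtain ⟨f₂, δ₂, rfl⟩ := trivMk_surjective N f₂
    refine ⟨_, 𝟙 _, (trivSN N).id_mem _, ?_⟩
    congr 1
    replace h := (trivMk_zero_comp N _ _ _).symm.trans (h.trans (trivMk_zero_comp N _ _ _))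
    rw [trivMk_eq_iff, ← Preadditive.comp_sub, ← map_sub] at h
    rw [trivMk_eq_iff]
    exact ⟨hN.out.factorsThru_of_comp_left hs h.1, hN.out.mem_nullExt_of_pull hs h.2⟩

instance : (trivSN N).HasRightCalculusOfFractions where
  exists_rightFraction := by
    rintro ⟨⟨X⟩⟩ ⟨⟨Y⟩⟩ @⟨⟨⟨Y'⟩⟩, f, _, ⟨s, hs, rfl⟩⟩
    obtain ⟨f, δ, rfl⟩ := trivMk_surjective N f
    obtain ⟨X₁, t₁, f₁, ht₁, h₁⟩ := hN.out.exists_ore' hs f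
    obtain ⟨X₂, t₂, δ', ht₂, h₂⟩ := hN.out.exists_pull_eq_push hs (pull E t₁ δ)
    refine ⟨⟨trivMk N (t₂ ≫ t₁) 0, ⟨_, .comp _ _ ht₂ ht₁, rfl⟩, trivMk N (t₂ ≫ f₁) δ'⟩, ?_⟩
    refine (trivMk_zero_comp N _ _ _).trans (Eq.trans ?_ (trivMk_comp_zero N _ _ _).symm)
    rw [trivMk_eq_iff, pull_comp, h₂, sub_self]
    exact ⟨by simpa using h₁.comp_left t₂, zero_mem _⟩
  ext := by
    rintro ⟨⟨X⟩⟩ ⟨⟨Y⟩⟩ ⟨⟨Y'⟩⟩ f₁ f₂ _ ⟨s, hs, rfl⟩ h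
    obtain ⟨f₁, δ₁, rfl⟩ := trivMk_surjective N f₁
    obtain ⟨f₂, δ₂, rfl⟩ := trivMk_surjective N f₂
    refine ⟨_, 𝟙 _, (trivSN N).id_mem _, ?_⟩
    congr 1
    replace h := (trivMk_comp_zero N _ _ _).symm.trans (h.trans (trivMk_comp_zero N _ _ _))
    rw [trivMk_eq_iff, ← Preadditive.sub_comp, ← map_sub] at h
    rw [trivMk_eq_iff]
    exact ⟨hN.out.factorsThru_of_comp_right hs h.1, hN.out.mem_nullExt_of_push hs h.2⟩

end

end ET

/-! ### Realizations in a localization: weak cokernels, lifting and (ET3) -/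

namespace ET

open Extriangulated

variable {A : Type u} [Category.{v} A] [Preadditive A] [HasZeroObject A]
  [HasBinaryBiproducts A] [Extriangulated A]

/-- A localization of an extriangulated category at `SN N`, together with a localization of its
bifunctor. -/
structure ExtLocalization (N : ObjectProperty A) [IsExtensionClosed N] (B : Type u₂)
    [Category.{v} B] [Preadditive B] where
  absorbing : IsAbsorbing N
  Q : A ⥤ B
  additive : Q.Additive
  bifun : Bᵒᵖ ⥤ B ⥤ AddCommGrpCat.{v}
  additive_right : ∀ C : Bᵒᵖ, (bifun.obj C).Additive
  additive_left : ∀ X : B, (bifun.flip.obj X).Additive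
  μ : ∀ {C X : A}, Ext (E (A := A)) C X →+ Ext bifun (Q.obj C) (Q.obj X)
  μ_push : ∀ {C X X' : A} (a : X ⟶ X') (δ : Ext (E (A := A)) C X),
    μ (push E a δ) = push bifun (Q.map a) (μ δ)
  μ_pull : ∀ {C C' X : A} (c : C' ⟶ C) (δ : Ext (E (A := A)) C X),
    μ (pull E c δ) = pull bifun (Q.map c) (μ δ)
  essSurj : ∀ X : B, ∃ X₀ : A, Nonempty (X ≅ Q.obj X₀)
  map_eq_zero_iff : ∀ {X Y : A} (f : X ⟶ Y), Q.map f = 0 ↔ FactorsThru N f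
  inverts : ∀ {X Y : A} {s : X ⟶ Y}, SN N s → IsIso (Q.map s)
  left_fraction : ∀ {X Y : A} (f : Q.obj X ⟶ Q.obj Y), ∃ (Y' : A) (g : X ⟶ Y') (t : Y ⟶ Y'),
    SN N t ∧ f ≫ Q.map t = Q.map g
  right_fraction : ∀ {X Y : A} (f : Q.obj X ⟶ Q.obj Y), ∃ (X' : A) (s : X' ⟶ X) (g : X' ⟶ Y),
    SN N s ∧ Q.map s ≫ f = Q.map g
  μ_eq_zero_iff : ∀ {C X : A} (δ : Ext (E (A := A)) C X), μ δ = 0 ↔ δ ∈ nullExt N C X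
  exists_push : ∀ {C X : A} (ε : Ext bifun (Q.obj C) (Q.obj X)),
    ∃ (X' : A) (t : X ⟶ X') (δ : Ext (E (A := A)) C X'), SN N t ∧ push bifun (Q.map t) ε = μ δ
  exists_pull : ∀ {C X : A} (ε : Ext bifun (Q.obj C) (Q.obj X)),
    ∃ (C' : A) (s : C' ⟶ C) (δ : Ext (E (A := A)) C' X), SN N s ∧ pull bifun (Q.map s) ε = μ δ

lemma mem_nullExt_op_iff {N : ObjectProperty A} [IsExtensionClosed N] (hN : IsAbsorbing N)
    {C X : A} (δ : Ext (E (A := A)) C X) :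
    (show Ext (E (A := Aᵒᵖ)) (op X) (op C) from δ) ∈ nullExt N.op (op X) (op C) ↔
      δ ∈ nullExt N C X := by
  refine ⟨hN.mem_nullExt_of_op, fun h => ?_⟩
  obtain ⟨C', s, hs, h0⟩ := exists_pull_eq_zero_of_mem h
  exact hN.op.mem_nullExt_of_push_eq_zero hs.op h0

namespace ExtLocalization

variable {N : ObjectProperty A} [IsExtensionClosed N] {B : Type u₂} [Category.{v} B]
  [Preadditive B]

/-- The opposite localization. -/
def op (L : ExtLocalization N B) : ExtLocalization N.op Bᵒᵖ where
  absorbing := L.absorbing.op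
  Q := L.Q.op
  additive := by
    have := L.additive
    infer_instance
  bifun := unopUnop B ⋙ L.bifun.flip
  additive_right C := L.additive_left C.unop.unop
  additive_left X := by
    have := L.additive_right X
    exact ⟨fun {C D f g} => (L.bifun.obj X).map_add (f := f.unop.unop) (g := g.unop.unop)⟩
  μ {C X} := L.μ (C := X.unop) (X := C.unop)
  μ_push a δ := L.μ_pull a.unop δ
  μ_pull a δ := L.μ_push a.unop δ
  essSurj X := by
    obtain ⟨X₀, ⟨e⟩⟩ := L.essSurj X.unop
    exact ⟨.op X₀, ⟨e.symm.op⟩⟩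
  map_eq_zero_iff f := by
    constructor
    · intro h
      exact ((L.map_eq_zero_iff f.unop).1 (Quiver.Hom.op_inj h)).op
    · intro h
      exact Quiver.Hom.unop_inj ((L.map_eq_zero_iff f.unop).2 h.of_op)
  inverts {X Y s} hs := by
    have := L.inverts hs.unop
    change IsIso (L.Q.map s.unop).op
    infer_instance
  left_fraction f := by
    obtain ⟨X', s, g, hs, h⟩ := L.right_fraction f.unop
    exact ⟨.op X', g.op, s.op, hs.op, Quiver.Hom.unop_inj h⟩
  right_fraction f := by
    obtain ⟨X', s, g, hs, h⟩ := L.left_fraction f.unop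
    exact ⟨.op X', g.op, s.op, hs.op, Quiver.Hom.unop_inj h⟩
  μ_eq_zero_iff {C X} δ := (L.μ_eq_zero_iff (C := X.unop) (X := C.unop) δ).trans
    (mem_nullExt_op_iff L.absorbing (C := X.unop) (X := C.unop) δ).symm
  exists_push ε := by
    obtain ⟨C', s, δ, hs, h⟩ := L.exists_pull ε
    exact ⟨.op C', s.op, δ, hs.op, h⟩
  exists_pull ε := by
    obtain ⟨C', s, δ, hs, h⟩ := L.exists_push ε
    exact ⟨.op C', s.op, δ, hs.op, h⟩

variable (L : ExtLocalization N B)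

/-- The realization of the localized bifunctor: a sequence realizes an extension if the pair is
isomorphic to the image of a realization. -/
def Realizes {X Y Z : B} (x : X ⟶ Y) (y : Y ⟶ Z) (ε : Ext L.bifun Z X) : Prop :=
  ∃ (X₀ Y₀ Z₀ : A) (x₀ : X₀ ⟶ Y₀) (y₀ : Y₀ ⟶ Z₀) (δ₀ : Ext (E (A := A)) Z₀ X₀)
    (α : X ≅ L.Q.obj X₀) (β : Y ≅ L.Q.obj Y₀) (γ : Z ≅ L.Q.obj Z₀),
    Extriangulated.Realizes x₀ y₀ δ₀ ∧ x ≫ β.hom = α.hom ≫ L.Q.map x₀ ∧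
      y ≫ γ.hom = β.hom ≫ L.Q.map y₀ ∧ push L.bifun α.hom ε = pull L.bifun γ.hom (L.μ δ₀)

lemma push_add {C X X' : B} (a b : X ⟶ X') (ε : Ext L.bifun C X) :
    push L.bifun (a + b) ε = push L.bifun a ε + push L.bifun b ε := by
  have := L.additive_right (.op C)
  simp [push, Functor.map_add]

lemma pull_add {C C' X : B} (a b : C' ⟶ C) (ε : Ext L.bifun C X) :
    pull L.bifun (a + b) ε = pull L.bifun a ε + pull L.bifun b ε :=
  L.op.push_add (C := .op X) (X := .op C) (X' := .op C') a.op b.op ε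

lemma push_injective {C X X' : B} (a : X ⟶ X') [IsIso a] {ε ε' : Ext L.bifun C X}
    (h : push L.bifun a ε = push L.bifun a ε') : ε = ε' := by
  rw [← push_id L.bifun ε, ← push_id L.bifun ε', ← IsIso.hom_inv_id a, push_comp, push_comp, h]

lemma pull_injective {C C' X : B} (a : C' ⟶ C) [IsIso a] {ε ε' : Ext L.bifun C X}
    (h : pull L.bifun a ε = pull L.bifun a ε') : ε = ε' := by
  rw [← pull_id L.bifun ε, ← pull_id L.bifun ε', ← IsIso.inv_hom_id a, pull_comp, pull_comp, h]

variable {L}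

lemma Realizes.of_iso_inv {X Y Z : B} {x : X ⟶ Y} {y : Y ⟶ Z} {ε : Ext L.bifun Z X}
    {X₀ Y₀ Z₀ : A} {x₀ : X₀ ⟶ Y₀} {y₀ : Y₀ ⟶ Z₀} {δ₀ : Ext (E (A := A)) Z₀ X₀}
    (h : Extriangulated.Realizes x₀ y₀ δ₀) (α : L.Q.obj X₀ ≅ X) (β : L.Q.obj Y₀ ≅ Y)
    (γ : L.Q.obj Z₀ ≅ Z) (h1 : L.Q.map x₀ ≫ β.hom = α.hom ≫ x)
    (h2 : L.Q.map y₀ ≫ γ.hom = β.hom ≫ y) (h3 : push L.bifun α.hom (L.μ δ₀) =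
      pull L.bifun γ.hom ε) : L.Realizes x y ε := by
  refine ⟨X₀, Y₀, Z₀, x₀, y₀, δ₀, α.symm, β.symm, γ.symm, h, ?_, ?_, ?_⟩
  · rw [Iso.symm_hom, Iso.symm_hom, Iso.comp_inv_eq, Category.assoc, h1, Iso.inv_hom_id_assoc]
  · rw [Iso.symm_hom, Iso.symm_hom, Iso.comp_inv_eq, Category.assoc, h2, Iso.inv_hom_id_assoc]
  · apply L.push_injective α.hom
    apply L.pull_injective γ.hom
    rw [← push_comp, Iso.symm_hom, Iso.inv_hom_id, push_id, push_pull, ← pull_comp,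
      Iso.symm_hom, Iso.hom_inv_id, pull_id, h3]

lemma op_realizes {X Y Z : B} {x : X ⟶ Y} {y : Y ⟶ Z} {ε : Ext L.bifun Z X}
    (h : L.Realizes x y ε) :
    L.op.Realizes (X := .op Z) (Y := .op Y) (Z := .op X) y.op x.op ε := by
  obtain ⟨X₀, Y₀, Z₀, x₀, y₀, δ₀, α, β, γ, h0, h1, h2, h3⟩ := h
  refine ⟨.op Z₀, .op Y₀, .op X₀, y₀.op, x₀.op, δ₀, γ.symm.op, β.symm.op, α.symm.op, h0, ?_, ?_, ?_⟩
  · apply Quiver.Hom.unop_inj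
    change β.inv ≫ y = L.Q.map y₀ ≫ γ.inv
    rw [Iso.inv_comp_eq, ← reassoc_of% h2, Iso.hom_inv_id, Category.comp_id]
  · apply Quiver.Hom.unop_inj
    change α.inv ≫ x = L.Q.map x₀ ≫ β.inv
    rw [Iso.inv_comp_eq, ← reassoc_of% h1, Iso.hom_inv_id, Category.comp_id]
  · change pull L.bifun γ.inv ε = push L.bifun α.inv (L.μ δ₀)
    apply L.push_injective α.hom
    apply L.pull_injective γ.hom
    rw [← push_comp, Iso.inv_hom_id, push_id, push_pull, ← pull_comp, Iso.hom_inv_id, pull_id, h3]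

lemma unop_realizes {X Y Z : Bᵒᵖ} {x : X ⟶ Y} {y : Y ⟶ Z} {ε : Ext L.op.bifun Z X}
    (h : L.op.Realizes x y ε) :
    L.Realizes (X := Z.unop) (Y := Y.unop) (Z := X.unop) y.unop x.unop ε := by
  obtain ⟨X₀, Y₀, Z₀, x₀, y₀, δ₀, α, β, γ, h0, h1, h2, h3⟩ := h
  replace h1 : β.hom.unop ≫ x.unop = L.Q.map x₀.unop ≫ α.hom.unop := congrArg (·.unop) h1
  replace h2 : γ.hom.unop ≫ y.unop = L.Q.map y₀.unop ≫ β.hom.unop := congrArg (·.unop) h2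
  replace h3 : pull L.bifun α.unop.hom ε = push L.bifun γ.unop.hom (L.μ δ₀) := h3
  exact .of_iso_inv h0 γ.unop β.unop α.unop h2.symm h1.symm h3.symm

lemma Realizes.map {X Y Z : A} {x : X ⟶ Y} {y : Y ⟶ Z} {δ : Ext (E (A := A)) Z X}
    (h : Extriangulated.Realizes x y δ) : L.Realizes (L.Q.map x) (L.Q.map y) (L.μ δ) :=
  ⟨X, Y, Z, x, y, δ, Iso.refl _, Iso.refl _, Iso.refl _, h, by simp, by simp, by
    simp [push_id, pull_id]⟩

lemma Realizes.of_iso {X Y Z X' Y' Z' : B} {x : X ⟶ Y} {y : Y ⟶ Z} {ε : Ext L.bifun Z X}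
    {x' : X' ⟶ Y'} {y' : Y' ⟶ Z'} {ε' : Ext L.bifun Z' X'} (h : L.Realizes x' y' ε')
    (α : X ≅ X') (β : Y ≅ Y') (γ : Z ≅ Z') (h1 : x ≫ β.hom = α.hom ≫ x')
    (h2 : y ≫ γ.hom = β.hom ≫ y') (h3 : push L.bifun α.hom ε = pull L.bifun γ.hom ε') :
    L.Realizes x y ε := by
  obtain ⟨X₀, Y₀, Z₀, x₀, y₀, δ₀, α', β', γ', h0, h1', h2', h3'⟩ := h
  refine ⟨X₀, Y₀, Z₀, x₀, y₀, δ₀, α ≪≫ α', β ≪≫ β', γ ≪≫ γ', h0, ?_, ?_, ?_⟩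
  · simp [reassoc_of% h1, h1']
  · simp [reassoc_of% h2, h2']
  · rw [Iso.trans_hom, Iso.trans_hom, push_comp, h3, push_pull, h3', pull_comp]

section

variable {X Y Z : B} {x : X ⟶ Y} {y : Y ⟶ Z} {ε : Ext L.bifun Z X}

lemma Realizes.push_eq_zero (h : L.Realizes x y ε) : push L.bifun x ε = 0 := by
  obtain ⟨X₀, Y₀, Z₀, x₀, y₀, δ₀, α, β, γ, h0, h1, h2, h3⟩ := h
  apply L.push_injective β.hom
  rw [← push_comp, h1, push_comp, h3, push_pull, ← L.μ_push, push_inflation_eq_zero h0, map_zero,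
    map_zero, map_zero]

lemma Realizes.pull_eq_zero (h : L.Realizes x y ε) : pull L.bifun y ε = 0 :=
  (op_realizes h).push_eq_zero

/-- The second morphism of a realized sequence is a weak cokernel of the first one. -/
lemma Realizes.exists_desc (h : L.Realizes x y ε) {W : B} (g : Y ⟶ W) (hg : x ≫ g = 0) :
    ∃ k : Z ⟶ W, y ≫ k = g := by
  obtain ⟨X₀, Y₀, Z₀, x₀, y₀, δ₀, α, β, γ, h0, h1, h2, h3⟩ := h
  obtain ⟨W₀, ⟨ω⟩⟩ := L.essSurj W
  have := L.additive
  obtain ⟨W', g', t, ht, h4⟩ := L.left_fraction (β.inv ≫ g ≫ ω.hom)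
  obtain ⟨K, i, j, hK, hij⟩ := (L.map_eq_zero_iff (x₀ ≫ g')).1 (by
    rw [L.Q.map_comp, ← h4, ← cancel_epi α.hom, ← reassoc_of% h1]
    simp [reassoc_of% hg])
  -- The numerator `g'` kills `x₀` only modulo a map `i ≫ j` through `N`. Replacing `x₀` by `(x₀,
  -- i)` makes the vanishing exact, and the new cone `M` maps to `Z₀` by a deflation with cocone in
  -- `N`, which is inverted.
  obtain ⟨M, p, e, δ', η, hM, he, hpe⟩ := exists_realizes_lift h0 i
  obtain ⟨k, hk⟩ := ET.exists_desc hM (biprod.fst ≫ g' - biprod.snd ≫ j) (by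
    simp [Preadditive.comp_sub, hij])
  have : IsIso (L.Q.map e) := L.inverts (.of_def _ ⟨K, _, ⟨_, he⟩, hK⟩)
  have : IsIso (L.Q.map t) := L.inverts ht
  refine ⟨γ.hom ≫ inv (L.Q.map e) ≫ L.Q.map k ≫ inv (L.Q.map t) ≫ ω.inv, ?_⟩
  have e1 : y₀ = biprod.inl ≫ p ≫ e := by simp [hpe]
  have e2 : g' = biprod.inl ≫ p ≫ k := by simp [hk]
  rw [reassoc_of% h2, e1]
  simp only [L.Q.map_comp, Category.assoc, IsIso.hom_inv_id_assoc]
  rw [← L.Q.map_comp_assoc, ← L.Q.map_comp_assoc, Category.assoc, ← e2, ← h4]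
  simp

lemma Realizes.exists_pull_eq (h : L.Realizes x y ε) {W : B} (ε' : Ext L.bifun W X)
    (hε : push L.bifun x ε' = 0) : ∃ c : W ⟶ Z, ε' = pull L.bifun c ε := by
  obtain ⟨X₀, Y₀, Z₀, x₀, y₀, δ₀, α, β, γ, h0, h1, h2, h3⟩ := h
  obtain ⟨W₀, ⟨ω⟩⟩ := L.essSurj W
  -- After pulling back along `s` the class comes from `A`, and after `s'` its pushforward vanishes
  -- there, so exactness in `A` applies.
  obtain ⟨W', s, δ, hs, h4⟩ := L.exists_pull (push L.bifun α.hom (pull L.bifun ω.inv ε'))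
  obtain ⟨W'', s', hs', h5⟩ := exists_pull_eq_zero_of_mem ((L.μ_eq_zero_iff (push E x₀ δ)).1 (by
    rw [L.μ_push, ← h4, push_pull, ← push_comp, ← h1, push_comp, push_pull, hε]
    simp))
  rw [← push_pull] at h5
  obtain ⟨c, hc⟩ := ET.exists_pull_eq h0 _ h5
  have : IsIso (L.Q.map s) := L.inverts hs
  have : IsIso (L.Q.map s') := L.inverts hs'
  refine ⟨ω.hom ≫ inv (L.Q.map s) ≫ inv (L.Q.map s') ≫ L.Q.map c ≫ γ.inv, ?_⟩
  apply L.push_injective α.hom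
  apply L.pull_injective ω.inv
  apply L.pull_injective (L.Q.map s)
  apply L.pull_injective (L.Q.map s')
  rw [← push_pull, h4, ← L.μ_pull, hc, push_pull, h3, L.μ_pull]
  simp only [← pull_comp]
  simp

end

section

variable {X Y Z X' Y' Z' : A} {x : X ⟶ Y} {y : Y ⟶ Z} {δ : Ext (E (A := A)) Z X}
  {x' : X' ⟶ Y'} {y' : Y' ⟶ Z'} {δ' : Ext (E (A := A)) Z' X'}

-- With `a` a left fraction and `c` a right fraction, the denominators act on opposite ends.
-- Enlarging the one for `a` makes the equality of classes hold already in `A`. The denominators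
-- lift to maps of middle terms in `SN N`, which are then inverted.
variable (L) in
lemma exists_mid_map (a : L.Q.obj X ⟶ L.Q.obj X')
    (c : L.Q.obj Z ⟶ L.Q.obj Z') (h : Extriangulated.Realizes x y δ)
    (h' : Extriangulated.Realizes x' y' δ')
    (w : push L.bifun a (L.μ δ) = pull L.bifun c (L.μ δ')) :
    ∃ b : L.Q.obj Y ⟶ L.Q.obj Y', L.Q.map x ≫ b = a ≫ L.Q.map x' ∧
      L.Q.map y ≫ c = b ≫ L.Q.map y' := by
  obtain ⟨X₁, a', t, ht, ha⟩ := L.left_fraction a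
  obtain ⟨Z₁, s, c', hs, hc⟩ := L.right_fraction c
  obtain ⟨X₂, t', ht', h0⟩ := L.absorbing.exists_push_eq_zero_of_mem
    ((L.μ_eq_zero_iff (push E a' (pull E s δ) - push E t (pull E c' δ'))).1 (by
      rw [map_sub, L.μ_push, L.μ_pull, L.μ_push, L.μ_pull, ← ha, ← hc, push_comp, pull_comp,
        push_pull L.bifun a, w, sub_self]))
  rw [map_sub, ← push_comp, ← push_comp, sub_eq_zero, push_pull E _ c'] at h0
  obtain ⟨Y₁, x₁, y₁, h₁⟩ := exists_realizes (pull E s δ)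
  obtain ⟨Y₂, x₂, y₂, h₂⟩ := exists_realizes (push E (t ≫ t') δ')
  obtain ⟨b₁, hb₁, e₁, e₁'⟩ := hs.exists_pull h h₁
  obtain ⟨b₂, hb₂, e₂, e₂'⟩ := (SN.comp _ _ ht ht').exists_push h' h₂
  obtain ⟨b, e₃, e₃'⟩ := exists_mid (a' ≫ t') c' h₁ h₂ h0
  have i₁ : IsIso (L.Q.map b₁) := L.inverts hb₁
  have i₂ : IsIso (L.Q.map b₂) := L.inverts hb₂
  have i₃ : IsIso (L.Q.map s) := L.inverts hs
  refine ⟨inv (L.Q.map b₁) ≫ L.Q.map b ≫ inv (L.Q.map b₂), ?_, ?_⟩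
  · rw [← cancel_mono (L.Q.map b₂)]
    simp only [Category.assoc, IsIso.inv_hom_id, Category.comp_id]
    rw [← e₁, ← L.Q.map_comp, e₂]
    simp only [L.Q.map_comp, Category.assoc, IsIso.hom_inv_id_assoc]
    rw [← L.Q.map_comp, e₃, reassoc_of% ha]
    simp
  · rw [← cancel_epi (L.Q.map b₁)]
    simp only [Category.assoc, IsIso.hom_inv_id_assoc]
    rw [← e₂', ← L.Q.map_comp_assoc, e₁']
    simp only [L.Q.map_comp, Category.assoc, IsIso.inv_hom_id_assoc]
    rw [hc, ← L.Q.map_comp, e₃', L.Q.map_comp]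

end

section

variable {X Y Z X' Y' Z' : B} {x : X ⟶ Y} {y : Y ⟶ Z} {ε : Ext L.bifun Z X}
  {x' : X' ⟶ Y'} {y' : Y' ⟶ Z'} {ε' : Ext L.bifun Z' X'}

lemma Realizes.exists_mid (a : X ⟶ X') (c : Z ⟶ Z') (h : L.Realizes x y ε)
    (h' : L.Realizes x' y' ε') (w : push L.bifun a ε = pull L.bifun c ε') :
    ∃ b : Y ⟶ Y', x ≫ b = a ≫ x' ∧ y ≫ c = b ≫ y' := by
  obtain ⟨X₀, Y₀, Z₀, x₀, y₀, δ₀, α, β, γ, h0, h1, h2, h3⟩ := h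
  obtain ⟨X₀', Y₀', Z₀', x₀', y₀', δ₀', α', β', γ', h0', h1', h2', h3'⟩ := h'
  obtain ⟨b, hb, hb'⟩ := L.exists_mid_map (α.inv ≫ a ≫ α'.hom) (γ.inv ≫ c ≫ γ'.hom) h0 h0' (by
    apply L.pull_injective γ.hom
    rw [← push_pull, ← h3, ← push_comp, ← pull_comp, Iso.hom_inv_id_assoc, Iso.hom_inv_id_assoc,
      push_comp, w, push_pull, h3', pull_comp])
  refine ⟨β.hom ≫ b ≫ β'.inv, ?_, ?_⟩
  · rw [reassoc_of% h1, reassoc_of% hb, ← cancel_mono β'.hom]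
    simp [h1']
  · rw [← cancel_mono γ'.hom]
    simp only [Category.assoc] at hb' ⊢
    rw [h2', Iso.inv_hom_id_assoc, ← hb', ← reassoc_of% h2, Iso.hom_inv_id_assoc]

/-- Exactness gives `c` with the right class and then some middle map `b₁`. The difference `b - b₁`
kills `x`, so it is `y ≫ k`; correcting `c` by `k ≫ y'` does not change the class because `y'` pulls
`ε'` back to zero. -/
lemma Realizes.et3 (a : X ⟶ X') (b : Y ⟶ Y') (h : L.Realizes x y ε)
    (h' : L.Realizes x' y' ε') (w : x ≫ b = a ≫ x') :
    ∃ c : Z ⟶ Z', y ≫ c = b ≫ y' ∧ push L.bifun a ε = pull L.bifun c ε' := by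
  obtain ⟨c, hc⟩ := h'.exists_pull_eq (push L.bifun a ε) (by
    rw [← push_comp, ← w, push_comp, h.push_eq_zero, map_zero])
  obtain ⟨b₁, h1, h2⟩ := h.exists_mid a c h' hc
  obtain ⟨k, hk⟩ := h.exists_desc (b - b₁) (by rw [Preadditive.comp_sub, w, h1, sub_self])
  refine ⟨c + k ≫ y', ?_, ?_⟩
  · rw [Preadditive.comp_add, h2, reassoc_of% hk, Preadditive.sub_comp, add_sub_cancel]
  · rw [L.pull_add, pull_comp, h'.pull_eq_zero, map_zero, add_zero, hc]

lemma Realizes.et3_op (b : Y ⟶ Y') (c : Z ⟶ Z') (h : L.Realizes x y ε)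
    (h' : L.Realizes x' y' ε') (w : y ≫ c = b ≫ y') :
    ∃ a : X ⟶ X', x ≫ b = a ≫ x' ∧ push L.bifun a ε = pull L.bifun c ε' := by
  obtain ⟨a, h1, h2⟩ := (op_realizes h').et3 c.op b.op (op_realizes h)
    (congrArg (·.op) w.symm)
  exact ⟨a.unop, (congrArg (·.unop) h1).symm, h2.symm⟩

lemma Realizes.isIso_endo (h : L.Realizes x y ε) (b : Y ⟶ Y) (h1 : x ≫ b = x) (h2 : b ≫ y = y) :
    IsIso b := by
  obtain ⟨k, hk⟩ := h.exists_desc (b - 𝟙 Y) (by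
    rw [Preadditive.comp_sub, h1, Category.comp_id, sub_self])
  apply isIso_of_sq_zero
  conv_lhs => rw [← hk]
  rw [hk, ← hk, ← Category.assoc, hk, Preadditive.sub_comp, h2, Category.id_comp, sub_self,
    zero_comp]

end

lemma Realizes.exists_iso {X Y Y' Z : B} {x : X ⟶ Y} {y : Y ⟶ Z} {x' : X ⟶ Y'} {y' : Y' ⟶ Z}
    {ε : Ext L.bifun Z X} (h : L.Realizes x y ε) (h' : L.Realizes x' y' ε) :
    ∃ e : Y ≅ Y', x ≫ e.hom = x' ∧ e.hom ≫ y' = y := by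
  obtain ⟨b, h1, h2⟩ := h.exists_mid (𝟙 X) (𝟙 Z) h' (by rw [push_id, pull_id])
  obtain ⟨b', h1', h2'⟩ := h'.exists_mid (𝟙 X) (𝟙 Z) h (by rw [push_id, pull_id])
  rw [Category.id_comp] at h1 h1'
  rw [Category.comp_id] at h2 h2'
  have i₁ : IsIso (b ≫ b') := h.isIso_endo _ (by rw [reassoc_of% h1, h1'])
    (by rw [Category.assoc, ← h2', h2])
  have i₂ : IsIso (b' ≫ b) := h'.isIso_endo _ (by rw [reassoc_of% h1', h1])
    (by rw [Category.assoc, ← h2, h2'])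
  have : IsSplitMono b := IsSplitMono.mk' ⟨b' ≫ inv (b ≫ b'), by
    rw [← Category.assoc, IsIso.hom_inv_id]⟩
  have : IsSplitEpi b := IsSplitEpi.mk' ⟨inv (b' ≫ b) ≫ b', by
    rw [Category.assoc, IsIso.inv_hom_id]⟩
  have : IsIso b := isIso_of_epi_of_isSplitMono b
  exact ⟨asIso b, h1, h2.symm⟩

lemma exists_realizes' {X Z : B} (ε : Ext L.bifun Z X) :
    ∃ (Y : B) (x : X ⟶ Y) (y : Y ⟶ Z), L.Realizes x y ε := by
  obtain ⟨X₀, ⟨α⟩⟩ := L.essSurj X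
  obtain ⟨Z₀, ⟨γ⟩⟩ := L.essSurj Z
  obtain ⟨X₁, t, δ, ht, h⟩ := L.exists_push (push L.bifun α.hom (pull L.bifun γ.inv ε))
  obtain ⟨Y₀, x₀, y₀, h0⟩ := exists_realizes δ
  have := L.inverts ht
  refine ⟨L.Q.obj Y₀, α.hom ≫ L.Q.map t ≫ L.Q.map x₀, L.Q.map y₀ ≫ γ.inv,
    X₁, Y₀, Z₀, x₀, y₀, δ, α ≪≫ asIso (L.Q.map t), Iso.refl _, γ, h0, by simp, by simp, ?_⟩
  rw [← h, Iso.trans_hom, push_comp, asIso_hom]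
  rw [← push_pull, ← push_pull, ← pull_comp, Iso.hom_inv_id, pull_id]

end ExtLocalization

end ET

/-! ### Saturation, (ET4), and the localized extriangulated structure -/

namespace ET

open Extriangulated

namespace ExtLocalization

variable {A : Type u} [Category.{v} A] [Preadditive A] [HasZeroObject A]
  [HasBinaryBiproducts A] [Extriangulated A]
variable {N : ObjectProperty A} [IsExtensionClosed N] {B : Type u₂} [Category.{v} B]
  [Preadditive B] {L : ExtLocalization N B}

variable (L) in
lemma map_eq_iff {X Y : A} (f g : X ⟶ Y) : L.Q.map f = L.Q.map g ↔ FactorsThru N (f - g) := by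
  have := L.additive
  rw [← L.map_eq_zero_iff, L.Q.map_sub, sub_eq_zero]

-- An object dies exactly when its identity factors through `N`, and `N` contains its retracts.
variable (L) in
lemma isZero_iff (X : A) : IsZero (L.Q.obj X) ↔ N X := by
  have := L.additive
  rw [IsZero.iff_id_eq_zero, ← L.Q.map_id, L.map_eq_zero_iff]
  exact ⟨L.absorbing.prop_of_factorsThru_id, fun h => ⟨X, 𝟙 X, 𝟙 X, h, by simp⟩⟩

variable (L) in
/-- The class `SN N` is saturated. -/
lemma SN_of_isIso {X Y : A} (a : X ⟶ Y) [IsIso (L.Q.map a)] : SN N a := by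
  have hN := L.absorbing
  have := L.additive
  -- A fraction for the inverse makes `a ≫ g` agree with the denominator `t` modulo `N`, hence lie
  -- in `SN N`. Cancellation then turns `(n, a)` into an inflation, and only its cone `C` remains to
  -- be controlled.
  obtain ⟨X', g, t, ht, h⟩ := L.left_fraction (inv (L.Q.map a))
  have hg : SN N (a ≫ g) := hN.SN_of_sub ht ((L.map_eq_iff _ _).1 (by
    rw [L.Q.map_comp, ← h, IsIso.hom_inv_id_assoc]))
  obtain ⟨K, n, hK, Z, y, hy⟩ := hN.exists_inf_lift hg
  have h1 : biprod.lift n a ≫ biprod.map (𝟙 K) g = biprod.lift n (a ≫ g) := by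
    ext <;> simp
  obtain ⟨C, q, δ, hq⟩ : IsInflation (biprod.lift n a) := .of_comp (g := biprod.map (𝟙 K) g)
    hN.compl (by
      rw [h1]
      exact ⟨Z, y, hy.1⟩)
  have h2 : SN N (biprod.snd : K ⊞ Y ⟶ Y) := .of_def _ (.biprod_snd Y hK)
  have h3 : biprod.lift n a ≫ biprod.snd = a := by simp
  have i₁ : IsIso (L.Q.map (biprod.lift n a)) := by
    have := L.inverts h2
    have : IsIso (L.Q.map (biprod.lift n a) ≫ L.Q.map biprod.snd) := by
      rw [← L.Q.map_comp, h3]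
      infer_instance
    exact IsIso.of_isIso_comp_right _ (L.Q.map (biprod.snd : K ⊞ Y ⟶ Y))
  -- The inverted inflation pushes its class to zero, so the class is null. Hence some member of `SN
  -- N` factors through `q`, while `q` itself becomes zero; thus `C` becomes zero and lies in `N`.
  have h4 : L.μ δ = 0 := L.push_injective (L.Q.map (biprod.lift n a)) (by
    rw [← L.μ_push, push_inflation_eq_zero hq, map_zero, map_zero])
  obtain ⟨C', s, hs, h5⟩ := exists_pull_eq_zero_of_mem ((L.μ_eq_zero_iff _).1 h4)
  obtain ⟨k, rfl⟩ := exists_factor hq s h5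
  have h6 : L.Q.map q = 0 := by
    rw [← cancel_epi (L.Q.map (biprod.lift n a)), ← L.Q.map_comp, comp_zero_of_realizes hq,
      L.Q.map_zero, comp_zero]
  have h7 : N C := by
    have := L.inverts hs
    rw [← L.isZero_iff, IsZero.iff_id_eq_zero, ← cancel_epi (L.Q.map (k ≫ q)), L.Q.map_comp, h6]
    simp
  rw [← h3]
  exact .comp _ _ (.of_inf _ ⟨C, q, ⟨δ, hq⟩, h7⟩) h2

/-- The two models `Y₁`, `Y₂` of `Y` are joined by `a : Y₁ ⟶ Y₃` and a denominator `t : Y₂ ⟶ Y₃`,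
and `a` lies in `SN N` by saturation. Write `a` as an inflation `i : Y₁ ⟶ M` followed by a map with
section `s`. The first triangle is moved to `M` by composing its inflation with `i`, the second by
pushing out along `t ≫ s`. -/
lemma Realizes.exists_composable {X Y D Z F : B} {f : X ⟶ Y} {f' : Y ⟶ D} {ε : Ext L.bifun D X}
    {g : Y ⟶ Z} {g' : Z ⟶ F} {ρ : Ext L.bifun F Y} (h : L.Realizes f f' ε)
    (h' : L.Realizes g g' ρ) :
    ∃ (X₀ Y₀ D₀ Z₀ F₀ : A) (f₀ : X₀ ⟶ Y₀) (f₀' : Y₀ ⟶ D₀) (δ₀ : Ext (E (A := A)) D₀ X₀)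
      (g₀ : Y₀ ⟶ Z₀) (g₀' : Z₀ ⟶ F₀) (ρ₀ : Ext (E (A := A)) F₀ Y₀) (α : X ≅ L.Q.obj X₀)
      (β : Y ≅ L.Q.obj Y₀) (γ : D ≅ L.Q.obj D₀) (ζ : Z ≅ L.Q.obj Z₀) (φ : F ≅ L.Q.obj F₀),
      Extriangulated.Realizes f₀ f₀' δ₀ ∧ Extriangulated.Realizes g₀ g₀' ρ₀ ∧
      f ≫ β.hom = α.hom ≫ L.Q.map f₀ ∧ f' ≫ γ.hom = β.hom ≫ L.Q.map f₀' ∧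
      push L.bifun α.hom ε = pull L.bifun γ.hom (L.μ δ₀) ∧
      g ≫ ζ.hom = β.hom ≫ L.Q.map g₀ ∧ g' ≫ φ.hom = ζ.hom ≫ L.Q.map g₀' ∧
      push L.bifun β.hom ρ = pull L.bifun φ.hom (L.μ ρ₀) := by
  obtain ⟨X₁, Y₁, D₁, f₁, f₁', δ₁, α₁, β₁, γ₁, h1, h2, h3, h4⟩ := h
  obtain ⟨Y₂, Z₂, F₂, g₂, g₂', ρ₂, β₂, ζ₂, φ₂, h1', h2', h3', h4'⟩ := h'
  obtain ⟨Y₃, a, t, ht, h5⟩ := L.left_fraction (β₁.inv ≫ β₂.hom)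
  have := L.inverts ht
  have ha : IsIso (L.Q.map a) := by
    rw [← h5]
    infer_instance
  obtain ⟨M, i, p, ⟨K, q, ⟨κ, hi⟩, hK⟩, ⟨hp, ⟨⟨s, hsp⟩⟩⟩, rfl⟩ :=
    L.absorbing.exists_fac (L.SN_of_isIso a)
  replace hp : SN N p := .of_def _ hp
  have hs : SN N s := L.absorbing.SN_of_comp_right (by
    rw [hsp]
    exact .id _) hp
  obtain ⟨Z₃, g₃, g₃', h6⟩ := exists_realizes (push E (t ≫ s) ρ₂)
  have hts := SN.comp _ _ ht hs
  obtain ⟨b, hb, h7, h8⟩ := hts.exists_push h1' h6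
  obtain ⟨M', k, d, e, δ', h9, h10, h11, -, h12, -⟩ := et4 h1 hi
  have hd : SN N d := .of_inf _ ⟨K, e, ⟨_, h10⟩, hK⟩
  have := L.inverts hp
  have := L.inverts hs
  have := L.inverts hts
  have := L.inverts hb
  have := L.inverts hd
  have e1 : L.Q.map p ≫ L.Q.map s = 𝟙 _ := by
    rw [← cancel_mono (L.Q.map p), Category.assoc, ← L.Q.map_comp, hsp]
    simp
  have e2 : β₂.hom ≫ L.Q.map (t ≫ s) = β₁.hom ≫ L.Q.map i := by
    rw [← cancel_epi β₁.inv, L.Q.map_comp, reassoc_of% h5, L.Q.map_comp, Category.assoc, e1]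
    simp
  refine ⟨X₁, M, M', Z₃, F₂, f₁ ≫ i, k, δ', g₃, g₃', _, α₁, β₂ ≪≫ asIso (L.Q.map (t ≫ s)),
    γ₁ ≪≫ asIso (L.Q.map d), ζ₂ ≪≫ asIso (L.Q.map b), φ₂, h9, h6, ?_, ?_, ?_, ?_, ?_, ?_⟩
  · rw [Iso.trans_hom, asIso_hom, e2, reassoc_of% h2, L.Q.map_comp]
  · rw [Iso.trans_hom, asIso_hom, Iso.trans_hom, asIso_hom, e2, reassoc_of% h3, ← L.Q.map_comp,
      h11, L.Q.map_comp, Category.assoc]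
  · rw [h4, Iso.trans_hom, asIso_hom, pull_comp, ← L.μ_pull, h12]
  · rw [Iso.trans_hom, asIso_hom, Iso.trans_hom, asIso_hom, reassoc_of% h2', ← L.Q.map_comp, h7,
      L.Q.map_comp, Category.assoc]
  · rw [h3', Iso.trans_hom, asIso_hom, Category.assoc, ← L.Q.map_comp, h8]
  · rw [Iso.trans_hom, asIso_hom, push_comp, h4', L.μ_push, push_pull]

lemma Realizes.et4 {X Y D Z F : B} {f : X ⟶ Y} {f' : Y ⟶ D} {ε : Ext L.bifun D X}
    {g : Y ⟶ Z} {g' : Z ⟶ F} {ρ : Ext L.bifun F Y} (h : L.Realizes f f' ε)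
    (h' : L.Realizes g g' ρ) :
    ∃ (M : B) (h' : Z ⟶ M) (d : D ⟶ M) (e : M ⟶ F) (δ' : Ext L.bifun M X),
      L.Realizes (f ≫ g) h' δ' ∧ L.Realizes d e (push L.bifun f' ρ) ∧
      f' ≫ d = g ≫ h' ∧ h' ≫ e = g' ∧ pull L.bifun d δ' = ε ∧
      pull L.bifun e ρ = push L.bifun f δ' := by
  obtain ⟨X₀, Y₀, D₀, Z₀, F₀, f₀, f₀', δ₀, g₀, g₀', ρ₀, α, β, γ, ζ, φ, hf, hg, h1, h2, h3, h4,
    h5, h6⟩ := h.exists_composable h'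
  obtain ⟨M, k, d, e, δ', h7, h8, h9, h10, h11, h12⟩ := Extriangulated.et4 hf hg
  refine ⟨L.Q.obj M, ζ.hom ≫ L.Q.map k, γ.hom ≫ L.Q.map d, L.Q.map e ≫ φ.inv,
    push L.bifun α.inv (L.μ δ'), ?_, ?_, ?_, ?_, ?_, ?_⟩
  · refine ⟨X₀, Z₀, M, _, k, δ', α, ζ, Iso.refl _, h7, ?_, ?_, ?_⟩
    · rw [Category.assoc, h4, reassoc_of% h1, L.Q.map_comp]
    · simp
    · rw [← push_comp, Iso.inv_hom_id, push_id, Iso.refl_hom, pull_id]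
  · refine ⟨D₀, M, F₀, d, e, _, γ, Iso.refl _, φ, h8, ?_, ?_, ?_⟩
    · simp
    · simp
    · rw [L.μ_push, ← push_comp, h2, push_comp, h6, push_pull]
  · rw [reassoc_of% h2, reassoc_of% h4, ← L.Q.map_comp, ← L.Q.map_comp, h9]
  · rw [Category.assoc, ← L.Q.map_comp_assoc, h10, ← reassoc_of% h5]
    simp
  · apply L.push_injective α.hom
    rw [h3, push_pull, ← push_comp, Iso.inv_hom_id, push_id, pull_comp, ← L.μ_pull, h11]
  · apply L.push_injective β.hom
    rw [← push_comp, h1, push_comp, ← push_comp _ α.inv, Iso.inv_hom_id, push_id, push_pull, h6,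
      ← pull_comp, Category.assoc, Iso.inv_hom_id, Category.comp_id, ← L.μ_pull, h12, L.μ_push]

lemma Realizes.et4_op {D X Y F Z : B} {f' : D ⟶ X} {f : X ⟶ Y} {ε : Ext L.bifun Y D}
    {g' : F ⟶ Y} {g : Y ⟶ Z} {ρ : Ext L.bifun Z F} (h : L.Realizes f' f ε)
    (h' : L.Realizes g' g ρ) :
    ∃ (M : B) (h' : M ⟶ X) (d : D ⟶ M) (e : M ⟶ F) (δ' : Ext L.bifun Z M),
      L.Realizes h' (f ≫ g) δ' ∧ L.Realizes d e (pull L.bifun g' ε) ∧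
      d ≫ h' = f' ∧ h' ≫ f = e ≫ g' ∧ push L.bifun e δ' = ρ ∧
      push L.bifun d ε = pull L.bifun g δ' := by
  obtain ⟨M, k, d, e, δ', h1, h2, h3, h4, h5, h6⟩ := (op_realizes h').et4 (op_realizes h)
  exact ⟨M.unop, k.unop, e.unop, d.unop, δ', unop_realizes h1, unop_realizes h2,
    congrArg (·.unop) h4, (congrArg (·.unop) h3).symm, h5, h6⟩

section

variable [HasBinaryBiproducts B]

variable (L) in
/-- The comparison of biproducts. -/
noncomputable def biprodIso {X Y : B} {X₀ Y₀ : A} (α : X ≅ L.Q.obj X₀) (β : Y ≅ L.Q.obj Y₀) :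
    X ⊞ Y ≅ L.Q.obj (X₀ ⊞ Y₀) where
  hom := biprod.fst ≫ α.hom ≫ L.Q.map biprod.inl + biprod.snd ≫ β.hom ≫ L.Q.map biprod.inr
  inv := L.Q.map biprod.fst ≫ α.inv ≫ biprod.inl + L.Q.map biprod.snd ≫ β.inv ≫ biprod.inr
  hom_inv_id := by
    have := L.additive
    simp only [Preadditive.add_comp, Preadditive.comp_add, Category.assoc,
      ← L.Q.map_comp_assoc]
    simp
  inv_hom_id := by
    have := L.additive
    simp only [Preadditive.add_comp, Preadditive.comp_add, Category.assoc,
      biprod.inl_fst_assoc, biprod.inl_snd_assoc, biprod.inr_fst_assoc, biprod.inr_snd_assoc,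
      Iso.inv_hom_id_assoc, zero_comp, comp_zero, add_zero, zero_add]
    rw [← L.Q.map_comp, ← L.Q.map_comp, ← L.Q.map_add, biprod.total, L.Q.map_id]

section

variable {X Y : B} {X₀ Y₀ : A} (α : X ≅ L.Q.obj X₀) (β : Y ≅ L.Q.obj Y₀)

@[simp]
lemma inl_biprodIso_hom : biprod.inl ≫ (L.biprodIso α β).hom = α.hom ≫ L.Q.map biprod.inl := by
  simp [biprodIso, Preadditive.comp_add]

@[simp]
lemma inr_biprodIso_hom : biprod.inr ≫ (L.biprodIso α β).hom = β.hom ≫ L.Q.map biprod.inr := by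
  simp [biprodIso, Preadditive.comp_add]

@[simp]
lemma biprodIso_hom_fst : (L.biprodIso α β).hom ≫ L.Q.map biprod.fst = biprod.fst ≫ α.hom := by
  have := L.additive
  simp [biprodIso, Preadditive.add_comp, ← L.Q.map_comp]

@[simp]
lemma biprodIso_hom_snd : (L.biprodIso α β).hom ≫ L.Q.map biprod.snd = biprod.snd ≫ β.hom := by
  have := L.additive
  simp [biprodIso, Preadditive.add_comp, ← L.Q.map_comp]

lemma map_biprodIso_hom {X' Y' : B} {X₀' Y₀' : A} (α' : X' ≅ L.Q.obj X₀')
    (β' : Y' ≅ L.Q.obj Y₀') {f : X ⟶ X'} {g : Y ⟶ Y'} {f₀ : X₀ ⟶ X₀'} {g₀ : Y₀ ⟶ Y₀'}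
    (hf : f ≫ α'.hom = α.hom ≫ L.Q.map f₀) (hg : g ≫ β'.hom = β.hom ≫ L.Q.map g₀) :
    biprod.map f g ≫ (L.biprodIso α' β').hom =
      (L.biprodIso α β).hom ≫ L.Q.map (biprod.map f₀ g₀) := by
  apply biprod.hom_ext'
  · simp only [biprod.inl_map_assoc, inl_biprodIso_hom, reassoc_of% hf,
      reassoc_of% inl_biprodIso_hom α β,
      ← L.Q.map_comp, biprod.inl_map]
  · simp only [biprod.inr_map_assoc, inr_biprodIso_hom, reassoc_of% hg,
      reassoc_of% inr_biprodIso_hom α β,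
      ← L.Q.map_comp, biprod.inr_map]

end

variable (L) in
lemma realizes_zero' (X Z : B) :
    L.Realizes (biprod.inl : X ⟶ X ⊞ Z) (biprod.snd : X ⊞ Z ⟶ Z) (0 : Ext L.bifun Z X) := by
  obtain ⟨X₀, ⟨α⟩⟩ := L.essSurj X
  obtain ⟨Z₀, ⟨γ⟩⟩ := L.essSurj Z
  exact ⟨X₀, X₀ ⊞ Z₀, Z₀, _, _, _, α, L.biprodIso α γ, γ, realizes_zero X₀ Z₀, by simp, by simp,
    by simp⟩

lemma Realizes.sum {X Y Z X' Y' Z' : B} {x : X ⟶ Y} {y : Y ⟶ Z} {ε : Ext L.bifun Z X}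
    {x' : X' ⟶ Y'} {y' : Y' ⟶ Z'} {ε' : Ext L.bifun Z' X'} (h : L.Realizes x y ε)
    (h' : L.Realizes x' y' ε') :
    L.Realizes (biprod.map x x') (biprod.map y y') (extSum L.bifun ε ε') := by
  obtain ⟨X₀, Y₀, Z₀, x₀, y₀, δ₀, α, β, γ, h0, h1, h2, h3⟩ := h
  obtain ⟨X₀', Y₀', Z₀', x₀', y₀', δ₀', α', β', γ', h0', h1', h2', h3'⟩ := h'
  refine ⟨_, _, _, _, _, _, L.biprodIso α α', L.biprodIso β β', L.biprodIso γ γ',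
    realizes_sum h0 h0', map_biprodIso_hom _ _ _ _ h1 h1', map_biprodIso_hom _ _ _ _ h2 h2', ?_⟩
  rw [extSum, extSum, map_add, map_add, map_add, ← push_comp, ← push_comp, inl_biprodIso_hom,
    inr_biprodIso_hom, push_comp, push_comp, push_pull _ α.hom, push_pull _ α'.hom, h3, h3',
    ← pull_comp, ← pull_comp, L.μ_push, L.μ_push, L.μ_pull, L.μ_pull, ← push_pull, ← push_pull,
    ← pull_comp, ← pull_comp, biprodIso_hom_fst, biprodIso_hom_snd]

variable (L) in
/-- The extriangulated structure on the localized category. -/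
noncomputable abbrev extriangulated [HasZeroObject B] : Extriangulated B where
  E := L.bifun
  additive_right := L.additive_right
  additive_left := L.additive_left
  Realizes := L.Realizes
  exists_realizes := exists_realizes'
  realizes_of_iso e h := h.of_iso (Iso.refl _) e.symm (Iso.refl _) (by simp) (by simp) (by
    rw [Iso.refl_hom, Iso.refl_hom, push_id, pull_id])
  iso_of_realizes h h' := h.exists_iso h'
  exists_mid a c h h' w := h.exists_mid a c h' w
  realizes_zero := L.realizes_zero'
  realizes_sum h h' := h.sum h'
  et3 a b h h' w := h.et3 a b h' w
  et3_op b c h h' w := h.et3_op b c h' w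
  et4 h h' := h.et4 h'
  et4_op h h' := h.et4_op h'

end

end ExtLocalization

end ET

/-! ### The localized category as fractions of the ideal quotient -/

namespace ET

open Extriangulated

lemma SmallLoc.additive_of_comp {C : Type u} [Category.{v} C] (W : MorphismProperty C)
    [W.HasLeftCalculusOfFractions] [EssentiallySmall.{v} C] [Preadditive C]
    {D : Type u₂} [Category.{v₂} D] [Preadditive D] (G : SmallLoc W ⥤ D)
    (h : (SmallLoc.functor W ⋙ G).Additive) : G.Additive :=
  (Localization.functor_additive_iff (SmallLoc.functor W) W G).2 h

lemma additive_of_quotient_comp {C : Type u} [Category.{v} C] [Preadditive C] (r : HomRel C)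
    [Congruence r] [Preadditive (Quotient r)] [(Quotient.functor r).Additive]
    {D : Type u₂} [Category.{v₂} D] [Preadditive D] (G : Quotient r ⥤ D)
    (h : (Quotient.functor r ⋙ G).Additive) : G.Additive where
  map_add {X Y f g} := by
    obtain ⟨f, rfl⟩ := (Quotient.functor r).map_surjective f
    obtain ⟨g, rfl⟩ := (Quotient.functor r).map_surjective g
    rw [← Functor.map_add]
    exact h.map_add

section

variable {A : Type u} [Category.{v} A] [Preadditive A] [HasZeroObject A]
  [HasBinaryBiproducts A] [Extriangulated A] [EssentiallySmall.{v} A]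
  (N : ObjectProperty A) [IsExtensionClosed N] [hN : Fact (IsAbsorbing N)]

instance : EssentiallySmall.{v} (IdealQuot (SN N)) :=
  essentiallySmall_of_essSurj (idealProj (SN N))

/-- The localization of `A` at `SN N`. -/
abbrev Loc := SmallLoc (bar (SN N))

/-- The localization functor at `SN N`. -/
noncomputable def locFunctor : A ⥤ Loc N := idealProj (SN N) ⋙ SmallLoc.functor (bar (SN N))

instance : (locFunctor N).Additive := by
  unfold locFunctor
  infer_instance

instance : (locFunctor N).EssSurj where
  mem_essImage X := by
    obtain ⟨⟨X⟩, rfl⟩ := SmallLoc.obj_surjective X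
    exact ⟨X, ⟨Iso.refl _⟩⟩

instance : EssentiallySmall.{v} (Loc N) :=
  essentiallySmall_of_essSurj (locFunctor N)

lemma locFunctor_inverts : (SN N).IsInvertedBy (locFunctor N) := fun _ _ s hs =>
  Localization.inverts (SmallLoc.functor (bar (SN N))) (bar (SN N)) _ ((bar_map_iff s).2 hs)

section

variable {D : Type u₂} [Category.{v₂} D]

variable {N} in
/-- The strict universal property of the localization functor. -/
noncomputable def locLift (F : A ⥤ D) (hF : (SN N).IsInvertedBy F) : Loc N ⥤ D :=
  SmallLoc.lift (idealLift F hF) (idealLift_inverts F hF)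

variable {N} in
lemma locLift_map (F : A ⥤ D) (hF : (SN N).IsInvertedBy F) {X Y : A} (f : X ⟶ Y) :
    (locLift F hF).map ((locFunctor N).map f) = F.map f :=
  SmallLoc.lift_map _ _ ((idealProj (SN N)).map f)

lemma locFunctor_fac (F : A ⥤ D) (hF : (SN N).IsInvertedBy F) :
    locFunctor N ⋙ locLift F hF = F :=
  CategoryTheory.Functor.ext (fun _ => rfl) (fun _ _ f =>
    (locLift_map F hF f).trans ((Category.id_comp _).trans (Category.comp_id _)).symm)

variable {N} in
lemma locFunctor_uniq (F G : Loc N ⥤ D) (h : locFunctor N ⋙ F = locFunctor N ⋙ G) : F = G :=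
  SmallLoc.uniq _ _ (Quotient.lift_unique' _ _ _ h)

variable {N} in
lemma additive_of_locFunctor_comp [Preadditive D] (G : Loc N ⥤ D)
    (h : (locFunctor N ⋙ G).Additive) : G.Additive :=
  SmallLoc.additive_of_comp _ _ (additive_of_quotient_comp _ _ h)

/-- The strict universal property. -/
noncomputable def locFunctorUniversal :
    Localization.StrictUniversalPropertyFixedTarget (locFunctor N) (SN N) D where
  inverts := locFunctor_inverts N
  lift := locLift
  fac := locFunctor_fac N
  uniq := locFunctor_uniq

end

instance : (locFunctor N).IsLocalization (SN N) :=
  .mk' _ _ (locFunctorUniversal N) (locFunctorUniversal N)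

instance : HasZeroObject (Loc N) := (locFunctor N).hasZeroObject_of_additive

lemma exists_obj_eq (X : Loc N) : ∃ X₀ : A, (locFunctor N).obj X₀ = X := by
  obtain ⟨⟨X⟩, rfl⟩ := SmallLoc.obj_surjective X
  exact ⟨X, rfl⟩

instance : HasBinaryBiproducts (Loc N) where
  has_binary_biproduct X Y := by
    obtain ⟨X, rfl⟩ := exists_obj_eq N X
    obtain ⟨Y, rfl⟩ := exists_obj_eq N Y
    have := preservesBinaryBiproducts_of_preservesBiproducts (locFunctor N)
    exact HasBinaryBiproduct.mk ⟨_, isBinaryBilimitOfPreserves (locFunctor N)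
      (BinaryBiproduct.isBilimit X Y)⟩

lemma locFunctor_left_fraction {X Y : A} (f : (locFunctor N).obj X ⟶ (locFunctor N).obj Y) :
    ∃ (Y' : A) (g : X ⟶ Y') (t : Y ⟶ Y'), SN N t ∧
      f ≫ (locFunctor N).map t = (locFunctor N).map g := by
  obtain ⟨@⟨⟨Y'⟩, g, t, ht⟩, rfl⟩ := Localization.exists_leftFraction
    (SmallLoc.functor (bar (SN N))) (bar (SN N)) f
  obtain ⟨g, rfl⟩ := (idealProj (SN N)).map_surjective g
  obtain ⟨t, rfl⟩ := (idealProj (SN N)).map_surjective t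
  refine ⟨Y', g, t, (bar_map_iff t).1 ht, ?_⟩
  exact MorphismProperty.LeftFraction.map_comp_map_s _ _ _

lemma locFunctor_right_fraction {X Y : A} (f : (locFunctor N).obj X ⟶ (locFunctor N).obj Y) :
    ∃ (X' : A) (s : X' ⟶ X) (g : X' ⟶ Y), SN N s ∧
      (locFunctor N).map s ≫ f = (locFunctor N).map g := by
  obtain ⟨@⟨⟨X'⟩, s, hs, g⟩, rfl⟩ := Localization.exists_rightFraction
    (SmallLoc.functor (bar (SN N))) (bar (SN N)) f
  obtain ⟨g, rfl⟩ := (idealProj (SN N)).map_surjective g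
  obtain ⟨s, rfl⟩ := (idealProj (SN N)).map_surjective s
  refine ⟨X', s, g, (bar_map_iff s).1 hs, ?_⟩
  exact MorphismProperty.RightFraction.map_s_comp_map (W := bar (SN N))
    ⟨(idealProj (SN N)).map s, hs, (idealProj (SN N)).map g⟩ (SmallLoc.functor _)
    (Localization.inverts (SmallLoc.functor _) _)

lemma locFunctor_map_eq_iff {X Y : A} (f g : X ⟶ Y) :
    (locFunctor N).map f = (locFunctor N).map g ↔ FactorsThru N (f - g) := by
  rw [← idealProj_map_eq_iff]
  constructor
  · intro h
    obtain ⟨Z, s, hs, h'⟩ := (MorphismProperty.map_eq_iff_postcomp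
      (SmallLoc.functor (bar (SN N))) (bar (SN N)) ((idealProj (SN N)).map f)
      ((idealProj (SN N)).map g)).1 h
    exact mono_of_bar hs _ _ h'
  · intro h
    exact congrArg (SmallLoc.functor (bar (SN N))).map h

end

end ET

/-! ### The localized bifunctor as a kernel in the localized trivial extension -/

namespace ET

open Extriangulated

section

variable {A : Type u} [Category.{v} A] [Preadditive A] [HasZeroObject A]
  [HasBinaryBiproducts A] [Extriangulated A] [EssentiallySmall.{v} A]
  (N : ObjectProperty A) [IsExtensionClosed N] [hN : Fact (IsAbsorbing N)]

instance : EssentiallySmall.{v} (TrivQuot N) := by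
  have : (TrivExt.zeroExt A ⋙ trivProj N).EssSurj := ⟨fun ⟨⟨X⟩⟩ => ⟨X, ⟨Iso.refl _⟩⟩⟩
  exact essentiallySmall_of_essSurj (TrivExt.zeroExt A ⋙ trivProj N)

/-- The localization of the trivial extension. -/
abbrev TrivLoc := SmallLoc (trivSN N)

/-- The object of `TrivLoc N` given by an object of `A`. -/
noncomputable abbrev trivObj (X : A) : TrivLoc N :=
  (SmallLoc.functor (trivSN N)).obj ((trivProj N).obj ⟨X⟩)

/-- The morphism of `TrivLoc N` given by a morphism and an extension. -/
noncomputable def trivHom {X Y : A} (f : X ⟶ Y) (δ : Ext (E (A := A)) X Y) :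
    trivObj N X ⟶ trivObj N Y :=
  (SmallLoc.functor (trivSN N)).map (trivMk N f δ)

section

variable {X Y Z : A}

lemma trivHom_comp (f : X ⟶ Y) (δ : Ext (E (A := A)) X Y) (g : Y ⟶ Z)
    (ε : Ext (E (A := A)) Y Z) :
    trivHom N f δ ≫ trivHom N g ε = trivHom N (f ≫ g) (push E g δ + pull E f ε) := by
  rw [trivHom, trivHom, trivHom, ← Functor.map_comp, trivMk_comp]

lemma trivHom_comp_zero (f : X ⟶ Y) (δ : Ext (E (A := A)) X Y) (g : Y ⟶ Z) :
    trivHom N f δ ≫ trivHom N g 0 = trivHom N (f ≫ g) (push E g δ) := by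
  rw [trivHom_comp, map_zero, add_zero]

lemma trivHom_zero_comp (f : X ⟶ Y) (g : Y ⟶ Z) (ε : Ext (E (A := A)) Y Z) :
    trivHom N f 0 ≫ trivHom N g ε = trivHom N (f ≫ g) (pull E f ε) := by
  rw [trivHom_comp, map_zero, zero_add]

lemma trivHom_add (f g : X ⟶ Y) (δ ε : Ext (E (A := A)) X Y) :
    trivHom N (f + g) (δ + ε) = trivHom N f δ + trivHom N g ε := by
  rw [trivHom, trivHom, trivHom, ← Functor.map_add, trivMk_add]

lemma isIso_trivHom {s : X ⟶ Y} (hs : SN N s) : IsIso (trivHom N s 0) :=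
  Localization.inverts (SmallLoc.functor (trivSN N)) (trivSN N) _ ⟨s, hs, rfl⟩

lemma trivHom_eq_iff (f g : X ⟶ Y) (δ ε : Ext (E (A := A)) X Y) :
    trivHom N f δ = trivHom N g ε ↔ FactorsThru N (f - g) ∧ δ - ε ∈ nullExt N X Y := by
  rw [← trivMk_eq_iff]
  constructor
  · intro h
    obtain ⟨⟨⟨Z⟩⟩, _, ⟨s, hs, rfl⟩, h'⟩ := (MorphismProperty.map_eq_iff_postcomp
      (SmallLoc.functor (trivSN N)) (trivSN N) (trivMk N f δ) (trivMk N g ε)).1 h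
    replace h' := (trivMk_comp_zero N _ _ _).symm.trans (h'.trans (trivMk_comp_zero N _ _ _))
    rw [trivMk_eq_iff, ← Preadditive.sub_comp, ← map_sub] at h'
    rw [trivMk_eq_iff]
    exact ⟨hN.out.factorsThru_of_comp_right hs h'.1, hN.out.mem_nullExt_of_push hs h'.2⟩
  · intro h
    rw [trivHom, trivHom, h]

lemma trivHom_left_fraction (f : trivObj N X ⟶ trivObj N Y) :
    ∃ (Y' : A) (g : X ⟶ Y') (δ : Ext (E (A := A)) X Y') (t : Y ⟶ Y'), SN N t ∧
      f ≫ trivHom N t 0 = trivHom N g δ := by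
  obtain ⟨@⟨⟨⟨Y'⟩⟩, g, _, ⟨t, ht, rfl⟩⟩, rfl⟩ := Localization.exists_leftFraction
    (SmallLoc.functor (trivSN N)) (trivSN N) f
  obtain ⟨g, δ, rfl⟩ := trivMk_surjective N g
  refine ⟨Y', g, δ, t, ht, ?_⟩
  exact MorphismProperty.LeftFraction.map_comp_map_s (W := trivSN N)
    ⟨trivMk N g δ, trivMk N t 0, ⟨t, ht, rfl⟩⟩ (SmallLoc.functor _)
    (Localization.inverts (SmallLoc.functor _) _)

lemma trivHom_right_fraction (f : trivObj N X ⟶ trivObj N Y) :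
    ∃ (X' : A) (s : X' ⟶ X) (g : X' ⟶ Y) (δ : Ext (E (A := A)) X' Y), SN N s ∧
      trivHom N s 0 ≫ f = trivHom N g δ := by
  obtain ⟨@⟨⟨⟨X'⟩⟩, _, ⟨s, hs, rfl⟩, g⟩, rfl⟩ := Localization.exists_rightFraction
    (SmallLoc.functor (trivSN N)) (trivSN N) f
  obtain ⟨g, δ, rfl⟩ := trivMk_surjective N g
  refine ⟨X', s, g, δ, hs, ?_⟩
  exact MorphismProperty.RightFraction.map_s_comp_map (W := trivSN N)
    ⟨trivMk N s 0, ⟨s, hs, rfl⟩, trivMk N g δ⟩ (SmallLoc.functor _)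
    (Localization.inverts (SmallLoc.functor _) _)

end

section

variable {D : Type u₂} [Category.{v₂} D] (F : TrivExt A ⥤ D)
  (h : ∀ ⦃X Y : TrivExt A⦄ (f g : X ⟶ Y), extRel N f g → F.map f = F.map g)
  (h' : ∀ ⦃X Y : A⦄ (s : X ⟶ Y), SN N s → IsIso (F.map ((TrivExt.zeroExt A).map s)))

/-- The universal property of `TrivLoc N`. -/
noncomputable def trivLift : TrivLoc N ⥤ D :=
  SmallLoc.lift (CategoryTheory.Quotient.lift _ F h) (by
    rintro ⟨⟨X⟩⟩ ⟨⟨Y⟩⟩ _ ⟨s, hs, rfl⟩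
    exact h' s hs)

lemma trivLift_map {X Y : A} (f : X ⟶ Y) (δ : Ext (E (A := A)) X Y) :
    (trivLift N F h h').map (trivHom N f δ) =
      F.map (⟨f, δ⟩ : TrivExt.Hom ⟨X⟩ ⟨Y⟩) :=
  SmallLoc.lift_map _ _ (trivMk N f δ)

lemma trivLift_fac :
    trivProj N ⋙ SmallLoc.functor (trivSN N) ⋙ trivLift N F h h' = F :=
  CategoryTheory.Functor.ext (fun _ => rfl) (fun _ _ f =>
    (trivLift_map N F h h' f.hom f.extn).trans
      ((Category.id_comp _).trans (Category.comp_id _)).symm)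

lemma additive_of_trivProj_comp [Preadditive D] (G : TrivLoc N ⥤ D)
    (h : (trivProj N ⋙ SmallLoc.functor (trivSN N) ⋙ G).Additive) : G.Additive :=
  SmallLoc.additive_of_comp _ _ (additive_of_quotient_comp _ _ h)

end

/-- The localized category as a subcategory of the localized trivial extension. -/
noncomputable def locToTriv : Loc N ⥤ TrivLoc N :=
  locLift (TrivExt.zeroExt A ⋙ trivProj N ⋙ SmallLoc.functor (trivSN N))
    (fun _ _ _ hs => isIso_trivHom N hs)

lemma locToTriv_map {X Y : A} (f : X ⟶ Y) :
    (locToTriv N).map ((locFunctor N).map f) = trivHom N f 0 :=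
  locLift_map _ _ f

instance : (locToTriv N).Additive :=
  additive_of_locFunctor_comp _ (by
    have : locFunctor N ⋙ locToTriv N =
        TrivExt.zeroExt A ⋙ trivProj N ⋙ SmallLoc.functor (trivSN N) :=
      locFunctor_fac N _ _
    rw [this]
    infer_instance)

/-- The projection of the localized trivial extension. -/
noncomputable def trivToLoc : TrivLoc N ⥤ Loc N :=
  trivLift N (TrivExt.fst A ⋙ locFunctor N)
    (fun _ _ f g h => (locFunctor_map_eq_iff N f.hom g.hom).2 h.1)
    (fun _ _ s hs => locFunctor_inverts N s hs)

lemma trivToLoc_map {X Y : A} (f : X ⟶ Y) (δ : Ext (E (A := A)) X Y) :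
    (trivToLoc N).map (trivHom N f δ) = (locFunctor N).map f :=
  trivLift_map _ _ _ _ f δ

instance : (trivToLoc N).Additive :=
  additive_of_trivProj_comp _ _ (by
    have : trivProj N ⋙ SmallLoc.functor (trivSN N) ⋙ trivToLoc N =
        TrivExt.fst A ⋙ locFunctor N := trivLift_fac _ _ _ _
    rw [this]
    infer_instance)

section

variable {B : Type u} [Category.{v} B] [Preadditive B] {T : Type u₂} [Category.{v₂} T]
  [Preadditive T] (I : B ⥤ T) (P : T ⥤ B) [P.Additive]

/-- The morphisms between objects in the image of `I` which are killed by `P`. -/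
def kerHom (C X : B) : AddSubgroup (I.obj C ⟶ I.obj X) := P.mapAddHom.ker

lemma mem_kerHom_iff {C X : B} (f : I.obj C ⟶ I.obj X) : f ∈ kerHom I P C X ↔ P.map f = 0 :=
  Iff.rfl

/-- The bifunctor of the morphisms killed by `P`. -/
def kerBifunctor : Bᵒᵖ ⥤ B ⥤ AddCommGrpCat.{v₂} where
  obj C :=
    { obj X := AddCommGrpCat.of (kerHom I P C.unop X)
      map {X X'} a := AddCommGrpCat.ofHom
        { toFun ε := ⟨ε.1 ≫ I.map a, by
            rw [mem_kerHom_iff, Functor.map_comp, (mem_kerHom_iff I P _).1 ε.2, zero_comp]⟩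
          map_zero' := Subtype.ext zero_comp
          map_add' ε ε' := Subtype.ext (Preadditive.add_comp _ _ _ _ _ _) }
      map_id X := by
        ext ε
        change ε.1 ≫ I.map (𝟙 X) = ε.1
        rw [CategoryTheory.Functor.map_id, Category.comp_id]
      map_comp a b := by
        ext ε
        change ε.1 ≫ I.map (a ≫ b) = (ε.1 ≫ I.map a) ≫ I.map b
        rw [Functor.map_comp, Category.assoc] }
  map {C C'} c :=
    { app X := AddCommGrpCat.ofHom
        { toFun ε := ⟨I.map c.unop ≫ ε.1, by
            rw [mem_kerHom_iff, Functor.map_comp, (mem_kerHom_iff I P _).1 ε.2, comp_zero]⟩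
          map_zero' := Subtype.ext comp_zero
          map_add' ε ε' := Subtype.ext (Preadditive.comp_add _ _ _ _ _ _) }
      naturality X X' a := by
        ext ε
        change I.map c.unop ≫ ε.1 ≫ I.map a = (I.map c.unop ≫ ε.1) ≫ I.map a
        rw [Category.assoc] }
  map_id C := by
    ext X ε
    change I.map (𝟙 C.unop) ≫ ε.1 = ε.1
    rw [CategoryTheory.Functor.map_id, Category.id_comp]
  map_comp c c' := by
    ext X ε
    change I.map (c'.unop ≫ c.unop) ≫ ε.1 = I.map c'.unop ≫ I.map c.unop ≫ ε.1
    rw [Functor.map_comp, Category.assoc]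

lemma kerBifunctor_additive_right [I.Additive] (C : Bᵒᵖ) : ((kerBifunctor I P).obj C).Additive where
  map_add {X X' a b} := by
    ext ε
    apply Subtype.ext
    change ε.1 ≫ I.map (a + b) = ε.1 ≫ I.map a + ε.1 ≫ I.map b
    rw [Functor.map_add, Preadditive.comp_add]

lemma kerBifunctor_additive_left [I.Additive] (X : B) :
    ((kerBifunctor I P).flip.obj X).Additive where
  map_add {C C' a b} := by
    ext ε
    apply Subtype.ext
    change I.map (a.unop + b.unop) ≫ ε.1 = I.map a.unop ≫ ε.1 + I.map b.unop ≫ ε.1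
    rw [Functor.map_add, Preadditive.add_comp]

end

lemma trivHom_mem_kerHom_iff {C X : A} (f : C ⟶ X) (δ : Ext (E (A := A)) C X) :
    (show (locToTriv N).obj ((locFunctor N).obj C) ⟶ (locToTriv N).obj ((locFunctor N).obj X) from
      trivHom N f δ) ∈ kerHom (locToTriv N) (trivToLoc N) _ _ ↔ FactorsThru N f := by
  rw [mem_kerHom_iff]
  have h := locFunctor_map_eq_iff N f 0
  rw [sub_zero, Functor.map_zero] at h
  rw [← h]
  exact Iff.of_eq (congrArg (· = 0) (trivToLoc_map N f δ))

lemma locFunctor_map_eq_zero_iff {X Y : A} (f : X ⟶ Y) :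
    (locFunctor N).map f = 0 ↔ FactorsThru N f := by
  have h := locFunctor_map_eq_iff N f 0
  rwa [sub_zero, Functor.map_zero] at h

lemma trivHom_zero_eq_zero_iff {C X : A} (δ : Ext (E (A := A)) C X) :
    trivHom N 0 δ = 0 ↔ δ ∈ nullExt N C X := by
  have h := trivHom_eq_iff N (0 : C ⟶ X) 0 δ 0
  rw [sub_zero, sub_zero] at h
  refine Iff.trans ?_ (h.trans (and_iff_right (.zero _ _)))
  exact Eq.congr_right ((SmallLoc.functor (trivSN N)).map_zero _ _).symm

lemma trivHom_eq_zero_trivHom {C X : A} {f : C ⟶ X} (δ : Ext (E (A := A)) C X)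
    (hf : FactorsThru N f) : trivHom N f δ = trivHom N 0 δ :=
  (trivHom_eq_iff N f 0 δ δ).2 ⟨by rwa [sub_zero], by
    rw [sub_self]
    exact zero_mem _⟩

/-- The numerator of a left fraction for `ε` is a pair `(g, δ)`. As `ε` is killed by the projection,
`g` factors through `N` and may be replaced by zero. -/
lemma exists_comp_trivHom {C X : A} (ε : trivObj N C ⟶ trivObj N X)
    (hε : (trivToLoc N).map ε = 0) :
    ∃ (X' : A) (t : X ⟶ X') (δ : Ext (E (A := A)) C X'), SN N t ∧
      ε ≫ trivHom N t 0 = trivHom N 0 δ := by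
  obtain ⟨X', g, δ, t, ht, h⟩ := trivHom_left_fraction N ε
  have hg : (locFunctor N).map g = 0 := by
    have h' := congrArg (trivToLoc N).map h
    rw [Functor.map_comp, hε, zero_comp] at h'
    exact (trivToLoc_map N g δ).symm.trans h'.symm
  exact ⟨X', t, δ, ht, h.trans (trivHom_eq_zero_trivHom N δ
    ((locFunctor_map_eq_zero_iff N g).1 hg))⟩

lemma exists_trivHom_comp {C X : A} (ε : trivObj N C ⟶ trivObj N X)
    (hε : (trivToLoc N).map ε = 0) :
    ∃ (C' : A) (s : C' ⟶ C) (δ : Ext (E (A := A)) C' X), SN N s ∧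
      trivHom N s 0 ≫ ε = trivHom N 0 δ := by
  obtain ⟨C', s, g, δ, hs, h⟩ := trivHom_right_fraction N ε
  have hg : (locFunctor N).map g = 0 := by
    have h' := congrArg (trivToLoc N).map h
    rw [Functor.map_comp, hε, comp_zero] at h'
    exact (trivToLoc_map N g δ).symm.trans h'.symm
  exact ⟨C', s, δ, hs, h.trans (trivHom_eq_zero_trivHom N δ
    ((locFunctor_map_eq_zero_iff N g).1 hg))⟩

/-- The comparison of extensions with localized extensions. -/
noncomputable def locμ (C X : A) : Ext (E (A := A)) C X →+
    Ext (kerBifunctor (locToTriv N) (trivToLoc N)) ((locFunctor N).obj C)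
      ((locFunctor N).obj X) where
  toFun δ := ⟨trivHom N 0 δ, (trivHom_mem_kerHom_iff N 0 δ).2 (.zero _ _)⟩
  map_zero' := Subtype.ext ((SmallLoc.functor (trivSN N)).map_zero _ _)
  map_add' δ δ' := Subtype.ext (by
    refine Eq.trans ?_ (trivHom_add N 0 0 δ δ')
    exact congrArg (trivHom N · (δ + δ')) (add_zero 0).symm)

/-- The localization of an extriangulated category at `SN N`. -/
noncomputable def extLoc : ExtLocalization N (Loc N) where
  absorbing := hN.out
  Q := locFunctor N
  additive := inferInstance
  bifun := kerBifunctor (locToTriv N) (trivToLoc N)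
  additive_right := kerBifunctor_additive_right _ _
  additive_left := kerBifunctor_additive_left _ _
  μ {C X} := locμ N C X
  μ_push a δ := Subtype.ext (by
    refine Eq.trans ?_ (congrArg (trivHom N 0 δ ≫ ·) (locToTriv_map N a)).symm
    refine Eq.trans ?_ (trivHom_comp_zero N 0 δ a).symm
    rw [zero_comp]
    rfl)
  μ_pull c δ := Subtype.ext (by
    refine Eq.trans ?_ (congrArg (· ≫ trivHom N 0 δ) (locToTriv_map N c)).symm
    refine Eq.trans ?_ (trivHom_zero_comp N c 0 δ).symm
    rw [comp_zero]
    rfl)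
  essSurj X := by
    obtain ⟨X₀, rfl⟩ := exists_obj_eq N X
    exact ⟨X₀, ⟨Iso.refl _⟩⟩
  map_eq_zero_iff := locFunctor_map_eq_zero_iff N
  inverts {X Y s} hs := locFunctor_inverts N s hs
  left_fraction := locFunctor_left_fraction N
  right_fraction := locFunctor_right_fraction N
  μ_eq_zero_iff {C X} δ := Subtype.ext_iff.trans (trivHom_zero_eq_zero_iff N δ)
  exists_push {C X} ε := by
    obtain ⟨X', t, δ, ht, h⟩ := exists_comp_trivHom N (C := C) (X := X) ε.1 ε.2
    exact ⟨X', t, δ, ht, Subtype.ext ((congrArg (ε.1 ≫ ·) (locToTriv_map N t)).trans h)⟩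
  exists_pull {C X} ε := by
    obtain ⟨C', s, δ, hs, h⟩ := exists_trivHom_comp N (C := C) (X := X) ε.1 ε.2
    exact ⟨C', s, δ, hs, Subtype.ext ((congrArg (· ≫ ε.1) (locToTriv_map N s)).trans h)⟩

end

end ET

/-! ### Exact functors vanishing on `N` and the universal property -/

namespace ET

open Extriangulated

/-- A sequence isomorphic to a realization of an extension is a realization. -/
lemma realizes_of_isos {A : Type u} [Category.{v} A] [Preadditive A] [HasZeroObject A]
    [HasBinaryBiproducts A] [Extriangulated A] {X Y Z X' Y' Z' : A} {x : X ⟶ Y} {y : Y ⟶ Z}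
    {δ : Ext (E (A := A)) Z X} {x' : X' ⟶ Y'} {y' : Y' ⟶ Z'} {δ' : Ext (E (A := A)) Z' X'}
    (h : Realizes x' y' δ') (α : X ≅ X') (β : Y ≅ Y') (γ : Z ≅ Z')
    (h1 : x ≫ β.hom = α.hom ≫ x') (h2 : y ≫ γ.hom = β.hom ≫ y')
    (h3 : push E α.hom δ = pull E γ.hom δ') : Realizes x y δ := by
  have := realizes_of_iso β.symm (realizes_transport h α.symm γ.symm)
  convert this using 1
  · simp only [Iso.symm_inv, Iso.symm_hom]
    rw [← h1, Category.assoc, Iso.hom_inv_id, Category.comp_id]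
  · simp only [Iso.symm_inv, Iso.symm_hom]
    rw [← reassoc_of% h2, Iso.hom_inv_id, Category.comp_id]
  · rw [Iso.symm_hom, Iso.symm_inv, ← h3, ← push_comp, Iso.hom_inv_id, push_id]

variable {A : Type u} [Category.{v} A] [Preadditive A] [HasZeroObject A]
  [HasBinaryBiproducts A] [Extriangulated A] (N : ObjectProperty A) [IsExtensionClosed N]

section

variable {N} {A' : Type u₃} [Category.{v₃} A'] [Preadditive A'] [HasZeroObject A']
  [HasBinaryBiproducts A'] [Extriangulated A'] (G : ExtriFunctor A A')
  (hG : ∀ X, N X → IsZero (G.functor.obj X))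

include hG

omit [IsExtensionClosed N] in
lemma ExtriFunctor.inverts : (SN N).IsInvertedBy G.functor := by
  intro X Y f hf
  induction hf with
  | of_inf f h =>
    obtain ⟨Z, g, ⟨δ, h⟩, hZ⟩ := h
    exact isIso_of_realizes_of_isZero_right (G.map_realizes h) (hG Z hZ)
  | of_def f h =>
    obtain ⟨Z, g, ⟨δ, h⟩, hZ⟩ := h
    exact isIso_of_realizes_of_isZero_left (G.map_realizes h) (hG Z hZ)
  | comp f g _ _ _ _ =>
    rw [Functor.map_comp]
    infer_instance

lemma ExtriFunctor.φ_eq_zero {C X : A} {δ : Ext (E (A := A)) C X} (h : δ ∈ nullExt N C X) :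
    G.φ C X δ = 0 := by
  obtain ⟨K, ε, j, hK, rfl⟩ := h
  rw [G.φ_push, ext_eq_zero_of_isZero_right (hG K hK) (G.φ C K ε), map_zero]

lemma TrivExt.map_eq_of_extRel {X Y : TrivExt A} (f g : X ⟶ Y) (h : extRel N f g) :
    (TrivExt.map G).map f = (TrivExt.map G).map g := by
  ext
  · exact map_eq_of_inverts (G.inverts hG) h.1
  · refine sub_eq_zero.1 ((map_sub (G.φ X.as Y.as) f.extn g.extn).symm.trans ?_)
    exact G.φ_eq_zero hG h.2

omit [IsExtensionClosed N] in
lemma TrivExt.isIso_map {X Y : A} (s : X ⟶ Y) (hs : SN N s) :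
    IsIso ((TrivExt.map G).map ((TrivExt.zeroExt A).map s)) := by
  have := G.inverts hG s hs
  have h : (TrivExt.map G).map ((TrivExt.zeroExt A).map s) =
      (TrivExt.zeroExt A').map (G.functor.map s) :=
    TrivExt.hom_ext rfl (map_zero (G.φ X Y))
  rw [h]
  exact inferInstanceAs (IsIso ((TrivExt.zeroExt A').map (G.functor.map s)))

end

variable [EssentiallySmall.{v} A] [hN : Fact (IsAbsorbing N)]

noncomputable instance : Extriangulated (Loc N) := (extLoc N).extriangulated

/-- The localization functor as an exact functor. -/
noncomputable def locExtriFunctor : ExtriFunctor A (Loc N) where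
  functor := locFunctor N
  additive := inferInstance
  φ := locμ N
  φ_push := (extLoc N).μ_push
  φ_pull := (extLoc N).μ_pull
  map_realizes h := ExtLocalization.Realizes.map (L := extLoc N) h

section

variable {N} {A' : Type u₃} [Category.{v₃} A'] [Preadditive A'] [HasZeroObject A']
  [HasBinaryBiproducts A'] [Extriangulated A']

/-- The functors agree by strict uniqueness. On extensions, every `ε` becomes the image of some `δ`
after pushing out along an invertible map, and compatibility with pushouts lets that map be
cancelled. -/
lemma ExtriFunctor.ext_of_comp {G₁ G₂ : ExtriFunctor (Loc N) A'}
    (h : (locExtriFunctor N).comp G₁ = (locExtriFunctor N).comp G₂) : G₁ = G₂ := by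
  obtain ⟨F₁, hF₁, φ₁, push₁, pull₁, real₁⟩ := G₁
  obtain ⟨F₂, hF₂, φ₂, push₂, pull₂, real₂⟩ := G₂
  obtain rfl : F₁ = F₂ := locFunctor_uniq _ _ (congrArg ExtriFunctor.functor h)
  congr 1
  have h' := eq_of_heq (ExtriFunctor.ext_iff.1 h).2
  ext C X ε
  obtain ⟨C, rfl⟩ := exists_obj_eq N C
  obtain ⟨X, rfl⟩ := exists_obj_eq N X
  obtain ⟨X', t, δ, ht, hε⟩ := (extLoc N).exists_push ε
  have := (extLoc N).inverts ht
  have e : φ₁ _ _ (locμ N C X' δ) = φ₂ _ _ (locμ N C X' δ) :=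
    DFunLike.congr_fun (congrFun (congrFun h' C) X') δ
  have e₁ := push₁ ((locFunctor N).map t) ε
  have e₂ := push₂ ((locFunctor N).map t) ε
  replace hε : push E ((locFunctor N).map t) ε = locμ N C X' δ := hε
  rw [hε] at e₁ e₂
  have e₃ := e₁.symm.trans (e.trans e₂)
  have : IsIso ((locFunctor N).map t) := (extLoc N).inverts ht
  have e₄ := congrArg (push E (inv (F₁.map ((locFunctor N).map t)))) e₃
  rwa [← push_comp, ← push_comp, IsIso.hom_inv_id, push_id, push_id] at e₄

variable (G : ExtriFunctor A A') (hG : ∀ X, N X → IsZero (G.functor.obj X))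

/-- The functor induced on the localized trivial extension. -/
noncomputable def trivLocLift : TrivLoc N ⥤ TrivExt A' :=
  trivLift N (TrivExt.map G) (fun _ _ => TrivExt.map_eq_of_extRel G hG)
    (fun _ _ => TrivExt.isIso_map G hG)

lemma trivLocLift_map {X Y : A} (f : X ⟶ Y) (δ : Ext (E (A := A)) X Y) :
    (trivLocLift G hG).map (trivHom N f δ) = (TrivExt.map G).map (⟨f, δ⟩ : TrivExt.Hom ⟨X⟩ ⟨Y⟩) :=
  trivLift_map _ _ _ _ f δ

instance : (trivLocLift G hG).Additive :=
  additive_of_trivProj_comp _ _ (by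
    have : trivProj N ⋙ SmallLoc.functor (trivSN N) ⋙ trivLocLift G hG = TrivExt.map G :=
      trivLift_fac _ _ _ _
    rw [this]
    infer_instance)

/-- The functor induced on the localized category. -/
noncomputable def locDesc : Loc N ⥤ A' := locLift G.functor (G.inverts hG)

lemma trivLocLift_comp : locToTriv N ⋙ trivLocLift G hG = locDesc G hG ⋙ TrivExt.zeroExt A' := by
  apply locFunctor_uniq
  refine CategoryTheory.Functor.ext (fun _ => rfl) (fun X Y f => ?_)
  refine Eq.trans ?_ ((Category.id_comp _).trans (Category.comp_id _)).symm
  refine (congrArg (trivLocLift G hG).map (locToTriv_map N f)).trans ?_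
  refine (trivLocLift_map G hG f 0).trans ?_
  refine Eq.trans ?_ (congrArg (TrivExt.zeroExt A').map
    (locLift_map G.functor (G.inverts hG) f)).symm
  exact TrivExt.hom_ext rfl (map_zero (G.φ X Y))

lemma trivLocLift_locToTriv_map {X Y : Loc N} (f : X ⟶ Y) :
    (trivLocLift G hG).map ((locToTriv N).map f) =
      (TrivExt.zeroExt A').map ((locDesc G hG).map f) :=
  (Functor.congr_hom (trivLocLift_comp G hG) f).trans
    ((Category.id_comp _).trans (Category.comp_id _))

end

end ET

namespace ET

open Extriangulated

variable {A : Type u} [Category.{v} A] [Preadditive A] [HasZeroObject A]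
  [HasBinaryBiproducts A] [Extriangulated A] {N : ObjectProperty A} [IsExtensionClosed N]
  [EssentiallySmall.{v} A] [hN : Fact (IsAbsorbing N)]

section

variable {A' : Type u₃} [Category.{v₃} A'] [Preadditive A'] [HasZeroObject A']
  [HasBinaryBiproducts A'] [Extriangulated A'] (G : ExtriFunctor A A')
  (hG : ∀ X, N X → IsZero (G.functor.obj X))

lemma locDesc_map {X Y : A} (f : X ⟶ Y) :
    (locDesc G hG).map ((locFunctor N).map f) = G.functor.map f :=
  locLift_map _ _ f

/-- The map on localized extensions induced by an exact functor. -/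
noncomputable def locDescExt (C X : Loc N) :
    Ext (E (A := Loc N)) C X →+
      Ext (E (A := A')) ((locDesc G hG).obj C) ((locDesc G hG).obj X) where
  toFun ε := ((trivLocLift G hG).map ε.1).extn
  map_zero' := congrArg TrivExt.Hom.extn ((trivLocLift G hG).map_zero _ _)
  map_add' ε ε' := congrArg TrivExt.Hom.extn
    ((trivLocLift G hG).map_add (f := ε.1) (g := ε'.1))

/-- Pushing out is composition in the localized trivial extension; the image of `a` has zero
extension component, so only the push term of the composite remains. -/
lemma locDescExt_push {C X X' : Loc N} (a : X ⟶ X') (ε : Ext (E (A := Loc N)) C X) :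
    locDescExt G hG C X' (push E a ε) =
      push E ((locDesc G hG).map a) (locDescExt G hG C X ε) := by
  have h := ((trivLocLift G hG).map_comp ε.1 ((locToTriv N).map a)).trans
    (congrArg ((trivLocLift G hG).map ε.1 ≫ ·) (trivLocLift_locToTriv_map G hG a))
  refine (congrArg TrivExt.Hom.extn h).trans ((TrivExt.comp_extn _ _).trans ?_)
  exact (congrArg (_ + ·) (map_zero (pull E _))).trans (add_zero _)

lemma locDescExt_pull {C C' X : Loc N} (c : C' ⟶ C) (ε : Ext (E (A := Loc N)) C X) :
    locDescExt G hG C' X (pull E c ε) =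
      pull E ((locDesc G hG).map c) (locDescExt G hG C X ε) := by
  have h := ((trivLocLift G hG).map_comp ((locToTriv N).map c) ε.1).trans
    (congrArg (· ≫ (trivLocLift G hG).map ε.1) (trivLocLift_locToTriv_map G hG c))
  refine (congrArg TrivExt.Hom.extn h).trans ((TrivExt.comp_extn _ _).trans ?_)
  exact (congrArg (· + _) (map_zero (push E _))).trans (zero_add _)

lemma locDescExt_locμ {C X : A} (δ : Ext (E (A := A)) C X) :
    locDescExt G hG _ _ (locμ N C X δ) = G.φ C X δ :=
  congrArg TrivExt.Hom.extn (trivLocLift_map G hG 0 δ)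

/-- The exact functor on the localized category induced by an exact functor vanishing on `N`. -/
noncomputable def locExtriDesc : ExtriFunctor (Loc N) A' where
  functor := locDesc G hG
  additive := additive_of_locFunctor_comp _ (by
    have : locFunctor N ⋙ locDesc G hG = G.functor := locFunctor_fac N _ _
    rw [this]
    exact G.additive)
  φ := locDescExt G hG
  φ_push := locDescExt_push G hG
  φ_pull := locDescExt_pull G hG
  map_realizes {X Y Z x y ε} h := by
    obtain ⟨X₀, Y₀, Z₀, x₀, y₀, δ₀, α, β, γ, h0, h1, h2, h3⟩ := h
    refine realizes_of_isos (G.map_realizes h0) ((locDesc G hG).mapIso α)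
      ((locDesc G hG).mapIso β) ((locDesc G hG).mapIso γ) ?_ ?_ ?_
    · refine ((locDesc G hG).map_comp x β.hom).symm.trans ((congrArg (locDesc G hG).map h1).trans
        (((locDesc G hG).map_comp _ _).trans ?_))
      exact congrArg ((locDesc G hG).map α.hom ≫ ·) (locDesc_map G hG x₀)
    · refine ((locDesc G hG).map_comp y γ.hom).symm.trans ((congrArg (locDesc G hG).map h2).trans
        (((locDesc G hG).map_comp _ _).trans ?_))
      exact congrArg ((locDesc G hG).map β.hom ≫ ·) (locDesc_map G hG y₀)
    · refine (locDescExt_push G hG α.hom ε).symm.trans ((congrArg (locDescExt G hG _ _) h3).trans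
        ((locDescExt_pull G hG γ.hom _).trans ?_))
      exact congrArg (pull E ((locDesc G hG).map γ.hom)) (locDescExt_locμ G hG δ₀)

lemma locExtriFunctor_comp_desc : (locExtriFunctor N).comp (locExtriDesc G hG) = G :=
  ExtriFunctor.ext (locFunctor_fac N _ _) (heq_of_eq (funext fun _ => funext fun _ =>
    AddMonoidHom.ext fun δ => locDescExt_locμ G hG δ))

end

variable (N) in
lemma isExactSequence_locExtriFunctor : IsExactSequence.{v₃, u₃} N (locExtriFunctor N) := by
  have h1 : N = (incl N).functor.essImage := by
    ext X
    constructor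
    · intro hX
      exact ⟨⟨X, hX⟩, ⟨Iso.refl _⟩⟩
    · rintro ⟨Y, ⟨e⟩⟩
      exact N.prop_of_iso e Y.property
  refine ⟨h1, ?_, ?_⟩
  · rw [← h1]
    ext X
    exact ((extLoc N).isZero_iff X).symm
  · intro A' _ _ _ _ _ G hG
    have hG' : ∀ X, N X → IsZero (G.functor.obj X) := fun X hX => hG ⟨X, hX⟩
    exact ⟨locExtriDesc G hG', locExtriFunctor_comp_desc G hG', fun G' h =>
      ExtriFunctor.ext_of_comp (h.trans (locExtriFunctor_comp_desc G hG').symm)⟩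

end ET

theorem mainTheorem2
    {k : Type w} [CommRing k]
    {A : Type u} [Category.{v} A] [Preadditive A] [HasZeroObject A] [HasBinaryBiproducts A]
    [Linear k A] [Extriangulated A] [EssentiallySmall.{v} A] (hA : IsWIC A)
    (N : ObjectProperty A) [IsExtensionClosed N] (hN : IsSummandClosed N) (hs : Spade N) :
    IsThick N ∧
    SN N = compClass (DefSpN N) (InfN N) ∧
    SN N = compClass (DefN N) (InfSpN N) ∧
    MR1 (SN N) ∧ MR2 (SN N) ∧ MR3 (SN N) ∧ MR4 (SN N) ∧
    ∃ (B : Type u) (_ : Category.{v} B) (_ : Preadditive B) (_ : HasZeroObject B)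
      (_ : HasBinaryBiproducts B) (_ : Extriangulated B) (Q : ExtriFunctor A B),
      EssentiallySmall.{v} B ∧
      Q.functor.IsLocalization (SN N) ∧
      IsExactSequence.{v₃, u₃} N Q ∧
      ∃ _ : Linear k B, Q.functor.Linear k ∧
        ∀ (A' : Type u₃) [Category.{v₃} A'] [Preadditive A'] [HasZeroObject A']
          [HasBinaryBiproducts A'] [Linear k A'] [Extriangulated A'] (G' : ExtriFunctor B A'),
          (Q.comp G').functor.Linear k → G'.functor.Linear k := by
  have hN' := IsAbsorbing.of_spade hA hN hs
  have : Fact (IsAbsorbing N) := ⟨hN'⟩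
  refine ⟨hN'.isThick hN, hN'.SN_eq, hN'.SN_eq', mr1 N, mr2 N, mr3 N, mr4 N, Loc N, inferInstance,
    inferInstance, inferInstance, inferInstance, inferInstance, locExtriFunctor N, inferInstance,
    inferInstanceAs ((locFunctor N).IsLocalization (SN N)), isExactSequence_locExtriFunctor N,
    Localization.linear k (locFunctor N) (SN N),
    Localization.functor_linear k (locFunctor N) (SN N), ?_⟩
  intro A' _ _ _ _ _ _ G' h
  let : Linear k (Loc N) := Localization.linear k (locFunctor N) (SN N)
  have : (locFunctor N).Linear k := Localization.functor_linear k _ _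
  -- Linearity of a functor on the localization is tested after composing with the localization
  -- functor; the required comparison isomorphism is the identity.
  let : Localization.Lifting (locFunctor N) (SN N) (locFunctor N ⋙ G'.functor) G'.functor :=
    ⟨Iso.refl _⟩
  exact (Localization.functor_linear_iff (locFunctor N) (SN N) k (locFunctor N ⋙ G'.functor)
    G'.functor).1 h
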